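/- Let $q\in\mathbb C$ with $0<|q|<1$, and fix a square root $q^{1/2}$ of $q$. For a partition $\nu$ with conjugate $\nu'$, write $|\nu|$ for its size, $\kappa_\nu=\sum_{i\ge1}\nu_i(\nu_i-2i+1)$ (an even integer), and $\rho=(-\tfrac12,-\tfrac32,\dots)$; $q^{-\nu-\rho+c}$ denotes the sequence $(q^{-\nu_i+i-1/2+c})_{i\ge1}$ and $p_n(x)=\sum_i x_i^n$. *Topological vertex and Hopf-link invariant.* With $s_{\lambda/\eta}$ the skew Schur functions, let $$C_{\lambda\mu\nu}=q^{\kappa_\mu/2}\,s_{\nu'}(q^{-\rho})\sum_\eta s_{\lambda'/\eta}(q^{-\nu-\rho})\,s_{\mu/\eta}(q^{-\nu'-\rho}),\qquad W_{\lambda\mu}(q)=q^{\kappa_\mu/2}\,C_{\varnothing\lambda\mu'} .$$ *Fock space.* Let $\psi_r,\psi^\dagger_r$ ($r\in\mathbb Z+\tfrac12$) be free fermions, $\{\psi_r,\psi^\dagger_s\}=\delta_{r+s,0}$, $\{\psi_r,\psi_s\}=\{\psi^\dagger_r,\psi^\dagger_s\}=0$, acting on their Fock space with vacuum $|0\rangle$,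 where $\psi_r|0\rangle=\psi_r^\dagger|0\rangle=0$ for $r>0$; let $\langle0|$ be the dual vacuum and let $a_n=-\sum_r:\!\psi_r\psi^\dagger_{n-r}\!:$. The standard basis is $$|\lambda\rangle=\prod_{i:\ i\le\lambda_i}\Big[(-1)^{-\lambda_i+i}\,\psi_{-\lambda_i'+i-1/2}\,\psi^\dagger_{-\lambda_i+i-1/2}\Big]|0\rangle,$$ and $\langle\lambda|$ is its transpose under $\psi_r\leftrightarrow\psi_{-r}^\dagger$ (so $\langle\lambda|\mu\rangle=\delta_{\lambda\mu}$). The S-dual basis is $$|\lambda\rangle_{\mathcal S}=\mathcal N_\lambda\exp\Big[-\sum_{n>0}\frac{a_{-n}}n\,p_n(q^{-\lambda'-\rho-1/2})\Big]|0\rangle,\qquad {}_{\mathcal S}\langle\lambda|=\mathcal N'_\lambda\,\langle0|\exp\Big[\sum_{n>0}\frac{a_n}n\,p_n(q^{-\lambda-\rho+1/2})\Big],$$ $$\mathcal N_\lambda=\Big[(-1)^{|\lambda|}q^{\kappa_\lambda/2-|\lambda|}\prod_{i,j>0}(1-q^{-\lambda_i-\lambda'_j+i+j-1})^{-1}\Big]^{1/2},\qquad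 \mathcal N'_\lambda=(-1)^{|\lambda|}\Big[(-1)^{|\lambda|}q^{-\kappa_\lambda/2+|\lambda|}\prod_{i,j>0}(1-q^{-\lambda_i-\lambda'_j+i+j-1})^{-1}\Big]^{1/2}.$$ Here $[\cdot]^{1/2}$ is the continuous branch on the punctured disc $0<|q|<1$ that is positive for $0<q<1$. **Proposition.** For every $\nu$ the infinite product above converges, and both square-root branches exist (they are unique). For all partitions $\lambda,\mu$, $$W_{\lambda\mu}(q)=q^{\frac{\kappa_\lambda}2+\frac{\kappa_\mu}2}\,(-q^{-1/2})^{|\lambda|+|\mu|}\,\mathcal N_\varnothing^{-1}\;{}_{\mathcal S}\langle\lambda|\mu\rangle =q^{\frac{\kappa_\lambda}2+\frac{\kappa_\mu}2}\,q^{\frac12|\lambda|+\frac12|\mu|}\,\mathcal N_\varnothing^{-1}\,\langle\mu'|\lambda'\rangle_{\mathcal S},$$ and also $W_{\lambda\mu}(q)=q^{\kappa_\lambda/2}\,C_{\varnothing\mu\lambda'}$. Moreover $\mathcal N_\varnothing=\prod_{n\ge1}(1-q^n)^{-n/2}$ (principal powers), the square root of the MacMahon function: $\mathcal N_\varnothing^2=\prod_{n\ge1}(1-q^n)^{-n}$.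 -/

import Mathlib

noncomputable section

namespace SDual

/-! ### Partitions

A partition `ν` is a `YoungDiagram` in English notation.  Rows and columns are indexed from `0`, so
`ν.rowLen i` is the usual `ν_{i+1}`, `ν.colLen j` is `ν'_{j+1}`, and the empty partition is `⊥`. -/

/-- `κ_ν = ∑_{i ≥ 1} ν_i (ν_i - 2 i + 1)`. -/
def kappa (ν : YoungDiagram) : ℤ :=
  ∑ i ∈ Finset.range (ν.colLen 0), (ν.rowLen i : ℤ) * ((ν.rowLen i : ℤ) - 2 * ((i : ℤ) + 1) + 1)

/-- `κ_ν` is even, so the integer quotient `kappa ν / 2` below is exact. -/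
theorem two_dvd_kappa (ν : YoungDiagram) : (2 : ℤ) ∣ kappa ν := by
  refine Finset.dvd_sum fun i _ => ?_
  obtain ⟨c, hc⟩ := (Int.even_mul_succ_self (ν.rowLen i : ℤ)).two_dvd
  exact ⟨c - (ν.rowLen i : ℤ) * ((i : ℤ) + 1), by linear_combination hc⟩

/-- The number of diagonal boxes. -/
def diag (ν : YoungDiagram) : ℕ :=
  ((Finset.range (ν.colLen 0)).filter fun i => i < ν.rowLen i).card

/-! ### Skew Schur functions, topological vertex, Hopf-link invariant -/

/-- Semistandard tableaux of skew shape `lam / eta` with entries in `ℕ`; the entry is `0` off the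
shape. -/
structure SkewSSYT (lam eta : YoungDiagram) where
  entry : ℕ → ℕ → ℕ
  row_weak : ∀ i j₁ j₂ : ℕ, j₁ < j₂ → (i, j₁) ∈ lam.cells \ eta.cells →
    (i, j₂) ∈ lam.cells \ eta.cells → entry i j₁ ≤ entry i j₂
  col_strict : ∀ i₁ i₂ j : ℕ, i₁ < i₂ → (i₁, j) ∈ lam.cells \ eta.cells →
    (i₂, j) ∈ lam.cells \ eta.cells → entry i₁ j < entry i₂ j
  zeros : ∀ i j : ℕ, (i, j) ∉ lam.cells \ eta.cells → entry i j = 0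

open Classical in
/-- The skew Schur function `s_{lam/eta}(x_0, x_1, …)`; it is `0` unless `eta ⊆ lam`. -/
def skewSchur (lam eta : YoungDiagram) (x : ℕ → ℂ) : ℂ :=
  if eta ≤ lam then
    ∑' T : SkewSSYT lam eta, ∏ c ∈ lam.cells \ eta.cells, x (T.entry c.1 c.2)
  else 0

/-- The Schur function `s_lam(x_0, x_1, …)`. -/
def schur (lam : YoungDiagram) (x : ℕ → ℂ) : ℂ := skewSchur lam ⊥ x

/-- The sequence `q^{-ν-ρ-1/2}`, where `ρ = (-1/2, -3/2, …)`.  With `t = q^{1/2}`, the sequences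
`q^{-ν-ρ}` and `q^{-ν-ρ+1/2}` are `t` times and `q` times this one. -/
def qSeq (q : ℂ) (ν : YoungDiagram) (i : ℕ) : ℂ := q ^ ((i : ℤ) - (ν.rowLen i : ℤ))

/-- The power sum `p_n(x) = ∑_i x_i^n`. -/
def powerSum (n : ℕ) (x : ℕ → ℂ) : ℂ := ∑' i, x i ^ n

/-- The topological vertex `C_{lam mu nu}` at `q`, with `t = q^{1/2}`. -/
def vertex (q t : ℂ) (lam mu nu : YoungDiagram) : ℂ :=
  q ^ (kappa mu / 2) * schur nu.transpose (fun i => t * qSeq q ⊥ i) *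
    ∑ᶠ eta : YoungDiagram,
      skewSchur lam.transpose eta (fun i => t * qSeq q nu i) *
        skewSchur mu eta (fun i => t * qSeq q nu.transpose i)

/-- The Hopf-link invariant `W_{lam mu}(q) = q^{κ_mu / 2} C_{∅ lam mu'}`. -/
def hopfLink (q t : ℂ) (lam mu : YoungDiagram) : ℂ :=
  q ^ (kappa mu / 2) * vertex q t ⊥ lam mu.transpose

/-! ### The fermionic Fock space -/

/-- The space of creation modes: `Sum.inl j` stands for `ψ_{-(j+1/2)}` and `Sum.inr j` stands for
`ψ†_{-(j+1/2)}`. -/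
abbrev Modes : Type := (ℕ ⊕ ℕ) →₀ ℂ

/-- The fermionic Fock space (of finite vectors, all charges): the exterior algebra on the creation
modes, with the vacuum `1`. -/
abbrev Fock : Type := ExteriorAlgebra ℂ Modes

/-- The creation operator of a mode. -/
def create (s : ℕ ⊕ ℕ) : Module.End ℂ Fock :=
  LinearMap.mulLeft ℂ (ExteriorAlgebra.ι ℂ (Finsupp.single s 1) : Fock)

/-- The annihilation operator adjoint to `create s`: contraction with the dual basis vector. -/
def annihilate (s : ℕ ⊕ ℕ) : Module.End ℂ Fock :=
  CliffordAlgebra.contractLeft (Q := (0 : QuadraticForm ℂ Modes))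
    (Finsupp.lapply s : Modes →ₗ[ℂ] ℂ)

/-- The mode `ψ_{k+1/2}` of the free fermion. -/
def psi : ℤ → Module.End ℂ Fock
  | Int.ofNat j => annihilate (Sum.inr j)
  | Int.negSucc j => create (Sum.inl j)

/-- The mode `ψ†_{k+1/2}` of the free fermion. -/
def psiDag : ℤ → Module.End ℂ Fock
  | Int.ofNat j => annihilate (Sum.inl j)
  | Int.negSucc j => create (Sum.inr j)

/-- The normal ordered product `: ψ_{k+1/2} ψ†_{l+1/2} :` (annihilators to the right). -/
def normalOrdered (k l : ℤ) : Module.End ℂ Fock :=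
  if 0 ≤ k then -(psiDag l * psi k) else psi k * psiDag l

theorem exists_annihilate_eq_zero (v : Fock) :
    ∃ N : ℕ, ∀ j, N ≤ j → annihilate (Sum.inl j) v = 0 ∧ annihilate (Sum.inr j) v = 0 := by
  induction v using CliffordAlgebra.left_induction with
  | algebraMap r =>
    have key : ∀ s : ℕ ⊕ ℕ,
        annihilate s (algebraMap ℂ (CliffordAlgebra (0 : QuadraticForm ℂ Modes)) r) = 0 :=
      fun s => CliffordAlgebra.contractLeft_algebraMap (Q := (0 : QuadraticForm ℂ Modes))
        (d := (Finsupp.lapply s : Modes →ₗ[ℂ] ℂ)) r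
    exact ⟨0, fun j _ => ⟨key _, key _⟩⟩
  | add x y hx hy =>
    obtain ⟨N, hN⟩ := hx
    obtain ⟨M, hM⟩ := hy
    refine ⟨max N M, fun j hj => ?_⟩
    obtain ⟨h1, h2⟩ := hN j (le_trans (le_max_left _ _) hj)
    obtain ⟨h3, h4⟩ := hM j (le_trans (le_max_right _ _) hj)
    exact ⟨by rw [map_add, h1, h3, add_zero], by rw [map_add, h2, h4, add_zero]⟩
  | ι_mul x m hx =>
    obtain ⟨N, hN⟩ := hx
    have key : ∀ s : ℕ ⊕ ℕ, m s = 0 → annihilate s x = 0 →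
        annihilate s (CliffordAlgebra.ι (0 : QuadraticForm ℂ Modes) m * x) = 0 := by
      intro s h1 h2
      have h3 := CliffordAlgebra.contractLeft_ι_mul (Q := (0 : QuadraticForm ℂ Modes))
        (d := (Finsupp.lapply s : Modes →ₗ[ℂ] ℂ)) m x
      unfold annihilate at h2 ⊢
      rw [h3, h2, Finsupp.lapply_apply, h1, zero_smul, mul_zero, sub_zero]
    obtain ⟨K, hK⟩ : ∃ K : ℕ, ∀ j, K ≤ j → m (Sum.inl j) = 0 ∧ m (Sum.inr j) = 0 := by
      refine ⟨m.support.sup (Sum.elim id id) + 1, fun j hj => ⟨?_, ?_⟩⟩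
      · by_contra h
        have h' := Finset.le_sup (f := Sum.elim id id) (Finsupp.mem_support_iff.2 h)
        simp only [Sum.elim_inl, id] at h'
        omega
      · by_contra h
        have h' := Finset.le_sup (f := Sum.elim id id) (Finsupp.mem_support_iff.2 h)
        simp only [Sum.elim_inr, id] at h'
        omega
    refine ⟨max N K, fun j hj => ?_⟩
    obtain ⟨h1, h2⟩ := hN j (le_trans (le_max_left _ _) hj)
    obtain ⟨h3, h4⟩ := hK j (le_trans (le_max_right _ _) hj)
    exact ⟨key _ h3 h1, key _ h4 h2⟩

/-- On each vector only finitely many terms of `∑_r : ψ_r ψ†_{n-r} :` are nonzero. -/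
theorem finite_support_normalOrdered (n : ℤ) (v : Fock) :
    (Function.support fun k : ℤ => normalOrdered k (n - k - 1) v).Finite := by
  obtain ⟨N, hN⟩ := exists_annihilate_eq_zero v
  refine (Set.finite_Icc (-(N : ℤ) - |n| - 1) (N : ℤ)).subset fun k hk => ?_
  by_contra hk'
  apply hk
  rw [Set.mem_Icc, not_and_or] at hk'
  have hn := neg_abs_le n
  show normalOrdered k (n - k - 1) v = 0
  unfold normalOrdered
  rcases hk' with h | h
  · rw [if_neg (by have := abs_nonneg n; omega)]
    obtain ⟨j, hj⟩ := Int.eq_ofNat_of_zero_le (show 0 ≤ n - k - 1 by omega)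
    have : psiDag (n - k - 1) v = 0 := by
      rw [hj]; exact (hN j (by omega)).1
    rw [Module.End.mul_apply, this, map_zero]
  · rw [if_pos (by omega)]
    obtain ⟨j, hj⟩ := Int.eq_ofNat_of_zero_le (show 0 ≤ k by omega)
    have : psi k v = 0 := by
      rw [hj]; exact (hN j (by omega)).2
    rw [LinearMap.neg_apply, Module.End.mul_apply, this, map_zero, neg_zero]

/-- The bosonic mode `a_n = - ∑_{r ∈ ℤ + 1/2} : ψ_r ψ†_{n-r} :` (here `r = k + 1/2`). -/
def boson (n : ℤ) : Module.End ℂ Fock where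
  toFun v := -∑ᶠ k : ℤ, normalOrdered k (n - k - 1) v
  map_add' v w := by
    simp only [map_add]
    rw [finsum_add_distrib (finite_support_normalOrdered n v) (finite_support_normalOrdered n w),
      neg_add]
  map_smul' c v := by
    simp only [map_smul, RingHom.id_apply]
    rw [← smul_finsum' c (finite_support_normalOrdered n v), smul_neg]

/-- The vacuum bra `⟨0|`: the coefficient of the vacuum. -/
def vacBra : Module.Dual ℂ Fock :=
  (ExteriorAlgebra.algebraMapInv : Fock →ₐ[ℂ] ℂ).toLinearMap

/-- The standard fermionic basis
`|ν⟩ = ∏_{i=1}^{diag ν} [(-1)^{-ν_i+i} ψ_{-ν'_i+i-1/2} ψ†_{-ν_i+i-1/2}] |0⟩`. -/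
def ket (ν : YoungDiagram) : Fock :=
  ((List.range (diag ν)).map fun i : ℕ =>
    ((-1 : ℂ) ^ (-(ν.rowLen i : ℤ) + ((i : ℤ) + 1))) •
      (psi ((i : ℤ) - ν.colLen i) * psiDag ((i : ℤ) - ν.rowLen i))).prod (1 : Fock)

/-- The dual basis `⟨ν|`, the transpose of `|ν⟩` under `ψ_r ↔ ψ†_{-r}`:
`⟨ν| = ⟨0| ∏_{i=diag ν}^{1} [(-1)^{-ν_i+i} ψ_{ν_i-i+1/2} ψ†_{ν'_i-i+1/2}]`. -/
def bra (ν : YoungDiagram) : Module.Dual ℂ Fock :=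
  vacBra ∘ₗ ((List.range (diag ν)).reverse.map fun i : ℕ =>
    ((-1 : ℂ) ^ (-(ν.rowLen i : ℤ) + ((i : ℤ) + 1))) •
      (psi ((ν.rowLen i : ℤ) - i - 1) * psiDag ((ν.colLen i : ℤ) - i - 1))).prod

/-! ### The S-dual basis -/

/-- The degree-`d` part of `exp (∑_{n>0} A_n)`, where `A_n` has degree `n`:
the sum over `k` of `1/k!` times the sum of all `A_{n_1} ⋯ A_{n_k}` with `n_1 + ⋯ + n_k = d`. -/
def expPart (A : ℕ → Module.End ℂ Fock) (d : ℕ) : Module.End ℂ Fock :=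
  ∑ k ∈ Finset.range (d + 1), ((k.factorial : ℂ)⁻¹) •
    PowerSeries.coeff d ((PowerSeries.mk fun n => if n = 0 then 0 else A n) ^ k)

/-- `g` is the branch of `f^{1/2}` on the punctured unit disc that is positive on `(0, 1)`. -/
structure IsSqrtBranch (f g : ℂ → ℂ) : Prop where
  continuousOn : ContinuousOn g {q : ℂ | q ≠ 0 ∧ ‖q‖ < 1}
  sq_eq : ∀ q : ℂ, q ≠ 0 → ‖q‖ < 1 → g q ^ 2 = f q
  pos : ∀ x : ℝ, 0 < x → x < 1 → ∃ y : ℝ, 0 < y ∧ g (x : ℂ) = (y : ℂ)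

/-- The branch of `f^{1/2}` on the punctured unit disc that is positive on `(0, 1)`; there is at
most one such branch on the punctured disc when `f` has no zeros there. -/
def sqrtBranch (f : ℂ → ℂ) : ℂ → ℂ := Classical.epsilon (IsSqrtBranch f)

/-- The factor `(1 - q^{-ν_i-ν'_j+i+j-1})^{-1}` (with `i`, `j` shifted to start at `0`). -/
def hookFactor (ν : YoungDiagram) (q : ℂ) (p : ℕ × ℕ) : ℂ :=
  (1 - q ^ (-(ν.rowLen p.1 : ℤ) - (ν.colLen p.2 : ℤ) + (p.1 : ℤ) + (p.2 : ℤ) + 1))⁻¹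

/-- The quantity under the square root in `N_ν`. -/
def normSq (ν : YoungDiagram) (q : ℂ) : ℂ :=
  (-1) ^ ν.card * q ^ (kappa ν / 2 - (ν.card : ℤ)) * ∏' p : ℕ × ℕ, hookFactor ν q p

/-- The quantity under the square root in `N'_ν`. -/
def normSq' (ν : YoungDiagram) (q : ℂ) : ℂ :=
  (-1) ^ ν.card * q ^ (-(kappa ν / 2) + (ν.card : ℤ)) * ∏' p : ℕ × ℕ, hookFactor ν q p

/-- The normalizing constant `N_ν`. -/
def norm (ν : YoungDiagram) (q : ℂ) : ℂ := sqrtBranch (normSq ν) q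

/-- The normalizing constant `N'_ν`. -/
def norm' (ν : YoungDiagram) (q : ℂ) : ℂ := (-1) ^ ν.card * sqrtBranch (normSq' ν) q

/-- The S-dual ket `|ν⟩_S = N_ν exp[-∑_{n>0} (a_{-n}/n) p_n(q^{-ν'-ρ-1/2})] |0⟩`, an element of the
completed Fock space, given by its component of each degree `d`. -/
def dualKet (q : ℂ) (ν : YoungDiagram) (d : ℕ) : Fock :=
  norm ν q • expPart (fun n => (-(powerSum n (qSeq q ν.transpose) / (n : ℂ))) • boson (-(n : ℤ))) d
    (1 : Fock)

/-- The S-dual bra `_S⟨ν| = N'_ν ⟨0| exp[∑_{n>0} (a_n/n) p_n(q^{-ν-ρ+1/2})]`, given by its component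
of each degree `d`. -/
def dualBra (q : ℂ) (ν : YoungDiagram) (d : ℕ) : Module.Dual ℂ Fock :=
  norm' ν q • vacBra ∘ₗ
    expPart (fun n => (powerSum n (fun i => q * qSeq q ν i) / (n : ℂ)) • boson (n : ℤ)) d

/-- `_S⟨lam|mu⟩`. -/
def dualBraKet (q : ℂ) (lam mu : YoungDiagram) : ℂ := ∑ᶠ d : ℕ, dualBra q lam d (ket mu)

/-- `⟨lam|mu⟩_S`. -/
def braDualKet (q : ℂ) (lam mu : YoungDiagram) : ℂ := ∑ᶠ d : ℕ, bra lam (dualKet q mu d)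

end SDual

end

/-! Write t = q^{1/2}, x_λ = (q^{i-1-λ_i})_{i≥1}, n(λ) = ∑ (i-1)λ_i, and H_λ for the product of 1 -
q^h over the hook lengths h of λ. Everything is compared with q^{κ_λ/2+κ_μ/2} t^{|λ|+|μ|} s_μ(x_λ)
s_λ(x_∅).

Vertex side. With one empty leg the sum over η in C collapses to η = ∅, and C becomes a product of
two ordinary Schur functions. This gives the expression above for the form with C_{∅μλ'}, and the
same with λ and μ exchanged for W. The two agree by `schur_symm`: by the bialternant formula in N
variables, s_λ(x_μ) s_μ(x_∅) is a ratio of determinants with entries q^{(j-μ_j)(λ_i-i)}, which is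
symmetric in λ and μ; then N → ∞.

Fock side. The bosons act on fermions by shifting indices, so a_n acts as a derivation on a product
of fermions, and d times the degree-d part of the exponential satisfies Newton's recursion. The
Jacobi-Trudi determinant satisfies the same recursion, and Wick's theorem gives the common value in
degree 0. Hence `pairing_annProd`, used once on Fock space and once on its dual, evaluates both
matrix elements as Jacobi-Trudi determinants (`vacBra_expPart_ket`, `bra_expPart_one`).
`schur_eq_jacobiTrudi` identifies these with the tableau sums s_μ: in finitely many variables both
obey the branching rule for the last variable, and the infinite case is a limit.

Normalization. The integers λ_i - i and j - 1 - λ'_j together exhaust ℤ. Grouping factors along this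
splitting gives both s_λ(x_∅) = q^{n(λ)}/H_λ and the infinite product as the MacMahon product times
explicit hook factors. The quantities under the square roots are then the MacMahon function times
the square of q^k/H_λ, so N_λ = N_∅ q^{n(λ')}/H_λ and N'_λ = (-1)^{|λ|} N_∅ q^{|λ|+n(λ)}/H_λ. Thus
the normalizations supply exactly the missing factor s_λ(x_∅). The branch is unique because the
punctured disc is connected. -/

noncomputable section

namespace SDual

/-! ### Canonical anticommutation relations -/

/-- Canonical anticommutation relations; the index `k` stands for the mode `k + 1/2`. -/
structure IsFermion {V : Type*} [AddCommGroup V] [Module ℂ V] (ψ ψd : ℤ → Module.End ℂ V) :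
    Prop where
  psi_psi : ∀ k l v, ψ k (ψ l v) = -ψ l (ψ k v)
  psid_psid : ∀ k l v, ψd k (ψd l v) = -ψd l (ψd k v)
  psi_psid : ∀ k l v, ψ k (ψd l v) = (if k + l + 1 = 0 then v else 0) - ψd l (ψ k v)

theorem create_create (s u : ℕ ⊕ ℕ) (v : Fock) :
    create s (create u v) = -create u (create s v) := by
  have h := ExteriorAlgebra.ι_add_mul_swap (R := ℂ) (Finsupp.single s (1 : ℂ) : Modes)
    (Finsupp.single u (1 : ℂ))
  simp only [create, LinearMap.mulLeft_apply, ← mul_assoc]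
  rw [eq_neg_iff_add_eq_zero, ← add_mul, h, zero_mul]

theorem annihilate_annihilate (s u : ℕ ⊕ ℕ) (v : Fock) :
    annihilate s (annihilate u v) = -annihilate u (annihilate s v) :=
  CliffordAlgebra.contractLeft_comm (Q := (0 : QuadraticForm ℂ Modes))
    (d := (Finsupp.lapply s : Modes →ₗ[ℂ] ℂ)) (d' := (Finsupp.lapply u : Modes →ₗ[ℂ] ℂ)) v

theorem annihilate_create (s u : ℕ ⊕ ℕ) (v : Fock) :
    annihilate s (create u v) = (if s = u then v else 0) - create u (annihilate s v) := by
  have h := CliffordAlgebra.contractLeft_ι_mul (Q := (0 : QuadraticForm ℂ Modes))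
    (d := (Finsupp.lapply s : Modes →ₗ[ℂ] ℂ)) (Finsupp.single u (1 : ℂ)) v
  refine h.trans ?_
  rw [Finsupp.lapply_apply, Finsupp.single_apply]
  by_cases hsu : s = u
  · subst hsu; simp; rfl
  · rw [if_neg (Ne.symm hsu), if_neg hsu, zero_smul]; rfl

theorem annihilate_one (s : ℕ ⊕ ℕ) : annihilate s (1 : Fock) = 0 :=
  CliffordAlgebra.contractLeft_one (Q := (0 : QuadraticForm ℂ Modes))
    (d := (Finsupp.lapply s : Modes →ₗ[ℂ] ℂ))

theorem vacBra_create (s : ℕ ⊕ ℕ) (v : Fock) : vacBra (create s v) = 0 := by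
  simp [vacBra, create, ExteriorAlgebra.algebraMapInv]

theorem vacBra_one : vacBra (1 : Fock) = 1 := by simp [vacBra]

theorem psi_one {k : ℤ} (hk : 0 ≤ k) : psi k (1 : Fock) = 0 := by
  obtain ⟨j, rfl⟩ := Int.eq_ofNat_of_zero_le hk
  exact annihilate_one _

theorem psiDag_one {k : ℤ} (hk : 0 ≤ k) : psiDag k (1 : Fock) = 0 := by
  obtain ⟨j, rfl⟩ := Int.eq_ofNat_of_zero_le hk
  exact annihilate_one _

theorem vacBra_psi {k : ℤ} (hk : k < 0) (v : Fock) : vacBra (psi k v) = 0 := by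
  obtain ⟨j, rfl⟩ := Int.eq_negSucc_of_lt_zero hk
  exact vacBra_create _ _

theorem vacBra_psiDag {k : ℤ} (hk : k < 0) (v : Fock) : vacBra (psiDag k v) = 0 := by
  obtain ⟨j, rfl⟩ := Int.eq_negSucc_of_lt_zero hk
  exact vacBra_create _ _

/-- Since r = k + 1/2 and s = l + 1/2, the condition r + s = 0 reads k + l + 1 = 0. Each mode is a
creator or a contraction according to its sign, and the relations become those of wedging and
contracting. -/
theorem isFermion_fock : IsFermion psi psiDag where
  psi_psi k l v := by
    rcases k with a | a <;> rcases l with b | b <;> simp only [psi]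
    · exact annihilate_annihilate _ _ _
    · rw [annihilate_create]; simp
    · rw [annihilate_create]; simp
    · exact create_create _ _ _
  psid_psid k l v := by
    rcases k with a | a <;> rcases l with b | b <;> simp only [psiDag]
    · exact annihilate_annihilate _ _ _
    · rw [annihilate_create]; simp
    · rw [annihilate_create]; simp
    · exact create_create _ _ _
  psi_psid k l v := by
    rcases k with a | a <;> rcases l with b | b <;> simp only [psi, psiDag]
    · rw [annihilate_annihilate, if_neg (by simp only [Int.ofNat_eq_natCast]; omega), zero_sub]
    · rw [annihilate_create]
      have : (Sum.inr a = (Sum.inr b : ℕ ⊕ ℕ)) ↔ (Int.ofNat a + Int.negSucc b + 1 = 0) := by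
        rw [Sum.inr.injEq, Int.negSucc_eq, Int.ofNat_eq_natCast]; omega
      simp only [this]
    · rw [annihilate_create]
      have : (Sum.inl b = (Sum.inl a : ℕ ⊕ ℕ)) ↔ (Int.negSucc a + Int.ofNat b + 1 = 0) := by
        rw [Sum.inl.injEq, Int.negSucc_eq, Int.ofNat_eq_natCast]; omega
      simp only [this]
      abel
    · rw [create_create, if_neg (by rw [Int.negSucc_eq, Int.negSucc_eq]; omega), zero_sub]

/-! ### Normal ordering and commutators of the bosonic modes -/

theorem normalOrdered_apply (k l : ℤ) (v : Fock) :
    normalOrdered k l v = psi k (psiDag l v) - if 0 ≤ k ∧ k + l + 1 = 0 then v else 0 := by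
  unfold normalOrdered
  by_cases hk : 0 ≤ k
  · simp only [hk, if_true, true_and, LinearMap.neg_apply, Module.End.mul_apply]
    rw [isFermion_fock.psi_psid]; abel
  · simp [hk]

theorem normalOrdered_of_ne {k l : ℤ} (h : k + l + 1 ≠ 0) (v : Fock) :
    normalOrdered k l v = psi k (psiDag l v) := by
  simp [normalOrdered_apply, h]

theorem boson_apply (n : ℤ) (v : Fock) :
    boson n v = -∑ᶠ k : ℤ, normalOrdered k (n - k - 1) v := rfl

theorem boson_comp_sub (n : ℤ) (T : Module.End ℂ Fock) (v : Fock) :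
    boson n (T v) - T (boson n v) =
      -∑ᶠ k : ℤ, (normalOrdered k (n - k - 1) (T v) - T (normalOrdered k (n - k - 1) v)) := by
  have hf := finite_support_normalOrdered n v
  have hf' : (Function.support fun k : ℤ => T (normalOrdered k (n - k - 1) v)).Finite := by
    refine hf.subset fun k hk => ?_
    contrapose! hk
    simp only [Function.mem_support, not_not] at hk ⊢
    rw [hk, map_zero]
  rw [finsum_sub_distrib (finite_support_normalOrdered n (T v)) hf', boson_apply, boson_apply,
    map_neg, map_finsum T hf]
  abel

/-- In the commutator the normal-ordering scalar cancels, and only the summand whose ψ contracts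
with ψ†_s survives, namely k = -s-1. With the companion for ψ this is all that the later sections
use about how bosons act on fermions. -/
theorem boson_psiDag (n s : ℤ) (v : Fock) :
    boson n (psiDag s v) = psiDag (n + s) v + psiDag s (boson n v) := by
  rw [← sub_eq_iff_eq_add, boson_comp_sub, finsum_eq_single _ (-s - 1)]
  · rw [normalOrdered_apply, normalOrdered_apply, isFermion_fock.psid_psid, map_neg,
      isFermion_fock.psi_psid, map_sub, if_pos (by ring),
      show n - (-s - 1) - 1 = n + s by ring]
    split_ifs <;> simp
  · intro k hk
    rw [normalOrdered_apply, normalOrdered_apply, isFermion_fock.psid_psid, map_neg,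
      isFermion_fock.psi_psid, map_sub, if_neg (by omega)]
    split_ifs <;> simp

theorem boson_psi (n s : ℤ) (v : Fock) :
    boson n (psi s v) = -psi (n + s) v + psi s (boson n v) := by
  have key : ∀ l, psiDag l (psi s v) = (if s + l + 1 = 0 then v else 0) - psi s (psiDag l v) := by
    intro l
    rw [isFermion_fock.psi_psid]; abel
  rw [← sub_eq_iff_eq_add, boson_comp_sub, finsum_eq_single _ (n + s)]
  · rw [normalOrdered_apply, normalOrdered_apply, key, map_sub, map_sub,
      isFermion_fock.psi_psi _ s, if_pos (by ring)]
    split_ifs <;> simp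
  · intro k hk
    rw [normalOrdered_apply, normalOrdered_apply, key, map_sub, map_sub,
      isFermion_fock.psi_psi _ s, if_neg (by omega)]
    split_ifs <;> simp

/-- The commutator of a_n with the k-th summand of a_m is a difference of the summands of index k
and k + n in one and the same locally finite sum, so the total cancels by translation. The central
term could appear only for n + m = 0. -/
theorem commute_boson {n m : ℤ} (h : n + m ≠ 0) : Commute (boson n) (boson m) := by
  refine LinearMap.ext fun v => ?_
  rw [Module.End.mul_apply, Module.End.mul_apply, eq_comm, ← sub_eq_zero, boson_comp_sub]
  have hcomm : ∀ k : ℤ, normalOrdered k (m - k - 1) (boson n v) -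
      boson n (normalOrdered k (m - k - 1) v) =
      normalOrdered (k + n) (n + m - (k + n) - 1) v - normalOrdered k (n + m - k - 1) v := by
    intro k
    rw [normalOrdered_apply, normalOrdered_apply, map_sub, boson_psi, boson_psiDag,
      normalOrdered_of_ne (k := k + n) (by omega), normalOrdered_of_ne (k := k) (by omega),
      show n + m - (k + n) - 1 = m - k - 1 by ring, map_add,
      show n + (m - k - 1) = n + m - k - 1 by ring, add_comm k n]
    split_ifs <;> simp <;> abel
  simp only [hcomm]
  have hf := finite_support_normalOrdered (n + m) v
  have hf' : (Function.support fun k : ℤ =>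
      normalOrdered (k + n) (n + m - (k + n) - 1) v).Finite :=
    hf.preimage (f := fun k : ℤ => k + n) (add_left_injective n).injOn
  rw [finsum_sub_distrib hf' hf, neg_eq_zero, sub_eq_zero]
  exact finsum_comp_equiv (Equiv.addRight n) (f := fun k => normalOrdered k (n + m - k - 1) v)

theorem boson_one {n : ℤ} (hn : 0 < n) : boson n (1 : Fock) = 0 := by
  rw [boson_apply, neg_eq_zero]
  refine finsum_eq_zero_of_forall_eq_zero fun k => ?_
  unfold normalOrdered
  split_ifs with hk
  · rw [LinearMap.neg_apply, Module.End.mul_apply, psi_one hk, map_zero, neg_zero]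
  · rw [Module.End.mul_apply, psiDag_one (by omega), map_zero]

theorem vacBra_boson {n : ℤ} (hn : n < 0) (v : Fock) : vacBra (boson n v) = 0 := by
  rw [boson_apply, map_neg, map_finsum _ (finite_support_normalOrdered n v), neg_eq_zero]
  refine finsum_eq_zero_of_forall_eq_zero fun k => ?_
  unfold normalOrdered
  split_ifs with hk
  · rw [LinearMap.neg_apply, Module.End.mul_apply, map_neg, vacBra_psiDag (by omega), neg_zero]
  · rw [Module.End.mul_apply, vacBra_psi (by omega)]

/-! ### The recursion for exponentials -/

/-- The Euler derivation `X d/dX` on power series over a ring. -/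
def euler {R : Type*} [Ring R] (f : PowerSeries R) : PowerSeries R :=
  PowerSeries.mk fun n => (n : R) * PowerSeries.coeff n f

theorem coeff_euler {R : Type*} [Ring R] (f : PowerSeries R) (n : ℕ) :
    PowerSeries.coeff n (euler f) = (n : R) * PowerSeries.coeff n f := PowerSeries.coeff_mk _ _

theorem euler_mul {R : Type*} [Ring R] (f g : PowerSeries R) :
    euler (f * g) = euler f * g + f * euler g := by
  ext n
  simp only [coeff_euler, map_add, PowerSeries.coeff_mul, Finset.mul_sum, ← Finset.sum_add_distrib]
  refine Finset.sum_congr rfl fun p hp => ?_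
  rw [← Finset.HasAntidiagonal.mem_antidiagonal.1 hp, Nat.cast_add, add_mul, mul_assoc,
    (Nat.cast_commute p.2 (PowerSeries.coeff p.1 f)).symm.left_comm]

/-- The coefficients are operators, so the power rule for X d/dX needs f to commute with its own
derivative. -/
theorem euler_pow {R : Type*} [Ring R] {f : PowerSeries R} (h : Commute f (euler f)) (k : ℕ) :
    euler (f ^ (k + 1)) = ((k : PowerSeries R) + 1) * (euler f * f ^ k) := by
  induction k with
  | zero => simp
  | succ k ih =>
    rw [pow_succ' f (k + 1), euler_mul, ih]
    have h2 : f * (((k : PowerSeries R) + 1) * (euler f * f ^ k)) =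
        ((k : PowerSeries R) + 1) * (euler f * f ^ (k + 1)) := by
      have h3 : Commute f ((k : PowerSeries R) + 1) :=
        (Nat.cast_commute k f).symm.add_right (Commute.one_right f)
      rw [h3.left_comm, h.left_comm, pow_succ']
    rw [h2]
    push_cast
    rw [add_mul ((k : PowerSeries R) + 1) 1, one_mul, add_comm]

theorem coeff_pow_eq_zero {R : Type*} [Ring R] {f : PowerSeries R}
    (h : PowerSeries.coeff 0 f = 0) {k d : ℕ} (hd : d < k) :
    PowerSeries.coeff d (f ^ k) = 0 := by
  induction k generalizing d with
  | zero => omega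
  | succ k ih =>
    rw [pow_succ', PowerSeries.coeff_mul]
    refine Finset.sum_eq_zero fun p hp => ?_
    rw [Finset.HasAntidiagonal.mem_antidiagonal] at hp
    rcases Nat.eq_zero_or_pos p.1 with h0 | h0
    · rw [h0, h, zero_mul]
    · rw [ih (by omega), mul_zero]

/-- The generating series of the operators `A n`, `n > 0`. -/
def opSeries (A : ℕ → Module.End ℂ Fock) : PowerSeries (Module.End ℂ Fock) :=
  PowerSeries.mk fun n => if n = 0 then 0 else A n

/-- The series has no constant term, so powers beyond d do not reach degree d; a common cut-off D
allows parts of different degrees to be compared. -/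
theorem expPart_eq_sum (A : ℕ → Module.End ℂ Fock) {d D : ℕ} (h : d < D) :
    expPart A d = ∑ k ∈ Finset.range D,
      ((k.factorial : ℂ)⁻¹) • PowerSeries.coeff d (opSeries A ^ k) := by
  refine Finset.sum_subset (Finset.range_subset_range.2 h) fun k _ hk => ?_
  rw [coeff_pow_eq_zero (by simp), smul_zero]
  simpa using hk

theorem expPart_zero (A : ℕ → Module.End ℂ Fock) : expPart A 0 = 1 := by
  simp [expPart]

theorem commute_opSeries {A : ℕ → Module.End ℂ Fock}
    (hA : ∀ n m, 0 < n → 0 < m → Commute (A n) (A m)) :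
    Commute (opSeries A) (euler (opSeries A)) := by
  ext d : 1
  rw [PowerSeries.coeff_mul, PowerSeries.coeff_mul, ← Finset.Nat.sum_antidiagonal_swap]
  refine Finset.sum_congr rfl fun p _ => ?_
  simp only [coeff_euler, opSeries, PowerSeries.coeff_mk, Prod.fst_swap, Prod.snd_swap]
  rcases Nat.eq_zero_or_pos p.1 with h1 | h1
  · simp [h1]
  rcases Nat.eq_zero_or_pos p.2 with h2 | h2
  · simp [h2]
  rw [if_neg h1.ne', if_neg h2.ne', ← mul_assoc, ← (Nat.cast_commute p.1 (A p.2)).eq, mul_assoc,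
    mul_assoc, (hA _ _ h1 h2).eq]

/-- This is the degree-d coefficient of X d/dX e^f = (X f') e^f. Together with `expPart_zero` it
determines all the parts, so the exponential is never expanded again. -/
theorem expPart_recursion {A : ℕ → Module.End ℂ Fock}
    (hA : ∀ n m, 0 < n → 0 < m → Commute (A n) (A m)) (d : ℕ) :
    (d : ℂ) • expPart A d =
      ∑ m ∈ Finset.range d, (((m + 1 : ℕ) : ℂ) • A (m + 1)) * expPart A (d - (m + 1)) := by
  have hc := commute_opSeries hA
  rw [expPart_eq_sum A (show d < d + 1 by omega), Finset.smul_sum, Finset.sum_range_succ']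
  have hlast : (d : ℂ) • (((0 : ℕ).factorial : ℂ)⁻¹ •
      PowerSeries.coeff d (opSeries A ^ 0)) = 0 := by
    rcases Nat.eq_zero_or_pos d with h | h
    · simp [h]
    · simp [PowerSeries.coeff_one, h.ne']
  rw [hlast, add_zero]
  have hterm : ∀ k : ℕ, (d : ℂ) • (((k + 1).factorial : ℂ)⁻¹ •
      PowerSeries.coeff d (opSeries A ^ (k + 1))) =
      ((k.factorial : ℂ)⁻¹) • PowerSeries.coeff d (euler (opSeries A) * opSeries A ^ k) := by
    intro k
    have h1 := congrArg (PowerSeries.coeff d) (euler_pow hc k)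
    have h2 : ((k : PowerSeries (Module.End ℂ Fock)) + 1) =
        PowerSeries.C ((k + 1 : ℕ) : Module.End ℂ Fock) := by simp
    rw [coeff_euler, h2, PowerSeries.coeff_C_mul] at h1
    have h3 : ∀ (n : ℕ) (X : Module.End ℂ Fock), (n : Module.End ℂ Fock) * X = (n : ℂ) • X := by
      intro n X
      rw [← nsmul_eq_mul, Nat.cast_smul_eq_nsmul]
    rw [h3, h3] at h1
    rw [smul_comm, h1, smul_smul, Nat.factorial_succ]
    congr 1
    push_cast
    have : (k : ℂ) + 1 ≠ 0 := by exact_mod_cast k.succ_ne_zero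
    field_simp
  have hterm2 : ∀ k : ℕ, PowerSeries.coeff d (euler (opSeries A) * opSeries A ^ k) =
      ∑ m ∈ Finset.range d, (((m + 1 : ℕ) : ℂ) • A (m + 1)) *
        PowerSeries.coeff (d - (m + 1)) (opSeries A ^ k) := by
    intro k
    rw [PowerSeries.coeff_mul, Finset.Nat.sum_antidiagonal_eq_sum_range_succ_mk,
      Finset.sum_range_succ']
    simp only [coeff_euler, Nat.cast_zero, zero_mul, add_zero]
    refine Finset.sum_congr rfl fun m _ => ?_
    rw [opSeries, PowerSeries.coeff_mk, if_neg (Nat.succ_ne_zero m), ← nsmul_eq_mul,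
      Nat.cast_smul_eq_nsmul]
  simp only [hterm, hterm2, Finset.smul_sum]
  rw [Finset.sum_comm]
  refine Finset.sum_congr rfl fun m hm => ?_
  rw [expPart_eq_sum A (show d - (m + 1) < d by have := Finset.mem_range.1 hm; omega),
    Finset.mul_sum]
  exact Finset.sum_congr rfl fun k _ => (mul_smul_comm _ _ _).symm

theorem commute_expPart {A : ℕ → Module.End ℂ Fock} {B : Module.End ℂ Fock}
    (hA : ∀ n, 0 < n → Commute B (A n)) (d : ℕ) : Commute B (expPart A d) := by
  have hpow : ∀ k d, Commute B (PowerSeries.coeff d (opSeries A ^ k)) := by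
    intro k
    induction k with
    | zero =>
      intro d
      rw [pow_zero, PowerSeries.coeff_one]
      split_ifs
      · exact Commute.one_right B
      · exact Commute.zero_right B
    | succ k ih =>
      intro d
      rw [pow_succ', PowerSeries.coeff_mul]
      refine Commute.sum_right _ _ _ fun p _ => Commute.mul_right ?_ (ih _)
      rw [opSeries, PowerSeries.coeff_mk]
      split_ifs with h
      · exact Commute.zero_right B
      · exact hA _ (Nat.pos_of_ne_zero h)
  exact Commute.sum_right _ _ _ fun k _ => (hpow k d).smul_right _

/-! ### Products of fermions -/

section Fermion

variable {V : Type*} [AddCommGroup V] [Module ℂ V]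

/-- `f (l (n-1)) ⋯ f (l 1) f (l 0)`. -/
def annProd (f : ℤ → Module.End ℂ V) : ℕ → (ℕ → ℤ) → Module.End ℂ V
  | 0, _ => 1
  | n + 1, l => annProd f n (fun i => l (i + 1)) * f (l 0)

/-- `f (c 0) f (c 1) ⋯ f (c (n-1))`. -/
def creProd (f : ℤ → Module.End ℂ V) : ℕ → (ℕ → ℤ) → Module.End ℂ V
  | 0, _ => 1
  | n + 1, c => f (c 0) * creProd f n (fun i => c (i + 1))

/-- The increasing map `ℕ → ℕ` that misses `j`. -/
def skip (j i : ℕ) : ℕ := if i < j then i else i + 1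

/-- The vacuum vector and the vacuum functional. -/
structure IsVacuum (ψ ψd : ℤ → Module.End ℂ V) (vac : V) (ell : Module.Dual ℂ V) : Prop where
  psi_vac : ∀ k, 0 ≤ k → ψ k vac = 0
  psid_vac : ∀ k, 0 ≤ k → ψd k vac = 0
  ell_psid : ∀ k v, k < 0 → ell (ψd k v) = 0
  ell_vac : ell vac = 1

variable {ψ ψd : ℤ → Module.End ℂ V} {vac : V} {ell : Module.Dual ℂ V}

theorem annProd_succ (f : ℤ → Module.End ℂ V) (n : ℕ) (l : ℕ → ℤ) (v : V) :
    annProd f (n + 1) l v = annProd f n (fun i => l (i + 1)) (f (l 0) v) := rfl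

theorem creProd_succ (f : ℤ → Module.End ℂ V) (n : ℕ) (c : ℕ → ℤ) (v : V) :
    creProd f (n + 1) c v = f (c 0) (creProd f n (fun i => c (i + 1)) v) := rfl

theorem creProd_succ' (f : ℤ → Module.End ℂ V) (n : ℕ) (c : ℕ → ℤ) (v : V) :
    creProd f (n + 1) c v = creProd f n c (f (c n) v) := by
  induction n generalizing c with
  | zero => rfl
  | succ n ih => rw [creProd_succ, ih]; rfl

theorem creProd_congr (f : ℤ → Module.End ℂ V) {n : ℕ} {c c' : ℕ → ℤ} (h : ∀ i < n, c i = c' i) :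
    creProd f n c = creProd f n c' := by
  induction n generalizing c c' with
  | zero => rfl
  | succ n ih =>
    simp only [creProd]
    rw [h 0 (by omega), ih fun i hi => h (i + 1) (by omega)]

theorem IsFermion.psid_psi (hF : IsFermion ψ ψd) (k l : ℤ) (v : V) :
    ψd k (ψ l v) = (if l + k + 1 = 0 then v else 0) - ψ l (ψd k v) := by
  rw [hF.psi_psid]; abel

/-- Moving ψ† to the right past each ψ in turn: passing j of them costs (-1)^j, and a contraction
deletes the factor of index j. The signs and deletions are those of a Laplace expansion. -/
theorem IsFermion.psid_creProd (hF : IsFermion ψ ψd) (k : ℤ) (n : ℕ) (c : ℕ → ℤ) (v : V) :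
    ψd k (creProd ψ (n + 1) c v) =
      ∑ j ∈ Finset.range (n + 1), (-1 : ℂ) ^ j •
        (if c j + k + 1 = 0 then creProd ψ n (c ∘ skip j) v else 0) +
      (-1 : ℂ) ^ (n + 1) • creProd ψ (n + 1) c (ψd k v) := by
  induction n generalizing c with
  | zero =>
    rw [creProd_succ, hF.psid_psi]
    simp [creProd, sub_eq_add_neg]
  | succ n ih =>
    rw [creProd_succ, hF.psid_psi, ih, Finset.sum_range_succ' _ (n + 1), map_add, map_sum]
    have h0 : (c ∘ skip 0) = fun i => c (i + 1) := by ext i; simp [skip]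
    have hs : ∀ j, creProd ψ (n + 1) (c ∘ skip (j + 1)) v =
        ψ (c 0) (creProd ψ n ((fun i => c (i + 1)) ∘ skip j) v) := by
      intro j
      rw [creProd_succ]
      have h1 : (fun i => (c ∘ skip (j + 1)) (i + 1)) = (fun i => c (i + 1)) ∘ skip j := by
        ext i
        simp only [Function.comp_apply, skip, add_lt_add_iff_right]
        split_ifs <;> rfl
      rw [h1]; rfl
    have hl : (-1 : ℂ) ^ (n + 1 + 1) • creProd ψ (n + 1 + 1) c (ψd k v) =
        -ψ (c 0) ((-1 : ℂ) ^ (n + 1) • creProd ψ (n + 1) (fun i => c (i + 1)) (ψd k v)) := by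
      rw [creProd_succ, map_smul, pow_succ, mul_neg_one, neg_smul]
    have hterm : ∀ j, (-1 : ℂ) ^ (j + 1) • (if c (j + 1) + k + 1 = 0 then
        creProd ψ (n + 1) (c ∘ skip (j + 1)) v else 0) =
        -ψ (c 0) ((-1 : ℂ) ^ j • if c (j + 1) + k + 1 = 0 then
          creProd ψ n ((fun i => c (i + 1)) ∘ skip j) v else 0) := by
      intro j
      split_ifs
      · rw [hs, map_smul, pow_succ, mul_neg_one, neg_smul]
      · simp
    rw [hl, h0, Finset.sum_congr rfl fun j _ => hterm j, Finset.sum_neg_distrib, pow_zero, one_smul]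
    abel

theorem IsFermion.psid_creProd_of_ne (hF : IsFermion ψ ψd) (k : ℤ) (n : ℕ) (c : ℕ → ℤ) (v : V)
    (h : ∀ j < n, c j + k + 1 ≠ 0) :
    ψd k (creProd ψ n c v) = (-1 : ℂ) ^ n • creProd ψ n c (ψd k v) := by
  cases n with
  | zero => simp [creProd]
  | succ n =>
    rw [hF.psid_creProd, Finset.sum_eq_zero, zero_add]
    intro j hj
    rw [if_neg (h j (Finset.mem_range.1 hj)), smul_zero]

theorem IsFermion.psid_annProd (hF : IsFermion ψ ψd) (k : ℤ) (n : ℕ) (l : ℕ → ℤ) (v : V) :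
    annProd ψd n l (ψd k v) = (-1 : ℂ) ^ n • ψd k (annProd ψd n l v) := by
  induction n generalizing l v with
  | zero => simp [annProd]
  | succ n ih =>
    rw [annProd_succ, hF.psid_psid, map_neg, ih, annProd_succ, pow_succ, mul_neg_one, neg_smul]

/-- Wick's theorem: moving the ψ† that acts first to the vacuum is the Laplace expansion of the
determinant of contractions along its row 0. -/
theorem IsFermion.wick (hF : IsFermion ψ ψd) (hV : IsVacuum ψ ψd vac ell) (n : ℕ) (l c : ℕ → ℤ)
    (hc : ∀ j < n, c j < 0) :
    ell (annProd ψd n l (creProd ψ n c vac)) =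
      Matrix.det (Matrix.of fun i j : Fin n => if c j + l i + 1 = 0 then (1 : ℂ) else 0) := by
  induction n generalizing l c with
  | zero => simp [annProd, creProd, hV.ell_vac]
  | succ n ih =>
    rw [annProd_succ]
    rcases lt_or_ge (l 0) 0 with h0 | h0
    -- A ψ† of negative index cannot contract with a ψ of negative index, so row 0 vanishes; on the
    -- other side it anticommutes to the far left and is killed by the vacuum functional.
    · rw [hF.psid_annProd, map_smul, hV.ell_psid _ _ h0, smul_zero,
        Matrix.det_eq_zero_of_row_eq_zero 0]
      intro j
      have := hc j j.2
      rw [Matrix.of_apply, if_neg]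
      simp only [Fin.val_zero]
      omega
    · rw [hF.psid_creProd, hV.psid_vac _ h0, map_zero, smul_zero, add_zero, map_sum, map_sum,
        Matrix.det_succ_row_zero, Finset.sum_range]
      refine Finset.sum_congr rfl fun j _ => ?_
      rw [map_smul, map_smul, smul_eq_mul, mul_assoc]
      congr 1
      rw [Matrix.of_apply, Fin.val_zero]
      split_ifs
      · rw [one_mul, ih]
        · congr 1
          ext i i'
          simp only [Matrix.of_apply, Matrix.submatrix_apply, Fin.val_succ, Function.comp_apply,
            skip, Fin.succAbove, Fin.lt_def, Fin.val_castSucc]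
          split_ifs <;> simp_all
        · intro i hi
          apply hc
          simp only [skip]
          split_ifs <;> omega
      · rw [map_zero, map_zero, zero_mul]

/-- The Leibniz rule: an operator that shifts each ψ† by m acts on a product by shifting one factor
at a time. -/
theorem shift_annProd {α : Module.End ℂ V} {m : ℤ}
    (hα : ∀ s v, α (ψd s v) = ψd (m + s) v + ψd s (α v)) (n : ℕ) (l : ℕ → ℤ) (v : V) :
    α (annProd ψd n l v) =
      ∑ i ∈ Finset.range n, annProd ψd n (Function.update l i (l i + m)) v +
        annProd ψd n l (α v) := by
  induction n generalizing l v with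
  | zero => simp [annProd]
  | succ n ih =>
    rw [annProd_succ, ih, hα, map_add, Finset.sum_range_succ']
    have h1 : ∀ i, annProd ψd (n + 1) (Function.update l (i + 1) (l (i + 1) + m)) v =
        annProd ψd n (Function.update (fun i => l (i + 1)) i (l (i + 1) + m)) (ψd (l 0) v) := by
      intro i
      rw [annProd_succ]
      have : (fun j => Function.update l (i + 1) (l (i + 1) + m) (j + 1)) =
          Function.update (fun i => l (i + 1)) i (l (i + 1) + m) := by
        ext j
        simp [Function.update_apply]
      rw [this, Function.update_of_ne (by omega)]
    have h2 : annProd ψd (n + 1) (Function.update l 0 (l 0 + m)) v =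
        annProd ψd n (fun i => l (i + 1)) (ψd (m + l 0) v) := by
      rw [annProd_succ, Function.update_self, add_comm m]
      congr 2
    simp only [h1, h2, annProd_succ]
    abel

/-- The ground state of charge `-n`. -/
def ground (ψ : ℤ → Module.End ℂ V) (vac : V) (n : ℕ) : V :=
  creProd ψ n (fun j => (j : ℤ) - n) vac

theorem ground_succ (n : ℕ) : ground ψ vac (n + 1) = ψ (-(n + 1)) (ground ψ vac n) := by
  have h1 : (fun j : ℕ => ((j + 1 : ℕ) : ℤ) - ((n + 1 : ℕ) : ℤ)) = fun j : ℕ => (j : ℤ) - n := by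
    ext j; push_cast; ring
  rw [ground, creProd_succ, ground, h1]
  congr 2

/-- Indices from -n to -1 are already occupied, so Pauli exclusion applies; nonnegative indices
annihilate the vacuum. -/
theorem IsFermion.psi_ground (hF : IsFermion ψ ψd) (hV : IsVacuum ψ ψd vac ell) (n : ℕ) {k : ℤ}
    (hk : -(n : ℤ) ≤ k) : ψ k (ground ψ vac n) = 0 := by
  induction n with
  | zero => exact hV.psi_vac _ (by simpa using hk)
  | succ n ih =>
    rw [ground_succ]
    rcases eq_or_lt_of_le hk with h | h
    · have h2 := hF.psi_psi k k (ground ψ vac n)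
      rw [eq_neg_iff_add_eq_zero, ← two_smul ℂ, smul_eq_zero_iff_right two_ne_zero] at h2
      rw [show -((n : ℤ) + 1) = k by rw [← h]; push_cast; ring]
      exact h2
    · rw [hF.psi_psi, ih (by push_cast at h; omega), map_zero, neg_zero]

/-- Raising the index of any ψ in the sea by m > 0 lands on an occupied mode or on an annihilator,
so nothing survives. -/
theorem IsFermion.shift_ground (hF : IsFermion ψ ψd) (hV : IsVacuum ψ ψd vac ell)
    {α : Module.End ℂ V} {m : ℤ} (hm : 0 < m) (hα : ∀ s v, α (ψ s v) = -ψ (m + s) v + ψ s (α v))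
    (hvac : α vac = 0) (n : ℕ) : α (ground ψ vac n) = 0 := by
  induction n with
  | zero => exact hvac
  | succ n ih =>
    rw [ground_succ, hα, ih, map_zero, hF.psi_ground hV n (by omega), neg_zero, zero_add]

end Fermion

/-! ### Jacobi-Trudi determinants -/

/-- Extension of a sequence by zero to negative indices. -/
def extend (h : ℕ → ℂ) (k : ℤ) : ℂ := if k < 0 then 0 else h k.toNat

theorem extend_neg (h : ℕ → ℂ) {k : ℤ} (hk : k < 0) : extend h k = 0 := if_pos hk

@[simp] theorem extend_natCast (h : ℕ → ℂ) (k : ℕ) : extend h k = h k := by simp [extend]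

/-- Newton's identities between power sums `p` and complete homogeneous functions `h`. -/
structure IsNewton (p h : ℕ → ℂ) : Prop where
  zero : h 0 = 1
  newton : ∀ k : ℕ, (k : ℂ) * h k = ∑ m ∈ Finset.range k, p (m + 1) * h (k - (m + 1))

variable {p h : ℕ → ℂ}

/-- Extension by zero makes Newton's identity valid at every integer k and with any cut-off d ≥ k,
so entries of one determinant can share a single range of summation. -/
theorem IsNewton.extend_rec (hN : IsNewton p h) {k : ℤ} {d : ℕ} (hk : k ≤ d) :
    (k : ℂ) * extend h k = ∑ m ∈ Finset.range d, p (m + 1) * extend h (k - (m + 1)) := by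
  rcases lt_or_ge k 0 with h0 | h0
  · rw [extend_neg h h0, mul_zero, Finset.sum_eq_zero]
    intro m _
    rw [extend_neg h (by omega), mul_zero]
  · lift k to ℕ using h0
    rw [extend_natCast, Int.cast_natCast, hN.newton]
    have hkd : k ≤ d := by exact_mod_cast hk
    rw [← Finset.sum_subset (Finset.range_subset_range.2 hkd)]
    · refine Finset.sum_congr rfl fun m hm => ?_
      rw [Finset.mem_range] at hm
      rw [← extend_natCast h (k - (m + 1)), Nat.cast_sub (by omega)]
      push_cast; rfl
    · intro m _ hm
      rw [Finset.mem_range] at hm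
      rw [extend_neg h (by omega), mul_zero]

/-- Integers with sum 0 are either all 0 or include a negative one. This matches the degree-0
Jacobi-Trudi determinant with the 0-1 determinant of Wick's theorem. -/
theorem prod_extend_of_sum_eq_zero (h0 : h 0 = 1) {n : ℕ} (k : Fin n → ℤ) (hk : ∑ i, k i = 0) :
    ∏ i, extend h (k i) = ∏ i, if k i = 0 then (1 : ℂ) else 0 := by
  by_cases hneg : ∃ i, k i < 0
  · obtain ⟨i, hi⟩ := hneg
    rw [Finset.prod_eq_zero (Finset.mem_univ i) (extend_neg h hi),
      Finset.prod_eq_zero (Finset.mem_univ i) (if_neg hi.ne)]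
  · push Not at hneg
    have := (Finset.sum_eq_zero_iff_of_nonneg fun i _ => hneg i).1 hk
    refine Finset.prod_congr rfl fun i hi => ?_
    rw [this i hi]
    simp [extend, h0]

theorem IsNewton.sum_mul_prod (hN : IsNewton p h) {n d : ℕ} (k : Fin n → ℤ)
    (hk : ∑ i, k i = d) :
    (d : ℂ) * ∏ i, extend h (k i) = ∑ m ∈ Finset.range d, p (m + 1) *
      ∑ i, ∏ i', extend h (k i' - if i' = i then ((m + 1 : ℕ) : ℤ) else 0) := by
  have hd : (d : ℂ) = ∑ i, (k i : ℂ) := by exact_mod_cast hk.symm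
  rw [hd, Finset.sum_mul]
  simp only [Finset.mul_sum]
  rw [Finset.sum_comm]
  refine Finset.sum_congr rfl fun i _ => ?_
  have hsplit : ∀ m : ℕ, ∏ i', extend h (k i' - if i' = i then ((m + 1 : ℕ) : ℤ) else 0) =
      extend h (k i - (m + 1)) * ∏ i' ∈ Finset.univ.erase i, extend h (k i') := by
    intro m
    rw [← Finset.mul_prod_erase _ _ (Finset.mem_univ i), if_pos rfl]
    push_cast
    congr 1
    refine Finset.prod_congr rfl fun i' hi' => ?_
    rw [if_neg (Finset.ne_of_mem_erase hi'), sub_zero]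
  simp only [hsplit]
  rw [← Finset.mul_prod_erase _ _ (Finset.mem_univ i)]
  -- If another index is negative, both sides vanish. Otherwise k_i ≤ d, which is what the cut-off d
  -- in the extended Newton identity requires.
  by_cases hneg : ∃ i' ∈ Finset.univ.erase i, k i' < 0
  · obtain ⟨i', hi', hi2⟩ := hneg
    rw [Finset.prod_eq_zero hi' (extend_neg h hi2)]
    simp
  · push Not at hneg
    have h1 := Finset.sum_nonneg hneg
    rw [← Finset.add_sum_erase _ _ (Finset.mem_univ i)] at hk
    rw [← mul_assoc, hN.extend_rec (show k i ≤ d by omega), Finset.sum_mul]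
    simp only [mul_assoc]

/-- `det (h_{n-1-j-l_i})_{i,j<n}`. -/
def detShift (h : ℕ → ℂ) (n : ℕ) (l : ℕ → ℤ) : ℂ :=
  Matrix.det (Matrix.of fun i j : Fin n => extend h ((n : ℤ) - 1 - (j : ℕ) - l i))

theorem detShift_apply (h : ℕ → ℂ) (n : ℕ) (l : ℕ → ℤ) :
    detShift h n l = ∑ σ : Equiv.Perm (Fin n), Equiv.Perm.sign σ •
      ∏ i : Fin n, extend h ((n : ℤ) - 1 - (i : ℕ) - l (σ i)) := by
  simp [detShift, Matrix.det_apply]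

/-- The degree of `l` above the ground state. -/
def degShift (n : ℕ) (l : ℕ → ℤ) : ℤ := ∑ i : Fin n, ((n : ℤ) - 1 - (i : ℕ) - l i)

theorem degShift_perm {n : ℕ} (l : ℕ → ℤ) (σ : Equiv.Perm (Fin n)) :
    ∑ i : Fin n, ((n : ℤ) - 1 - (i : ℕ) - l (σ i)) = degShift n l := by
  rw [degShift, Finset.sum_sub_distrib, Equiv.sum_comp σ fun i : Fin n => l i,
    ← Finset.sum_sub_distrib]

theorem degShift_update {n : ℕ} (l : ℕ → ℤ) {i : ℕ} (hi : i < n) (m : ℤ) :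
    degShift n (Function.update l i (l i + m)) = degShift n l - m := by
  have h1 : ∀ j : Fin n, (n : ℤ) - 1 - (j : ℕ) - Function.update l i (l i + m) j =
      (n : ℤ) - 1 - (j : ℕ) - l j - if j = ⟨i, hi⟩ then m else 0 := by
    intro j
    rw [Function.update_apply]
    by_cases hj : (j : ℕ) = i
    · rw [if_pos hj, if_pos (Fin.ext hj), hj]; ring
    · rw [if_neg hj, if_neg (fun hc => hj (by rw [hc])), sub_zero]
  simp only [degShift, h1, Finset.sum_sub_distrib, Finset.sum_ite_eq', Finset.mem_univ, if_true]

/-- Every term of the Leibniz expansion is a product of n factors h with total degree d, so the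
product form of Newton's identity applies to each term separately. -/
theorem IsNewton.detShift_rec (hN : IsNewton p h) {n d : ℕ} (l : ℕ → ℤ)
    (hl : degShift n l = d) :
    (d : ℂ) * detShift h n l = ∑ m ∈ Finset.range d, p (m + 1) *
      ∑ i ∈ Finset.range n, detShift h n (Function.update l i (l i + ((m + 1 : ℕ) : ℤ))) := by
  simp only [detShift_apply, Finset.mul_sum]
  have hσ : ∀ σ : Equiv.Perm (Fin n), (d : ℂ) * (Equiv.Perm.sign σ •
      ∏ i : Fin n, extend h ((n : ℤ) - 1 - (i : ℕ) - l (σ i))) =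
      ∑ m ∈ Finset.range d, ∑ i ∈ Finset.range n, p (m + 1) * (Equiv.Perm.sign σ •
        ∏ i' : Fin n, extend h ((n : ℤ) - 1 - (i' : ℕ) -
          Function.update l i (l i + ((m + 1 : ℕ) : ℤ)) (σ i'))) := by
    intro σ
    rw [mul_smul_comm, hN.sum_mul_prod _ ((degShift_perm l σ).trans hl), Finset.smul_sum]
    refine Finset.sum_congr rfl fun m _ => ?_
    -- In the term of σ, lowering the factor at position σ⁻¹(i) is the same as raising l_i.
    rw [← mul_smul_comm, Finset.smul_sum, Finset.mul_sum, Finset.sum_range, ← Equiv.sum_comp σ.symm]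
    refine Finset.sum_congr rfl fun i _ => ?_
    congr 2
    refine Finset.prod_congr rfl fun i' _ => ?_
    congr 1
    rw [Function.update_apply]
    by_cases hii : σ i' = i
    · subst hii; simp; ring
    · rw [if_neg (fun hc => hii (by rw [hc, Equiv.apply_symm_apply])),
        if_neg (fun hc => hii (Fin.ext hc)), sub_zero]
  rw [Finset.sum_congr rfl fun σ _ => hσ σ, Finset.sum_comm]
  refine Finset.sum_congr rfl fun m _ => ?_
  rw [Finset.sum_comm]

/-- Strong induction on d. The exponential recursion `hG` brings α (m+1) onto the state; it kills
the ground state and raises one l_i at a time, so the left side obeys exactly `detShift_rec`. The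
case d = 0 is Wick's theorem. The space is abstract so that the lemma serves both Fock space and its
dual. -/
theorem IsFermion.pairing_annProd {V : Type*} [AddCommGroup V] [Module ℂ V]
    {ψ ψd : ℤ → Module.End ℂ V} {vac : V} {ell : Module.Dual ℂ V} {α : ℕ → Module.End ℂ V}
    {G : ℕ → Module.Dual ℂ V} (hF : IsFermion ψ ψd) (hV : IsVacuum ψ ψd vac ell)
    (hN : IsNewton p h) {n : ℕ}
    (hα : ∀ m s v, α m (ψd s v) = ψd (m + s) v + ψd s (α m v))
    (hg : ∀ m, 0 < m → α m (ground ψ vac n) = 0) (hG0 : G 0 = ell)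
    (hG : ∀ (d : ℕ) (v : V), (d : ℂ) * G d v = ∑ m ∈ Finset.range d, p (m + 1) *
      G (d - (m + 1)) (α (m + 1) v)) (d : ℕ) (l : ℕ → ℤ) :
    G d (annProd ψd n l (ground ψ vac n)) = if degShift n l = d then detShift h n l else 0 := by
  induction d using Nat.strong_induction_on generalizing l with
  | _ d ih =>
    rcases Nat.eq_zero_or_pos d with h0 | h0
    · subst h0
      rw [hG0, ground, hF.wick hV _ _ _ (fun j hj => by omega), Matrix.det_apply]
      simp only [Matrix.of_apply, detShift_apply]
      have hiff : ∀ (σ : Equiv.Perm (Fin n)) (i : Fin n),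
          (((i : ℕ) : ℤ) - n + l (σ i) + 1 = 0) ↔ ((n : ℤ) - 1 - (i : ℕ) - l (σ i)) = 0 :=
        fun σ i => by omega
      simp only [hiff]
      split_ifs with hd
      · refine Finset.sum_congr rfl fun σ _ => ?_
        rw [prod_extend_of_sum_eq_zero hN.zero _ ((degShift_perm l σ).trans hd)]
      · refine Finset.sum_eq_zero fun σ _ => ?_
        rw [← degShift_perm l σ] at hd
        obtain ⟨i, -, hi⟩ := Finset.exists_ne_zero_of_sum_ne_zero hd
        rw [Finset.prod_eq_zero (Finset.mem_univ i) (if_neg hi), smul_zero]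
    · have hd0 : (d : ℂ) ≠ 0 := by exact_mod_cast h0.ne'
      refine mul_left_cancel₀ hd0 ?_
      rw [hG]
      have hterm : ∀ m ∈ Finset.range d, G (d - (m + 1)) (α (m + 1)
          (annProd ψd n l (ground ψ vac n))) = ∑ i ∈ Finset.range n,
            if degShift n l = d then
              detShift h n (Function.update l i (l i + ((m + 1 : ℕ) : ℤ))) else 0 := by
        intro m hm
        rw [Finset.mem_range] at hm
        rw [shift_annProd (hα (m + 1)), hg _ (Nat.succ_pos m), map_zero, add_zero, map_sum]
        refine Finset.sum_congr rfl fun i hi => ?_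
        rw [ih _ (by omega), degShift_update l (Finset.mem_range.1 hi), Nat.cast_sub (by omega)]
        simp only [sub_left_inj]
      rw [Finset.sum_congr rfl fun m hm => by rw [hterm m hm]]
      split_ifs with hd
      · rw [hN.detShift_rec l hd]
      · simp

/-! ### Combinatorics of Young diagrams -/

theorem rowLen_eq_zero {μ : YoungDiagram} {i : ℕ} (h : μ.colLen 0 ≤ i) : μ.rowLen i = 0 := by
  by_contra h0
  have := YoungDiagram.mem_iff_lt_rowLen.2 (Nat.pos_of_ne_zero h0)
  rw [YoungDiagram.mem_iff_lt_colLen] at this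
  omega

theorem lt_rowLen_iff_lt_colLen (μ : YoungDiagram) (i j : ℕ) :
    j < μ.rowLen i ↔ i < μ.colLen j := by
  rw [← YoungDiagram.mem_iff_lt_rowLen, YoungDiagram.mem_iff_lt_colLen]

theorem sum_cells {M : Type*} [AddCommMonoid M] (μ : YoungDiagram) {n : ℕ} (hn : μ.colLen 0 ≤ n)
    (f : ℕ × ℕ → M) :
    ∑ c ∈ μ.cells, f c = ∑ i ∈ Finset.range n, ∑ j ∈ Finset.range (μ.rowLen i), f (i, j) := by
  refine Finset.sum_finset_product _ _ _ fun c => ?_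
  rw [YoungDiagram.mem_cells, Finset.mem_range, Finset.mem_range, ← YoungDiagram.mem_iff_lt_rowLen]
  refine ⟨fun h => ⟨?_, h⟩, fun h => h.2⟩
  have h1 := YoungDiagram.mem_iff_lt_colLen.1 (μ.up_left_mem le_rfl (Nat.zero_le c.2) h)
  omega

theorem card_eq_sum_rowLen (μ : YoungDiagram) {n : ℕ} (hn : μ.colLen 0 ≤ n) :
    μ.card = ∑ i ∈ Finset.range n, μ.rowLen i := by
  rw [YoungDiagram.card, Finset.card_eq_sum_ones, sum_cells μ hn]
  simp

/-- Row lengths decrease while i grows, so the rows meeting the diagonal form an initial segment. -/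
theorem lt_diag_iff (μ : YoungDiagram) (i : ℕ) : i < diag μ ↔ i < μ.rowLen i := by
  obtain ⟨d, hd⟩ : ∃ d, ∀ i, i < d ↔ i < μ.rowLen i := by
    have hex : ∃ d, μ.rowLen d ≤ d := ⟨μ.colLen 0, by rw [rowLen_eq_zero le_rfl]; omega⟩
    refine ⟨Nat.find hex, fun i => ⟨fun h => ?_, fun h => ?_⟩⟩
    · have := Nat.find_min hex h; omega
    · by_contra hc
      have h1 := Nat.find_spec hex
      have h2 := μ.rowLen_anti _ _ (not_lt.1 hc)
      omega
  have : (Finset.range (μ.colLen 0)).filter (fun i => i < μ.rowLen i) = Finset.range d := by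
    ext i
    rw [Finset.mem_filter, Finset.mem_range, Finset.mem_range, hd]
    refine ⟨fun h => h.2, fun h => ⟨?_, h⟩⟩
    by_contra hc
    rw [rowLen_eq_zero (not_lt.1 hc)] at h
    omega
  rw [diag, this, Finset.card_range, hd]

theorem diag_transpose (μ : YoungDiagram) : diag μ.transpose = diag μ := by
  have h : ∀ i, i < diag μ.transpose ↔ i < diag μ := by
    intro i
    rw [lt_diag_iff, lt_diag_iff, YoungDiagram.rowLen_transpose, lt_rowLen_iff_lt_colLen]
  have h1 := h (diag μ)
  have h2 := h (diag μ.transpose)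
  omega

theorem diag_le (μ : YoungDiagram) : diag μ ≤ μ.colLen 0 := by
  by_contra h
  have h1 := (lt_diag_iff μ _).1 (not_le.1 h)
  rw [rowLen_eq_zero le_rfl] at h1
  omega

/-- Both sides count the cells below the Durfee square, by rows and by columns; the count enters the
sign of the bras. -/
theorem sum_rowLen_sub (μ : YoungDiagram) :
    ∑ i ∈ Finset.Ico (diag μ) (μ.colLen 0), μ.rowLen i =
      ∑ j ∈ Finset.range (diag μ), (μ.colLen j - diag μ) := by
  have h1 : ∀ i ∈ Finset.Ico (diag μ) (μ.colLen 0), μ.rowLen i =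
      ∑ j ∈ Finset.range (diag μ), if j < μ.rowLen i then 1 else 0 := by
    intro i hi
    rw [Finset.mem_Ico] at hi
    have h2 : μ.rowLen i ≤ diag μ := by
      have h3 := μ.rowLen_anti _ _ hi.1
      have h4 := lt_diag_iff μ (diag μ)
      omega
    rw [← Finset.card_filter]
    have h3 : (Finset.range (diag μ)).filter (fun j => j < μ.rowLen i) =
        Finset.range (μ.rowLen i) := by
      ext j; simp only [Finset.mem_filter, Finset.mem_range]; omega
    rw [h3, Finset.card_range]
  rw [Finset.sum_congr rfl h1, Finset.sum_comm]
  refine Finset.sum_congr rfl fun j _ => ?_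
  rw [← Finset.card_filter]
  have h3 : (Finset.Ico (diag μ) (μ.colLen 0)).filter (fun i => j < μ.rowLen i) =
      Finset.Ico (diag μ) (μ.colLen j) := by
    ext i
    rw [Finset.mem_filter, Finset.mem_Ico, Finset.mem_Ico, lt_rowLen_iff_lt_colLen]
    have := μ.colLen_anti _ _ (Nat.zero_le j)
    omega
  rw [h3, Nat.card_Ico]

/-! ### Partition states as products of fermions -/

section Fermion

variable {V : Type*} [AddCommGroup V] [Module ℂ V] {ψ ψd : ℤ → Module.End ℂ V} {vac : V}
  {ell : Module.Dual ℂ V}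

/-- `f (r 0) f (r 1) ⋯ f (r (n-1))`, in terms of `annProd`. -/
def rowProd (f : ℤ → Module.End ℂ V) (n : ℕ) (r : ℕ → ℤ) : Module.End ℂ V :=
  annProd f n fun i => r (n - 1 - i)

theorem rowProd_succ (f : ℤ → Module.End ℂ V) (n : ℕ) (r : ℕ → ℤ) (v : V) :
    rowProd f (n + 1) r v = rowProd f n r (f (r n) v) := by
  simp only [rowProd, annProd_succ]
  have : (fun i => r (n + 1 - 1 - (i + 1))) = fun i => r (n - 1 - i) := by
    ext i; congr 1; omega
  rw [this]; rfl

/-- A row that does not cross the diagonal is absorbed by one contraction. The indices j - max(μ'_j,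
i) interpolate between the filled sea (i ≥ μ'_0) and the Frobenius indices j - μ'_j (i at the
diagonal length). The factor with j = μ_i is the only one that contracts, and deleting it lowers the
depth from i + 1 to i. -/
theorem IsFermion.psid_hooks (hF : IsFermion ψ ψd) (hV : IsVacuum ψ ψd vac ell) (μ : YoungDiagram)
    {i : ℕ} (hi : μ.rowLen i ≤ i) :
    ψd ((i : ℤ) - μ.rowLen i) (creProd ψ (i + 1) (fun j => (j : ℤ) - max (μ.colLen j) (i + 1)) vac) =
      (-1 : ℂ) ^ μ.rowLen i • creProd ψ i (fun j => (j : ℤ) - max (μ.colLen j) i) vac := by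
  rw [hF.psid_creProd, hV.psid_vac _ (by omega), map_zero, smul_zero, add_zero,
    Finset.sum_eq_single (μ.rowLen i)]
  · have h1 : ¬ i < μ.colLen (μ.rowLen i) := by
      rw [← lt_rowLen_iff_lt_colLen]; omega
    rw [if_pos (by omega)]
    congr 2
    refine creProd_congr _ fun j hj => ?_
    simp only [Function.comp_apply, skip]
    by_cases hj2 : j < μ.rowLen i
    · have := (lt_rowLen_iff_lt_colLen μ i j).1 hj2
      rw [if_pos hj2]
      omega
    · have := (lt_rowLen_iff_lt_colLen μ i j).not.1 hj2
      have := μ.colLen_anti _ _ (Nat.le_succ j)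
      rw [if_neg hj2]
      push_cast
      simp only [Nat.succ_eq_add_one] at this
      omega
  · intro j hj hne
    rw [if_neg, smul_zero]
    have := lt_rowLen_iff_lt_colLen μ i j
    rw [Finset.mem_range] at hj
    omega
  · intro h
    exact absurd (Finset.mem_range.2 (by omega)) h

theorem IsFermion.rowProd_hooks (hF : IsFermion ψ ψd) (hV : IsVacuum ψ ψd vac ell)
    (μ : YoungDiagram) {d n : ℕ} (hd : ∀ i, d ≤ i → μ.rowLen i ≤ i) (hn : d ≤ n) :
    rowProd ψd n (fun i => (i : ℤ) - μ.rowLen i)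
        (creProd ψ n (fun j => (j : ℤ) - max (μ.colLen j) n) vac) =
      (-1 : ℂ) ^ (∑ i ∈ Finset.Ico d n, μ.rowLen i) •
        rowProd ψd d (fun i => (i : ℤ) - μ.rowLen i)
          (creProd ψ d (fun j => (j : ℤ) - max (μ.colLen j) d) vac) := by
  induction n, hn using Nat.le_induction with
  | base => simp
  | succ n hn ih =>
    have := hF.psid_hooks hV μ (hd n hn)
    rw [rowProd_succ, this, map_smul, ih, smul_smul, Finset.sum_Ico_succ_top hn, pow_add, mul_comm]

/-- Without contractions, regrouping into pairs ψψ† only permutes anticommuting factors: the last ψ†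
crosses i + 1 factors ψ at the step from i to i + 1 pairs. -/
theorem IsFermion.prod_pairs (hF : IsFermion ψ ψd) (c r : ℕ → ℤ) (d : ℕ)
    (h : ∀ i < d, ∀ j < d, c i + r j + 1 ≠ 0) (v : V) :
    rowProd ψd d r (creProd ψ d c v) = (-1 : ℂ) ^ (∑ i ∈ Finset.range d, (i + 1)) •
      ((List.range d).map fun i => ψ (c i) * ψd (r i)).prod v := by
  induction d generalizing v with
  | zero => simp [rowProd, annProd, creProd]
  | succ d ih =>
    rw [rowProd_succ, creProd_succ', hF.psid_creProd_of_ne _ _ _ _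
      (fun j hj => h j (by omega) d (by omega)), map_smul, hF.psid_psi,
      if_neg (h d (by omega) d (by omega)), zero_sub, map_neg, map_neg,
      ih (fun i hi j hj => h i (by omega) j (by omega)), Finset.sum_range_succ, List.range_succ]
    simp only [List.map_append, List.prod_append, List.map_cons, List.map_nil, List.prod_cons,
      List.prod_nil, mul_one, Module.End.mul_apply]
    rw [smul_neg, smul_smul, ← neg_smul]
    congr 1
    ring

theorem prod_smul_list (ε : ℕ → ℂ) (f : ℕ → Module.End ℂ V) (d : ℕ) :
    ((List.range d).map fun i => ε i • f i).prod =
      (∏ i ∈ Finset.range d, ε i) • ((List.range d).map f).prod := by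
  induction d with
  | zero => simp
  | succ d ih =>
    simp only [List.range_succ, List.map_append, List.prod_append, List.map_cons, List.map_nil,
      List.prod_cons, List.prod_nil, mul_one] at ih ⊢
    rw [ih, Finset.prod_range_succ, smul_mul_smul_comm]

/-- The product of fermions in the Frobenius form of a partition state, in terms of the rows. -/
theorem IsFermion.prod_pairs_vac (hF : IsFermion ψ ψd) (hV : IsVacuum ψ ψd vac ell)
    (μ : YoungDiagram) {n : ℕ} (hn : μ.colLen 0 ≤ n) :
    ((List.range (diag μ)).map fun i : ℕ => ψ ((i : ℤ) - μ.colLen i) *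
        ψd ((i : ℤ) - μ.rowLen i)).prod vac =
      (-1 : ℂ) ^ (∑ i ∈ Finset.range (diag μ), (i + 1) +
          ∑ i ∈ Finset.Ico (diag μ) (μ.colLen 0), μ.rowLen i) •
        rowProd ψd n (fun i => (i : ℤ) - μ.rowLen i) (ground ψ vac n) := by
  have hg : creProd ψ n (fun j => (j : ℤ) - max (μ.colLen j) n) vac = ground ψ vac n := by
    rw [ground]
    congr 1
    refine creProd_congr _ fun j _ => ?_
    have := μ.colLen_anti _ _ (Nat.zero_le j)
    omega
  have hd : ∀ i, diag μ ≤ i → μ.rowLen i ≤ i := fun i hi => by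
    have := lt_diag_iff μ i
    omega
  have hc : creProd ψ (diag μ) (fun j => (j : ℤ) - max (μ.colLen j) (diag μ)) =
      creProd ψ (diag μ) (fun j => (j : ℤ) - μ.colLen j) := by
    refine creProd_congr _ fun j hj => ?_
    have h2 := (lt_diag_iff μ (diag μ - 1)).1 (by omega)
    rw [lt_rowLen_iff_lt_colLen] at h2
    have := μ.colLen_anti j (diag μ - 1) (by omega)
    omega
  have hsum : ∑ i ∈ Finset.Ico (diag μ) n, μ.rowLen i =
      ∑ i ∈ Finset.Ico (diag μ) (μ.colLen 0), μ.rowLen i := by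
    rw [← Finset.sum_Ico_consecutive _ (diag_le μ) hn, add_eq_left]
    refine Finset.sum_eq_zero fun i hi => rowLen_eq_zero (Finset.mem_Ico.1 hi).1
  rw [← hg, hF.rowProd_hooks hV μ hd ((diag_le μ).trans hn), hc, hF.prod_pairs, smul_smul, smul_smul,
    hsum]
  -- The sign stated on the right equals the one produced by the two rearrangements, so it occurs
  -- twice and cancels.
  · rw [← pow_add, ← pow_add, Even.neg_one_pow ⟨∑ i ∈ Finset.range (diag μ), (i + 1) +
      ∑ i ∈ Finset.Ico (diag μ) (μ.colLen 0), μ.rowLen i, by ring⟩, one_smul]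
  · intro i hi j hj
    have h1 := (lt_diag_iff μ i).1 hi
    have h2 := (lt_diag_iff μ j).1 hj
    rw [lt_rowLen_iff_lt_colLen] at h1
    omega

end Fermion

/-! ### Pairings with the standard basis -/

theorem isVacuum_fock : IsVacuum psi psiDag (1 : Fock) vacBra where
  psi_vac _ hk := psi_one hk
  psid_vac _ hk := psiDag_one hk
  ell_psid _ v hk := vacBra_psiDag hk v
  ell_vac := vacBra_one

/-- The action of `psi` on the dual Fock space. -/
def dualPsi (k : ℤ) : Module.End ℂ (Module.Dual ℂ Fock) := (psi (-1 - k)).dualMap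

/-- The action of `psiDag` on the dual Fock space. -/
def dualPsiDag (k : ℤ) : Module.End ℂ (Module.Dual ℂ Fock) := (psiDag (-1 - k)).dualMap

theorem dualPsi_apply (k : ℤ) (φ : Module.Dual ℂ Fock) (v : Fock) :
    dualPsi k φ v = φ (psi (-1 - k) v) := rfl

theorem dualPsiDag_apply (k : ℤ) (φ : Module.Dual ℂ Fock) (v : Fock) :
    dualPsiDag k φ v = φ (psiDag (-1 - k) v) := rfl

/-- Transposition reverses products, and k ↦ -1 - k is r ↦ -r; both preserve the anticommutators. So
all results on kets transfer to bras. -/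
theorem isFermion_dual : IsFermion dualPsi dualPsiDag where
  psi_psi k l φ := by
    refine LinearMap.ext fun v => ?_
    simp only [LinearMap.neg_apply, dualPsi_apply]
    rw [isFermion_fock.psi_psi, map_neg]
  psid_psid k l φ := by
    refine LinearMap.ext fun v => ?_
    simp only [LinearMap.neg_apply, dualPsiDag_apply]
    rw [isFermion_fock.psid_psid, map_neg]
  psi_psid k l φ := by
    refine LinearMap.ext fun v => ?_
    simp only [LinearMap.sub_apply, dualPsiDag_apply, dualPsi_apply]
    rw [isFermion_fock.psid_psi, map_sub]
    have : (-1 - k + (-1 - l) + 1 = 0) ↔ (k + l + 1 = 0) := by omega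
    simp only [this]
    split_ifs <;> simp

theorem isVacuum_dual :
    IsVacuum dualPsi dualPsiDag vacBra (Module.Dual.eval ℂ Fock (1 : Fock)) where
  psi_vac k hk := LinearMap.ext fun v => vacBra_psi (k := -1 - k) (by omega) v
  psid_vac k hk := LinearMap.ext fun v => vacBra_psiDag (k := -1 - k) (by omega) v
  ell_psid k φ hk := by
    rw [Module.Dual.eval_apply, dualPsiDag_apply, psiDag_one (by omega), map_zero]
  ell_vac := vacBra_one

/-- The Jacobi-Trudi determinant `det (h_{m_i-i+j})_{i,j<n}`. -/
def jacobiTrudi (h : ℕ → ℂ) (n : ℕ) (m : ℕ → ℕ) : ℂ :=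
  Matrix.det (Matrix.of fun i j : Fin n => extend h ((m i : ℤ) - (i : ℕ) + (j : ℕ)))

/-- `rowProd` lists the rows backwards, so rows and columns of the determinant are reversed
together, which leaves it unchanged. -/
theorem detShift_rows (h : ℕ → ℂ) (n : ℕ) (μ : YoungDiagram) :
    detShift h n (fun i => ((n - 1 - i : ℕ) : ℤ) - μ.rowLen (n - 1 - i)) = jacobiTrudi h n μ.rowLen := by
  rw [detShift, jacobiTrudi, ← Matrix.det_submatrix_equiv_self Fin.revPerm]
  congr 1
  ext i j
  simp only [Matrix.submatrix_apply, Matrix.of_apply, Fin.revPerm_apply, Fin.val_rev]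
  have hi := i.2
  have hj := j.2
  have e : n - 1 - (n - ((i : ℕ) + 1)) = i := by omega
  rw [e]
  congr 1
  omega

theorem degShift_rows {n : ℕ} {μ : YoungDiagram} (hn : μ.colLen 0 ≤ n) :
    degShift n (fun i => ((n - 1 - i : ℕ) : ℤ) - μ.rowLen (n - 1 - i)) = μ.card := by
  rw [degShift, card_eq_sum_rowLen μ hn, Nat.cast_sum, Finset.sum_range, ← Equiv.sum_comp Fin.revPerm]
  refine Finset.sum_congr rfl fun i _ => ?_
  have hi := i.2
  simp only [Fin.revPerm_apply, Fin.val_rev]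
  have e : n - 1 - (n - ((i : ℕ) + 1)) = i := by omega
  rw [e]
  omega

theorem neg_one_pow_eq_zpow (a b : ℕ) : (-1 : ℂ) ^ (-(a : ℤ) + b) = (-1) ^ (a + b) := by
  rw [zpow_add₀ (by norm_num), zpow_neg, zpow_natCast, zpow_natCast, pow_add, ← inv_pow, inv_neg_one]

/-- The exponents i + 1 in the basis sign cancel those from the regrouping into pairs. The rows
meeting the diagonal and the rows below it then contribute |μ| in total. -/
theorem ket_eq (μ : YoungDiagram) {n : ℕ} (hn : μ.colLen 0 ≤ n) :
    ket μ = (-1 : ℂ) ^ μ.card •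
      rowProd psiDag n (fun i => (i : ℤ) - μ.rowLen i) (ground psi (1 : Fock) n) := by
  unfold ket
  rw [prod_smul_list (fun i : ℕ => (-1 : ℂ) ^ (-(μ.rowLen i : ℤ) + ((i : ℤ) + 1)))
    (fun i : ℕ => psi ((i : ℤ) - μ.colLen i) * psiDag ((i : ℤ) - μ.rowLen i)), LinearMap.smul_apply,
    isFermion_fock.prod_pairs_vac isVacuum_fock μ hn, smul_smul]
  congr 1
  have h1 : ∀ i : ℕ, (-1 : ℂ) ^ (-(μ.rowLen i : ℤ) + ((i : ℤ) + 1)) =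
      (-1) ^ (μ.rowLen i + (i + 1)) := fun i => by
    exact_mod_cast neg_one_pow_eq_zpow (μ.rowLen i) (i + 1)
  simp only [h1]
  rw [Finset.prod_pow_eq_pow_sum, Finset.sum_add_distrib, card_eq_sum_rowLen μ le_rfl, ← pow_add,
    ← Finset.sum_range_add_sum_Ico _ (diag_le μ)]
  have h2 : ∀ a b c : ℕ, (-1 : ℂ) ^ (a + b + (b + c)) = (-1) ^ (a + c) := fun a b c => by
    rw [show a + b + (b + c) = a + c + 2 * b by ring, pow_add, pow_mul]; simp
  exact h2 _ _ _

theorem comp_prod_reverse {f : ℕ → Module.End ℂ Fock} {g : ℕ → Module.End ℂ (Module.Dual ℂ Fock)}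
    (hfg : ∀ i φ, g i φ = φ ∘ₗ f i) (d : ℕ) (φ : Module.Dual ℂ Fock) :
    φ ∘ₗ ((List.range d).reverse.map f).prod = ((List.range d).map g).prod φ := by
  induction d generalizing φ with
  | zero => rfl
  | succ d ih =>
    rw [List.range_succ, List.reverse_append, List.map_append, List.prod_append, List.map_append,
      List.prod_append]
    simp only [List.reverse_singleton, List.map_cons, List.map_nil, List.prod_cons, List.prod_nil,
      mul_one, Module.End.mul_apply]
    rw [hfg, ← ih]
    rfl

theorem bra_eq (μ : YoungDiagram) :
    bra μ = ((List.range (diag μ)).map fun i : ℕ =>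
      ((-1 : ℂ) ^ (-(μ.rowLen i : ℤ) + ((i : ℤ) + 1))) •
        (dualPsiDag ((i : ℤ) - μ.colLen i) * dualPsi ((i : ℤ) - μ.rowLen i))).prod vacBra := by
  refine comp_prod_reverse (fun i φ => LinearMap.ext fun v => ?_) _ _
  simp only [LinearMap.smul_apply, Module.End.mul_apply, LinearMap.comp_apply, map_smul,
    dualPsi_apply, dualPsiDag_apply]
  congr 3
  · congr 1; ring
  · congr 2; ring

/-- In a bra the roles of ψ and ψ† are exchanged, so the row product of μ belongs to the bra of the
transpose. This is the source of the transposes in ⟨μ'|λ'⟩_S. -/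
theorem bra_transpose_eq (μ : YoungDiagram) {n : ℕ} (hn : μ.colLen 0 ≤ n) :
    bra μ.transpose =
      rowProd dualPsiDag n (fun i => (i : ℤ) - μ.rowLen i) (ground dualPsi vacBra n) := by
  rw [bra_eq, diag_transpose]
  simp only [YoungDiagram.rowLen_transpose, YoungDiagram.colLen_transpose]
  have h0 : ((List.range (diag μ)).map fun i : ℕ =>
      ((-1 : ℂ) ^ (-(μ.colLen i : ℤ) + ((i : ℤ) + 1))) •
        (dualPsiDag ((i : ℤ) - μ.rowLen i) * dualPsi ((i : ℤ) - μ.colLen i))) =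
      (List.range (diag μ)).map fun i : ℕ => ((-1 : ℂ) ^ (μ.colLen i + i)) •
        (dualPsi ((i : ℤ) - μ.colLen i) * dualPsiDag ((i : ℤ) - μ.rowLen i)) := by
    refine List.map_congr_left fun i hi => ?_
    have h1 := (lt_diag_iff μ i).1 (List.mem_range.1 hi)
    have h2 := (lt_rowLen_iff_lt_colLen μ i i).1 h1
    have h3 : dualPsiDag ((i : ℤ) - μ.rowLen i) * dualPsi ((i : ℤ) - μ.colLen i) =
        -(dualPsi ((i : ℤ) - μ.colLen i) * dualPsiDag ((i : ℤ) - μ.rowLen i)) := by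
      refine LinearMap.ext fun φ => ?_
      rw [Module.End.mul_apply, isFermion_dual.psid_psi, if_neg (by omega), zero_sub]
      rfl
    have h4 : (-1 : ℂ) ^ (-(μ.colLen i : ℤ) + ((i : ℤ) + 1)) = (-1) ^ (μ.colLen i + (i + 1)) := by
      exact_mod_cast neg_one_pow_eq_zpow (μ.colLen i) (i + 1)
    rw [h3, h4, smul_neg, ← neg_smul]
    congr 1
    rw [← add_assoc, pow_succ]; ring
  rw [h0, prod_smul_list (fun i : ℕ => (-1 : ℂ) ^ (μ.colLen i + i))
    (fun i : ℕ => dualPsi ((i : ℤ) - μ.colLen i) * dualPsiDag ((i : ℤ) - μ.rowLen i)),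
    LinearMap.smul_apply, isFermion_dual.prod_pairs_vac isVacuum_dual μ hn, smul_smul,
    Finset.prod_pow_eq_pow_sum, ← pow_add, sum_rowLen_sub, ← Finset.sum_add_distrib,
    ← Finset.sum_add_distrib]
  rw [Even.neg_one_pow, one_smul]
  -- Modulo 2 each diagonal index contributes d + 1, where d is the diagonal length; the total
  -- d(d+1) is even, so no sign remains.
  have h1 : ∀ i ∈ Finset.range (diag μ), μ.colLen i + i + (i + 1 + (μ.colLen i - diag μ)) =
      2 * (i + (μ.colLen i - diag μ)) + (diag μ + 1) := by
    intro i hi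
    rw [Finset.mem_range] at hi
    have h2 := (lt_diag_iff μ (diag μ - 1)).1 (by omega)
    rw [lt_rowLen_iff_lt_colLen] at h2
    have := μ.colLen_anti i (diag μ - 1) (by omega)
    omega
  rw [Finset.sum_congr rfl h1, Finset.sum_add_distrib, ← Finset.mul_sum, Finset.sum_const,
    Finset.card_range, smul_eq_mul]
  exact (even_two_mul _).add (Nat.even_mul_succ_self _)

theorem vacBra_expPart_ket {p h : ℕ → ℂ} (hN : IsNewton p h) (μ : YoungDiagram) {n : ℕ}
    (hn : μ.colLen 0 ≤ n) (d : ℕ) :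
    vacBra (expPart (fun m => (p m / (m : ℂ)) • boson (m : ℤ)) d (ket μ)) =
      if μ.card = d then (-1) ^ μ.card * jacobiTrudi h n μ.rowLen else 0 := by
  set A : ℕ → Module.End ℂ Fock := fun m => (p m / (m : ℂ)) • boson (m : ℤ) with hA
  have hcomm : ∀ a b : ℕ, 0 < a → 0 < b → Commute (A a) (A b) := fun a b ha hb =>
    ((commute_boson (by omega)).smul_left _).smul_right _
  have hA1 : ∀ m : ℕ, ((m + 1 : ℕ) : ℂ) • A (m + 1) = p (m + 1) • boson ((m + 1 : ℕ) : ℤ) := by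
    intro m
    have : ((m + 1 : ℕ) : ℂ) ≠ 0 := by exact_mod_cast m.succ_ne_zero
    rw [hA, smul_smul, mul_div_cancel₀ _ this]
  have key := isFermion_fock.pairing_annProd isVacuum_fock hN (n := n)
    (α := fun m => boson (m : ℤ)) (G := fun d => vacBra ∘ₗ expPart A d)
    (fun m s v => boson_psiDag m s v)
    (fun m hm => isFermion_fock.shift_ground isVacuum_fock (by exact_mod_cast hm)
      (fun s v => boson_psi m s v) (boson_one (by exact_mod_cast hm)) n)
    (by rw [expPart_zero]; rfl)
    (fun d v => by
      have h1 := congrArg (fun X : Module.End ℂ Fock => vacBra (X v)) (expPart_recursion hcomm d)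
      simp only [LinearMap.smul_apply, map_smul, LinearMap.sum_apply, map_sum, smul_eq_mul] at h1
      rw [LinearMap.comp_apply, h1]
      refine Finset.sum_congr rfl fun m _ => ?_
      -- Modes of equal sign commute, so a_{m+1} can be moved past the exponential to act directly
      -- on the ket.
      have h2 : Commute (boson ((m + 1 : ℕ) : ℤ)) (expPart A (d - (m + 1))) :=
        commute_expPart (fun a ha => (commute_boson (by omega)).smul_right _) _
      rw [hA1, smul_mul_assoc, h2.eq]
      simp) d
    (fun i => ((n - 1 - i : ℕ) : ℤ) - μ.rowLen (n - 1 - i))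
  rw [degShift_rows hn, detShift_rows] at key
  rw [ket_eq μ hn, map_smul, map_smul, smul_eq_mul]
  simp only [Nat.cast_inj] at key
  rw [← mul_ite_zero]
  exact congrArg _ key

theorem bra_expPart_one {p h : ℕ → ℂ} (hN : IsNewton p h) (μ : YoungDiagram) {n : ℕ}
    (hn : μ.colLen 0 ≤ n) (d : ℕ) :
    bra μ.transpose (expPart (fun m => (-(p m / (m : ℂ))) • boson (-(m : ℤ))) d (1 : Fock)) =
      if μ.card = d then jacobiTrudi h n μ.rowLen else 0 := by
  set A : ℕ → Module.End ℂ Fock := fun m => (-(p m / (m : ℂ))) • boson (-(m : ℤ)) with hA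
  have hcomm : ∀ a b : ℕ, 0 < a → 0 < b → Commute (A a) (A b) := fun a b ha hb =>
    ((commute_boson (by omega)).smul_left _).smul_right _
  have hA1 : ∀ m : ℕ, ((m + 1 : ℕ) : ℂ) • A (m + 1) = p (m + 1) • -boson (-((m + 1 : ℕ) : ℤ)) := by
    intro m
    have : ((m + 1 : ℕ) : ℂ) ≠ 0 := by exact_mod_cast m.succ_ne_zero
    rw [hA, smul_smul, mul_neg, mul_div_cancel₀ _ this, neg_smul, smul_neg]
  have key := isFermion_dual.pairing_annProd isVacuum_dual hN (n := n)
    (α := fun m => (-boson (-(m : ℤ))).dualMap)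
    (G := fun d => Module.Dual.eval ℂ Fock (expPart A d (1 : Fock)))
    -- On the dual space the transpose of -a_{-m} raises indices by m, with the signs that a_m has
    -- on Fock space; the minus sign in the S-dual ket is what makes this match.
    (fun m s φ => by
      refine LinearMap.ext fun v => ?_
      simp only [LinearMap.add_apply, LinearMap.dualMap_apply, dualPsiDag_apply,
        LinearMap.neg_apply, map_neg]
      rw [boson_psiDag, map_add, show -(m : ℤ) + (-1 - s) = -1 - (m + s) by ring]
      abel)
    (fun m hm => isFermion_dual.shift_ground isVacuum_dual (m := (m : ℤ)) (by exact_mod_cast hm)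
      (fun s φ => by
        refine LinearMap.ext fun v => ?_
        simp only [LinearMap.add_apply, LinearMap.dualMap_apply, dualPsi_apply,
          LinearMap.neg_apply, map_neg]
        rw [boson_psi, map_add, map_neg, show -(m : ℤ) + (-1 - s) = -1 - (m + s) by ring]
        abel)
      (by
        refine LinearMap.ext fun v => ?_
        simp only [LinearMap.dualMap_apply, LinearMap.neg_apply, map_neg, LinearMap.zero_apply]
        rw [vacBra_boson (by omega), neg_zero]) n)
    (by rw [expPart_zero]; rfl)
    (fun d φ => by
      have h1 := congrArg (fun X : Module.End ℂ Fock => φ (X 1)) (expPart_recursion hcomm d)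
      simp only [hA1, LinearMap.smul_apply, map_smul, LinearMap.sum_apply, map_sum, smul_eq_mul,
        smul_mul_assoc, Module.End.mul_apply] at h1
      exact h1) d
    (fun i => ((n - 1 - i : ℕ) : ℤ) - μ.rowLen (n - 1 - i))
  rw [degShift_rows hn, detShift_rows] at key
  rw [bra_transpose_eq μ hn]
  simp only [Nat.cast_inj] at key
  exact key

/-! ### Complete homogeneous symmetric functions -/

/-- The complete homogeneous symmetric function `h_k(x_0, …, x_{N-1})`. -/
def hFin (x : ℕ → ℂ) (N k : ℕ) : ℂ :=
  PowerSeries.coeff k (∏ i ∈ Finset.range N, PowerSeries.mk fun n => x i ^ n)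

theorem one_sub_mul_mk_pow (y : ℂ) :
    (1 - PowerSeries.C y * PowerSeries.X) * (PowerSeries.mk fun n => y ^ n) = 1 := by
  ext n
  rw [sub_mul, one_mul, map_sub, mul_assoc, PowerSeries.coeff_C_mul]
  cases n with
  | zero => simp
  | succ n => simp [PowerSeries.coeff_succ_X_mul, PowerSeries.coeff_one, pow_succ']

theorem hFin_zero_right (x : ℕ → ℂ) (N : ℕ) : hFin x N 0 = 1 := by
  simp [hFin, map_prod]

theorem hFin_succ_left (x : ℕ → ℂ) (N k : ℕ) :
    hFin x (N + 1) (k + 1) = hFin x N (k + 1) + x N * hFin x (N + 1) k := by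
  have h1 : (1 - PowerSeries.C (x N) * PowerSeries.X) *
      (∏ i ∈ Finset.range (N + 1), PowerSeries.mk fun n => x i ^ n) =
      ∏ i ∈ Finset.range N, PowerSeries.mk fun n => x i ^ n := by
    rw [Finset.prod_range_succ, mul_left_comm, one_sub_mul_mk_pow, mul_one]
  have h2 := congrArg (PowerSeries.coeff (k + 1)) h1
  rw [sub_mul, one_mul, map_sub, mul_assoc, PowerSeries.coeff_C_mul,
    PowerSeries.coeff_succ_X_mul] at h2
  exact sub_eq_iff_eq_add.1 h2

theorem extend_hFin_succ (x : ℕ → ℂ) (N : ℕ) (k : ℤ) :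
    extend (hFin x (N + 1)) k = extend (hFin x N) k + x N * extend (hFin x (N + 1)) (k - 1) := by
  rcases lt_trichotomy k 0 with h | h | h
  · rw [extend_neg _ h, extend_neg _ h, extend_neg _ (by omega)]; simp
  · subst h
    rw [extend_neg _ (show (0 : ℤ) - 1 < 0 by omega)]
    simp [extend, hFin_zero_right]
  · obtain ⟨j, rfl⟩ : ∃ j : ℕ, k = (j + 1 : ℕ) := ⟨(k - 1).toNat, by omega⟩
    rw [extend_natCast, extend_natCast, hFin_succ_left]
    congr 2
    rw [← extend_natCast (hFin x (N + 1)) j]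
    congr 1
    push_cast; ring

/-- The recursion in the last variable, stopped after t steps. The remainder still involves all N +
1 variables, and t will be chosen so that it is an entry of the next row of a Jacobi-Trudi matrix.
-/
theorem extend_hFin_expand (x : ℕ → ℂ) (N : ℕ) (k : ℤ) (t : ℕ) :
    extend (hFin x (N + 1)) k = ∑ s ∈ Finset.range t, x N ^ s * extend (hFin x N) (k - s) +
      x N ^ t * extend (hFin x (N + 1)) (k - t) := by
  induction t with
  | zero => simp
  | succ t ih =>
    rw [ih, Finset.sum_range_succ, extend_hFin_succ x N (k - t), pow_succ]
    push_cast
    rw [sub_sub]; ring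

/-- Logarithmic derivative of ∏ 1/(1 - x_i X): applying X d/dX multiplies it by ∑_{m>0} p_m X^m. -/
theorem isNewton_hFin (x : ℕ → ℂ) (N : ℕ) :
    IsNewton (fun m => ∑ i ∈ Finset.range N, x i ^ m) (hFin x N) := by
  refine ⟨hFin_zero_right x N, ?_⟩
  have key : ∀ N : ℕ, euler (∏ i ∈ Finset.range N, PowerSeries.mk fun n => x i ^ n) =
      (PowerSeries.mk fun m => if m = 0 then 0 else ∑ i ∈ Finset.range N, x i ^ m) *
        ∏ i ∈ Finset.range N, PowerSeries.mk fun n => x i ^ n := by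
    intro N
    induction N with
    | zero =>
      ext n
      simp only [Finset.range_zero, Finset.prod_empty, coeff_euler, PowerSeries.coeff_one,
        Finset.sum_empty, ite_self, mul_one, PowerSeries.coeff_mk]
      split_ifs with h <;> simp [h]
    | succ N ih =>
      have h1 : (PowerSeries.mk fun m => if m = 0 then 0 else ∑ i ∈ Finset.range (N + 1), x i ^ m) =
          (PowerSeries.mk fun m => if m = 0 then 0 else ∑ i ∈ Finset.range N, x i ^ m) +
          (PowerSeries.mk fun m => if m = 0 then 0 else x N ^ m) := by
        ext m
        simp only [PowerSeries.coeff_mk, map_add]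
        split_ifs
        · simp
        · rw [Finset.sum_range_succ]
      have h2 : euler (PowerSeries.mk fun n => x N ^ n) =
          (PowerSeries.mk fun m => if m = 0 then 0 else x N ^ m) *
            PowerSeries.mk fun n => x N ^ n := by
        ext n
        rw [coeff_euler, PowerSeries.coeff_mul, Finset.Nat.sum_antidiagonal_eq_sum_range_succ_mk,
          Finset.sum_range_succ']
        simp only [PowerSeries.coeff_mk, Nat.succ_ne_zero, if_false, if_true, zero_mul, add_zero]
        rw [Finset.sum_congr rfl (g := fun _ => x N ^ n), Finset.sum_const, Finset.card_range,
          nsmul_eq_mul]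
        intro k hk
        rw [Finset.mem_range] at hk
        rw [← pow_add]
        congr 1; omega
      rw [Finset.prod_range_succ, euler_mul, ih, h1, h2]
      ring
  intro k
  have h1 := congrArg (PowerSeries.coeff k) (key N)
  rw [coeff_euler, PowerSeries.coeff_mul, Finset.Nat.sum_antidiagonal_eq_sum_range_succ_mk,
    Finset.sum_range_succ'] at h1
  simp only [PowerSeries.coeff_mk, Nat.succ_ne_zero, if_false, if_true, zero_mul, add_zero] at h1
  exact h1

/-! ### Branching of Jacobi-Trudi determinants -/

/-- Extension by zero of a finite sequence. -/
def ofFin {n : ℕ} (m : Fin n → ℕ) (i : ℕ) : ℕ := if h : i < n then m ⟨i, h⟩ else 0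

theorem ofFin_coe {n : ℕ} (m : Fin n → ℕ) (i : Fin n) : ofFin m i = m i := by
  simp [ofFin]

theorem ofFin_of_lt {n : ℕ} (m : Fin n → ℕ) {i : ℕ} (h : i < n) : ofFin m i = m ⟨i, h⟩ := by
  simp [ofFin, h]

theorem ofFin_of_le {n : ℕ} (m : Fin n → ℕ) {i : ℕ} (h : n ≤ i) : ofFin m i = 0 := by
  simp [ofFin, h]

/-- The sequences `m'` with `m_{i+1} ≤ m'_i ≤ m_i`. -/
def interlacing (n : ℕ) (m : ℕ → ℕ) : Finset (Fin n → ℕ) :=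
  Fintype.piFinset fun i : Fin n => Finset.Icc (m (i + 1)) (m i)

/-- The branching rule. Subtracting from each row a multiple of the next one replaces it by ∑
x_N^{m_i-k} (row of k in N variables), with k from m_{i+1} to m_i; multilinearity in the rows then
yields the sum over interlacing sequences. -/
theorem jacobiTrudi_succ (x : ℕ → ℂ) (N : ℕ) {n : ℕ} {m : ℕ → ℕ} (hm : Antitone m)
    (hmn : m n = 0) :
    jacobiTrudi (hFin x (N + 1)) n m = ∑ m' ∈ interlacing n m,
      (∏ i : Fin n, x N ^ (m i - m' i)) * jacobiTrudi (hFin x N) n (ofFin m') := by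
  set A : Matrix (Fin n) (Fin n) ℂ :=
    Matrix.of fun i j => extend (hFin x (N + 1)) ((m i : ℤ) - (i : ℕ) + (j : ℕ)) with hA
  set B : Matrix (Fin n) (Fin n) ℂ := fun i => ∑ k ∈ Finset.Icc (m (i + 1)) (m i),
    x N ^ (m i - k) • fun j : Fin n => extend (hFin x N) ((k : ℤ) - (i : ℕ) + (j : ℕ)) with hB
  have hAB : ∀ i j : Fin n, A i j = B i j + x N ^ (m i - m (i + 1) + 1) *
      extend (hFin x (N + 1)) ((m (i + 1) : ℤ) - ((i : ℕ) + 1) + (j : ℕ)) := by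
    intro i j
    have hi := hm (Nat.le_succ (i : ℕ))
    simp only [Nat.succ_eq_add_one] at hi
    -- With m_i - m_{i+1} + 1 steps the remainder has index m_{i+1} - (i+1) + j, the entry of row i
    -- + 1.
    rw [hA, Matrix.of_apply, extend_hFin_expand x N _ (m i - m (i + 1) + 1)]
    congr 1
    · rw [hB]
      simp only [Finset.sum_apply, Pi.smul_apply, smul_eq_mul]
      refine Finset.sum_nbij' (fun s => m i - s) (fun k => m i - k) ?_ ?_ ?_ ?_ ?_
      · intro s hs; rw [Finset.mem_range] at hs; rw [Finset.mem_Icc]; omega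
      · intro s hs; rw [Finset.mem_Icc] at hs; rw [Finset.mem_range]; omega
      · intro s hs; rw [Finset.mem_range] at hs; omega
      · intro s hs; rw [Finset.mem_Icc] at hs; omega
      · intro s hs
        rw [Finset.mem_range] at hs
        congr 2
        · omega
        · omega
    · congr 2
      omega
  have hdet : A.det = B.det := by
    cases n with
    | zero => simp
    | succ n =>
      -- After reversal the next row becomes the preceding one. The original last row comes first
      -- and needs no correction, because its remainder has a negative index.
      rw [← Matrix.det_submatrix_equiv_self Fin.revPerm A,
        ← Matrix.det_submatrix_equiv_self Fin.revPerm B]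
      refine Matrix.det_eq_of_forall_row_eq_smul_add_pred
        (fun i => x N ^ (m (Fin.rev i.succ) - m ((Fin.rev i.succ : ℕ) + 1) + 1)) ?_ ?_
      · intro j
        rw [Matrix.submatrix_apply, Matrix.submatrix_apply, hAB, extend_neg, mul_zero, add_zero]
        have := (Fin.revPerm j).2
        simp only [Fin.revPerm_apply, Fin.val_rev, Fin.val_zero] at this ⊢
        simp only [zero_add, Nat.add_sub_cancel, hmn]
        push_cast
        omega
      · intro i j
        rw [Matrix.submatrix_apply, Matrix.submatrix_apply, Matrix.submatrix_apply, hAB]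
        simp only [Fin.revPerm_apply]
        congr 2
        rw [hA, Matrix.of_apply]
        have h1 : ((Fin.rev i.castSucc : Fin (n + 1)) : ℕ) = (Fin.rev i.succ : Fin (n + 1)) + 1 := by
          simp only [Fin.val_rev, Fin.val_succ, Fin.val_castSucc]; omega
        rw [h1]; push_cast; rfl
  have hexp : B.det = ∑ m' ∈ interlacing n m,
      Matrix.det (fun i : Fin n => x N ^ (m i - m' i) •
        fun j : Fin n => extend (hFin x N) ((m' i : ℤ) - (i : ℕ) + (j : ℕ))) :=
    (Matrix.detRowAlternating (R := ℂ) (n := Fin n)).toMultilinearMap.map_sum_finset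
      (fun (i : Fin n) (k : ℕ) => x N ^ (m i - k) • fun j : Fin n =>
        extend (hFin x N) ((k : ℤ) - (i : ℕ) + (j : ℕ))) fun i => Finset.Icc (m (i + 1)) (m i)
  rw [jacobiTrudi, hdet, hexp]
  refine Finset.sum_congr rfl fun m' _ => ?_
  refine ((Matrix.detRowAlternating (R := ℂ) (n := Fin n)).toMultilinearMap.map_smul_univ
    (fun i => x N ^ (m i - m' i)) _).trans ?_
  rw [smul_eq_mul, jacobiTrudi]
  simp only [ofFin_coe]
  rfl

/-! ### Tableaux with bounded entries -/

/-- `f` is a semistandard tableau with row lengths `m` and entries less than `N`. -/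
structure IsTab (m : ℕ → ℕ) (N : ℕ) (f : ℕ → ℕ → ℕ) : Prop where
  row_weak : ∀ i j₁ j₂, j₁ < j₂ → j₂ < m i → f i j₁ ≤ f i j₂
  col_strict : ∀ i₁ i₂ j, i₁ < i₂ → j < m i₂ → f i₁ j < f i₂ j
  zeros : ∀ i j, m i ≤ j → f i j = 0
  lt : ∀ i j, j < m i → f i j < N

theorem finite_isTab {m : ℕ → ℕ} {n : ℕ} (hm : Antitone m) (hmn : m n = 0) (N : ℕ) :
    {f | IsTab m N f}.Finite := by
  let g : (ℕ → ℕ → ℕ) → (Fin n × Fin (m 0) → ℕ) := fun f p => f p.1 p.2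
  refine Set.Finite.of_finite_image (f := g) ?_ ?_
  · refine (Set.Finite.pi' fun _ : Fin n × Fin (m 0) => Set.finite_Iio (N + 1)).subset ?_
    rintro _ ⟨f, hf, rfl⟩ p
    rw [Set.mem_Iio]
    rcases lt_or_ge (p.2 : ℕ) (m p.1) with h | h
    · exact (hf.lt _ _ h).trans (Nat.lt_succ_self N)
    · simp [g, hf.zeros _ _ h]
  · intro f hf f' hf' h
    ext i j
    rcases lt_or_ge j (m i) with hj | hj
    · have hi : i < n := by
        by_contra hc
        have := hm (not_lt.1 hc)
        omega
      have := hm (Nat.zero_le i)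
      exact congrFun h (⟨i, hi⟩, ⟨j, by omega⟩)
    · rw [hf.zeros _ _ hj, hf'.zeros _ _ hj]

/-- The generating function of the tableaux with row lengths `m_0, …, m_{n-1}` in the variables
`x_0, …, x_{N-1}`. -/
def tabSum (x : ℕ → ℂ) (N n : ℕ) (m : ℕ → ℕ) : ℂ :=
  ∑ᶠ f ∈ {f | IsTab m N f}, ∏ i ∈ Finset.range n, ∏ j ∈ Finset.range (m i), x (f i j)

theorem lt_card_filter {P : ℕ → Prop} [DecidablePred P] {M : ℕ}
    (hP : ∀ i j, i < j → j < M → P j → P i) (j : ℕ) :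
    j < ((Finset.range M).filter P).card ↔ j < M ∧ P j := by
  induction M with
  | zero => simp
  | succ M ih =>
    rw [Finset.range_add_one, Finset.filter_insert]
    split_ifs with h
    · have h1 : (Finset.range M).filter P = Finset.range M :=
        Finset.filter_true_of_mem fun i hi => hP i M (Finset.mem_range.1 hi) (by omega) h
      rw [h1, Finset.card_insert_of_notMem Finset.notMem_range_self, Finset.card_range]
      refine ⟨fun hj => ⟨hj, ?_⟩, fun hj => hj.1⟩
      rcases Nat.lt_succ_iff_lt_or_eq.1 hj with hj | rfl
      · exact hP j M hj (by omega) h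
      · exact h
    · rw [ih fun i j hij hj => hP i j hij (by omega)]
      refine ⟨fun hj => ⟨by omega, hj.2⟩, fun hj => ⟨?_, hj.2⟩⟩
      rcases Nat.lt_succ_iff_lt_or_eq.1 hj.1 with h1 | rfl
      · exact h1
      · exact absurd hj.2 h

/-- The row lengths of the entries less than `N`. -/
def subShape (n : ℕ) (m : ℕ → ℕ) (N : ℕ) (f : ℕ → ℕ → ℕ) (i : Fin n) : ℕ :=
  ((Finset.range (m i)).filter fun j => f i j < N).card

theorem IsTab.lt_subShape {n : ℕ} {m : ℕ → ℕ} {N M : ℕ} {f : ℕ → ℕ → ℕ} (hf : IsTab m M f)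
    (i : Fin n) (j : ℕ) : j < subShape n m N f i ↔ j < m i ∧ f i j < N :=
  lt_card_filter (fun j₁ j₂ h h2 h3 => (hf.row_weak i j₁ j₂ h h2).trans_lt h3) j

theorem IsTab.lt_ofFin_subShape {n : ℕ} {m : ℕ → ℕ} (hm : ∀ i, n ≤ i → m i = 0) {N M : ℕ}
    {f : ℕ → ℕ → ℕ} (hf : IsTab m M f)
    (i : ℕ) (j : ℕ) : j < ofFin (subShape n m N f) i ↔ j < m i ∧ f i j < N := by
  rcases lt_or_ge i n with hi | hi
  · rw [ofFin_of_lt _ hi, hf.lt_subShape]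
  · rw [ofFin_of_le _ hi, hm i hi]; simp

/-- The same branching rule for tableaux: removing the entries equal to N leaves a tableau with
entries below N. Strict columns say precisely that the removed cells form a horizontal strip, so the
shapes interlace. The inverse map fills the strip with N. -/
theorem tabSum_succ (x : ℕ → ℂ) (N : ℕ) {n : ℕ} {m : ℕ → ℕ} (hm : Antitone m)
    (hmn : m n = 0) :
    tabSum x (N + 1) n m = ∑ m' ∈ interlacing n m,
      (∏ i : Fin n, x N ^ (m i - m' i)) * tabSum x N n (ofFin m') := by
  have hm0 : ∀ i, n ≤ i → m i = 0 := fun i hi => by have := hm hi; omega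
  have hint : ∀ m' ∈ interlacing n m, ∀ i, m (i + 1) ≤ ofFin m' i ∧ ofFin m' i ≤ m i := by
    intro m' hm' i
    rcases lt_or_ge i n with hi | hi
    · rw [ofFin_of_lt _ hi]
      exact Finset.mem_Icc.1 (Fintype.mem_piFinset.1 hm' ⟨i, hi⟩)
    · rw [ofFin_of_le _ hi, hm0 _ (by omega)]; simp
  have hanti : ∀ m' ∈ interlacing n m, Antitone (ofFin m') := fun m' hm' =>
    antitone_nat_of_succ_le fun i => (hint m' hm' (i + 1)).2.trans (hint m' hm' i).1
  have hfin : ∀ m' ∈ interlacing n m, {f | IsTab (ofFin m') N f}.Finite := fun m' hm' =>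
    finite_isTab (hanti m' hm') (ofFin_of_le m' le_rfl) N
  classical
  let F : (Fin n → ℕ) → Finset (ℕ → ℕ → ℕ) := fun m' =>
    if h : m' ∈ interlacing n m then (hfin m' h).toFinset else ∅
  have hF : ∀ m' ∈ interlacing n m, ∀ f, f ∈ F m' ↔ IsTab (ofFin m') N f := by
    intro m' hm' f
    simp [F, hm']
  have hsum : ∀ m' ∈ interlacing n m, (∏ i : Fin n, x N ^ (m i - m' i)) * tabSum x N n (ofFin m') =
      ∑ f ∈ F m', (∏ i : Fin n, x N ^ (m i - m' i)) *
        ∏ i ∈ Finset.range n, ∏ j ∈ Finset.range (ofFin m' i), x (f i j) := by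
    intro m' hm'
    rw [tabSum, finsum_mem_eq_finite_toFinset_sum _ (hfin m' hm'), Finset.mul_sum]
    simp only [F, hm', dif_pos]
  have hext : ∀ m' ∈ interlacing n m, ∀ f, IsTab (ofFin m') N f → IsTab m (N + 1)
      (fun i j => if j < ofFin m' i then f i j else if j < m i then N else 0) := by
    intro m' hm' f hf
    have hi := hint m' hm'
    refine ⟨?_, ?_, ?_, ?_⟩
    · intro i j₁ j₂ h12 h2
      rcases lt_or_ge j₂ (ofFin m' i) with h3 | h3
      · rw [if_pos h3, if_pos (by omega)]
        exact hf.row_weak i j₁ j₂ h12 h3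
      · rw [if_neg (not_lt.2 h3), if_pos h2]
        split_ifs with h4 h5
        · exact (hf.lt _ _ h4).le
        · exact le_rfl
        · exact Nat.zero_le _
    · intro i₁ i₂ j h12 h2
      have h3 : j < ofFin m' i₁ := lt_of_lt_of_le (lt_of_lt_of_le h2 (hm h12)) (hi i₁).1
      rw [if_pos h3]
      split_ifs with h4
      · exact hf.col_strict i₁ i₂ j h12 h4
      · exact hf.lt _ _ h3
    · intro i j h
      have := (hi i).2
      rw [if_neg (by omega), if_neg (by omega)]
    · intro i j h
      split_ifs with h4
      · exact (hf.lt _ _ h4).trans (Nat.lt_succ_self N)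
      · exact Nat.lt_succ_self N
  rw [Finset.sum_congr rfl hsum, Finset.sum_sigma', tabSum,
    finsum_mem_eq_finite_toFinset_sum _ (finite_isTab hm hmn (N + 1))]
  refine Finset.sum_bij'
    (fun f _ => ⟨subShape n m N f, fun i j => if f i j < N then f i j else 0⟩)
    (fun p _ i j => if j < ofFin p.1 i then p.2 i j else if j < m i then N else 0) ?_ ?_ ?_ ?_ ?_
  · intro f hf
    rw [Set.Finite.mem_toFinset] at hf
    have hmem : subShape n m N f ∈ interlacing n m := by
      refine Fintype.mem_piFinset.2 fun i => Finset.mem_Icc.2 ⟨?_, ?_⟩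
      · by_contra hc
        have h1 := (hf.lt_subShape (N := N) i (subShape n m N f i)).not.1 (lt_irrefl _)
        have h2 := hm (Nat.le_succ (i : ℕ))
        simp only [Nat.succ_eq_add_one] at h2
        -- The first removed cell of row i has entry N; a cell below it would have an entry above N,
        -- which the bound excludes.
        have h3 := hf.col_strict i (i + 1) (subShape n m N f i) (by omega) (by omega)
        have h4 := hf.lt (i + 1) (subShape n m N f i) (by omega)
        omega
      · by_contra hc
        have h1 := (hf.lt_subShape (N := N) i (m i)).1 (by omega)
        omega
    rw [Finset.mem_sigma]
    refine ⟨hmem, (hF _ hmem _).2 ⟨?_, ?_, ?_, ?_⟩⟩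
    · intro i j₁ j₂ h12 h2
      rw [hf.lt_ofFin_subShape hm0] at h2
      have := hf.row_weak i j₁ j₂ h12 h2.1
      simp only
      rw [if_pos h2.2, if_pos (by omega)]
      exact this
    · intro i₁ i₂ j h12 h2
      rw [hf.lt_ofFin_subShape hm0] at h2
      have := hf.col_strict i₁ i₂ j h12 h2.1
      simp only
      rw [if_pos h2.2, if_pos (by omega)]
      exact this
    · intro i j h
      have h1 := (hf.lt_ofFin_subShape (N := N) hm0 i j).not.1 (by omega)
      simp only
      split_ifs with h2
      · exact hf.zeros i j (by omega)
      · rfl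
    · intro i j h
      rw [hf.lt_ofFin_subShape hm0] at h
      simp only
      rw [if_pos h.2]
      exact h.2
  · rintro ⟨m', f⟩ hp
    rw [Finset.mem_sigma] at hp
    rw [Set.Finite.mem_toFinset]
    exact hext m' hp.1 f ((hF m' hp.1 f).1 hp.2)
  · intro f hf
    rw [Set.Finite.mem_toFinset] at hf
    ext i j
    simp only
    have h1 := hf.lt_ofFin_subShape (N := N) hm0 i j
    have h2 := hf.lt i j
    have h3 := hf.zeros i j
    split_ifs <;> omega
  · rintro ⟨m', f⟩ hp
    rw [Finset.mem_sigma] at hp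
    obtain ⟨hm', hf⟩ := hp
    simp only at hm' hf
    rw [hF m' hm'] at hf
    have hi := hint m' hm'
    have hg := hext m' hm' f hf
    rw [Sigma.mk.injEq, heq_eq_eq]
    refine ⟨funext fun i => ?_, ?_⟩
    · have h1 : ∀ j, j < subShape n m N (fun i j => if j < ofFin m' i then f i j else
          if j < m i then N else 0) i ↔ j < m' i := by
        intro j
        rw [hg.lt_subShape, ← ofFin_coe m' i]
        have h2 := hf.lt i j
        have h3 := (hi i).2
        split_ifs <;> omega
      have h2 := h1 (m' i)
      have h3 := h1 (subShape n m N (fun i j => if j < ofFin m' i then f i j else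
          if j < m i then N else 0) i)
      simp only [lt_irrefl, iff_false, false_iff] at h2 h3
      exact le_antisymm (not_lt.1 h2) (not_lt.1 h3)
    · ext i j
      simp only
      have h2 := hf.lt i j
      have h3 := hf.zeros i j
      split_ifs <;> omega
  · intro f hf
    rw [Set.Finite.mem_toFinset] at hf
    simp only
    rw [Finset.prod_range, Finset.prod_range, ← Finset.prod_mul_distrib]
    refine Finset.prod_congr rfl fun i _ => ?_
    have hle : ofFin (subShape n m N f) i ≤ m i := by
      by_contra hc
      have := (hf.lt_ofFin_subShape (N := N) hm0 i (m i)).1 (by omega)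
      omega
    rw [← Finset.prod_range_mul_prod_Ico _ hle, mul_comm]
    congr 1
    · rw [Finset.prod_congr rfl (g := fun _ => x N), Finset.prod_const, Nat.card_Ico, ofFin_coe]
      intro j hj
      rw [Finset.mem_Ico] at hj
      have h1 := (hf.lt_ofFin_subShape (N := N) hm0 i j).not.1 (by omega)
      have h2 := hf.lt i j hj.2
      congr 1
      omega
    · refine Finset.prod_congr rfl fun j hj => ?_
      rw [Finset.mem_range, hf.lt_ofFin_subShape hm0] at hj
      rw [if_pos hj.2]

/-- With no variables only the empty shape has a tableau. The matrix is then the identity; otherwise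
its row 0 has indices m_0 + j > 0 and vanishes. -/
theorem tabSum_zero (x : ℕ → ℂ) {n : ℕ} {m : ℕ → ℕ} (hm : Antitone m) (hmn : m n = 0) :
    tabSum x 0 n m = jacobiTrudi (hFin x 0) n m := by
  have hh : ∀ k : ℤ, extend (hFin x 0) k = if k = 0 then 1 else 0 := by
    intro k
    rcases lt_or_ge k 0 with h | h
    · rw [extend_neg _ h, if_neg h.ne]
    · lift k to ℕ using h
      rw [extend_natCast]
      simp [hFin, PowerSeries.coeff_one]
  rcases Nat.eq_zero_or_pos (m 0) with h0 | h0
  · have hm0 : ∀ i, m i = 0 := fun i => by have := hm (Nat.zero_le i); omega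
    have hset : {f | IsTab m 0 f} = {fun _ _ => 0} := by
      ext f
      rw [Set.mem_singleton_iff]
      refine ⟨fun hf => ?_, ?_⟩
      · ext i j
        exact hf.zeros i j (by rw [hm0]; omega)
      · rintro rfl
        exact ⟨fun _ _ _ _ _ => le_rfl, fun i₁ i₂ j _ h => by rw [hm0] at h; omega,
          fun _ _ _ => rfl, fun i j h => by rw [hm0] at h; omega⟩
    rw [tabSum, hset, finsum_mem_singleton, jacobiTrudi]
    have : (Matrix.of fun i j : Fin n => extend (hFin x 0) ((m i : ℤ) - (i : ℕ) + (j : ℕ))) = 1 := by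
      ext i j
      rw [Matrix.of_apply, hh, Matrix.one_apply, hm0]
      congr 1
      rw [Fin.ext_iff]
      exact propext ⟨fun h => by omega, fun h => by omega⟩
    rw [this, Matrix.det_one]
    simp [hm0]
  · have hn : 0 < n := by
      by_contra hc
      rw [Nat.eq_zero_of_not_pos hc] at hmn
      omega
    have hset : {f | IsTab m 0 f} = ∅ := by
      ext f
      simp only [Set.mem_ofPred_eq, Set.mem_empty_iff_false, iff_false]
      intro hf
      exact absurd (hf.lt 0 0 h0) (by omega)
    rw [tabSum, hset, finsum_mem_empty, jacobiTrudi, Matrix.det_eq_zero_of_row_eq_zero ⟨0, hn⟩]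
    intro j
    rw [Matrix.of_apply, hh, if_neg]
    simp only
    omega

theorem interlacing_antitone {n : ℕ} {m : ℕ → ℕ} {m' : Fin n → ℕ}
    (hm' : m' ∈ interlacing n m) : Antitone (ofFin m') := by
  refine antitone_nat_of_succ_le fun i => ?_
  rcases lt_or_ge (i + 1) n with h | h
  · rw [ofFin_of_lt _ h, ofFin_of_lt _ (by omega)]
    have h1 := Finset.mem_Icc.1 (Fintype.mem_piFinset.1 hm' ⟨i + 1, h⟩)
    have h2 := Finset.mem_Icc.1 (Fintype.mem_piFinset.1 hm' ⟨i, by omega⟩)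
    exact h1.2.trans h2.1
  · rw [ofFin_of_le _ h]
    exact Nat.zero_le _

/-- The Jacobi-Trudi formula in finitely many variables. -/
theorem tabSum_eq_jacobiTrudi (x : ℕ → ℂ) (N : ℕ) {n : ℕ} {m : ℕ → ℕ} (hm : Antitone m)
    (hmn : m n = 0) : tabSum x N n m = jacobiTrudi (hFin x N) n m := by
  induction N generalizing m with
  | zero => exact tabSum_zero x hm hmn
  | succ N ih =>
    rw [tabSum_succ x N hm hmn, jacobiTrudi_succ x N hm hmn]
    exact Finset.sum_congr rfl fun m' hm' => by
      rw [ih (interlacing_antitone hm') (ofFin_of_le m' le_rfl)]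

/-! ### Schur functions of infinitely many variables -/

/-- The sequence determined by Newton's identities from the power sums `p`. -/
def newtonSeq (p : ℕ → ℂ) : ℕ → ℂ
  | 0 => 1
  | k + 1 => ((k : ℂ) + 1)⁻¹ * ∑ m : Fin (k + 1), p (m + 1) * newtonSeq p (k - m)

theorem isNewton_newtonSeq (p : ℕ → ℂ) : IsNewton p (newtonSeq p) := by
  refine ⟨by rw [newtonSeq], fun k => ?_⟩
  cases k with
  | zero => simp
  | succ k =>
    have : (k : ℂ) + 1 ≠ 0 := by exact_mod_cast k.succ_ne_zero
    rw [newtonSeq, Nat.cast_succ, mul_inv_cancel_left₀ this, Finset.sum_range]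
    simp

open Filter Topology in
-- Newton's identities give h_k as a polynomial in p_1, …, p_k, so convergence of the power sums is
-- enough.
theorem IsNewton.tendsto {p : ℕ → ℕ → ℂ} {h : ℕ → ℕ → ℂ} {P H : ℕ → ℂ}
    (hN : ∀ N, IsNewton (p N) (h N)) (hNH : IsNewton P H)
    (hp : ∀ m, 0 < m → Tendsto (fun N => p N m) atTop (𝓝 (P m))) (k : ℕ) :
    Tendsto (fun N => h N k) atTop (𝓝 (H k)) := by
  induction k using Nat.strong_induction_on with
  | _ k ih =>
    rcases Nat.eq_zero_or_pos k with h0 | h0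
    · subst h0
      simp only [(hN _).zero, hNH.zero, tendsto_const_nhds]
    · have hk : (k : ℂ) ≠ 0 := by exact_mod_cast h0.ne'
      have h1 : ∀ {p h : ℕ → ℂ}, IsNewton p h →
          h k = (k : ℂ)⁻¹ * ∑ m ∈ Finset.range k, p (m + 1) * h (k - (m + 1)) := by
        intro p h hN
        rw [← hN.newton, inv_mul_cancel_left₀ hk]
      rw [h1 hNH]
      simp only [h1 (hN _)]
      refine tendsto_const_nhds.mul (tendsto_finsetSum _ fun m hm => ?_)
      rw [Finset.mem_range] at hm
      exact (hp _ (Nat.succ_pos m)).mul (ih _ (by omega))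

open Filter Topology in
theorem tendsto_jacobiTrudi {h : ℕ → ℕ → ℂ} {H : ℕ → ℂ}
    (hh : ∀ k, Tendsto (fun N => h N k) atTop (𝓝 (H k))) (n : ℕ) (m : ℕ → ℕ) :
    Tendsto (fun N => jacobiTrudi (h N) n m) atTop (𝓝 (jacobiTrudi H n m)) := by
  unfold jacobiTrudi
  refine ((continuous_id.matrix_det).tendsto _).comp ?_
  refine tendsto_pi_nhds.2 fun i => tendsto_pi_nhds.2 fun j => ?_
  simp only [Matrix.of_apply]
  unfold extend
  split_ifs
  · exact tendsto_const_nhds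
  · exact hh _

theorem summable_pow_of_summable {x : ℕ → ℂ} (hx : Summable fun i => ‖x i‖) {m : ℕ} (hm : 0 < m) :
    Summable fun i => x i ^ m := by
  refine Summable.of_norm_bounded_eventually hx ?_
  have h1 : ∀ᶠ i in Filter.cofinite, ‖x i‖ < 1 := hx.tendsto_cofinite_zero.eventually_lt_const one_pos
  filter_upwards [h1] with i hi
  rw [norm_pow]
  exact pow_le_of_le_one (norm_nonneg _) hi.le hm.ne'

open Filter Topology in
theorem tendsto_tabSum {x : ℕ → ℂ} (hx : Summable fun i => ‖x i‖) {n : ℕ} {m : ℕ → ℕ}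
    (hm : Antitone m) (hmn : m n = 0) :
    Tendsto (fun N => tabSum x N n m) atTop
      (𝓝 (jacobiTrudi (newtonSeq fun k => powerSum k x) n m)) := by
  simp only [fun N => tabSum_eq_jacobiTrudi x N hm hmn]
  refine tendsto_jacobiTrudi (fun k => ?_) n m
  refine IsNewton.tendsto (fun N => isNewton_hFin x N) (isNewton_newtonSeq _) (fun k hk => ?_) k
  exact (summable_pow_of_summable hx hk).hasSum.tendsto_sum_nat

/-! ### Passage from bounded tableaux to the sum over all tableaux -/

theorem SkewSSYT.entry_injective (lam eta : YoungDiagram) :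
    Function.Injective (SkewSSYT.entry : SkewSSYT lam eta → ℕ → ℕ → ℕ) := by
  rintro ⟨⟩ ⟨⟩ h
  congr

theorem mem_cells_sdiff_bot (μ : YoungDiagram) (i j : ℕ) :
    (i, j) ∈ μ.cells \ (⊥ : YoungDiagram).cells ↔ j < μ.rowLen i := by
  simp [YoungDiagram.mem_iff_lt_rowLen]

theorem exists_entry_eq {μ : YoungDiagram} {N : ℕ} {f : ℕ → ℕ → ℕ} (hf : IsTab μ.rowLen N f) :
    ∃ T : SkewSSYT μ ⊥, T.entry = f := by
  refine ⟨⟨f, ?_, ?_, ?_⟩, rfl⟩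
  · intro i j₁ j₂ h _ h2
    exact hf.row_weak i j₁ j₂ h ((mem_cells_sdiff_bot μ _ _).1 h2)
  · intro i₁ i₂ j h _ h2
    exact hf.col_strict i₁ i₂ j h ((mem_cells_sdiff_bot μ _ _).1 h2)
  · intro i j h
    rw [mem_cells_sdiff_bot] at h
    exact hf.zeros i j (by omega)

theorem SkewSSYT.isTab {μ : YoungDiagram} (T : SkewSSYT μ ⊥) {N : ℕ}
    (hN : ∀ i j, j < μ.rowLen i → T.entry i j < N) : IsTab μ.rowLen N T.entry := by
  refine ⟨fun i j₁ j₂ h h2 => T.row_weak i j₁ j₂ h ?_ ?_,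
    fun i₁ i₂ j h h2 => T.col_strict i₁ i₂ j h ?_ ?_, fun i j h => T.zeros i j ?_, hN⟩
  · rw [mem_cells_sdiff_bot]; omega
  · rwa [mem_cells_sdiff_bot]
  · rw [mem_cells_sdiff_bot]
    have := μ.rowLen_anti _ _ h.le
    omega
  · rwa [mem_cells_sdiff_bot]
  · rw [mem_cells_sdiff_bot]; omega

theorem antitone_rowLen (μ : YoungDiagram) : Antitone μ.rowLen := fun _ _ h => μ.rowLen_anti _ _ h

/-- The tableaux of shape `μ` with entries less than `N`. -/
def boundedTabs (μ : YoungDiagram) (N : ℕ) : Finset (SkewSSYT μ ⊥) :=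
  (finite_isTab (antitone_rowLen μ) (rowLen_eq_zero (le_refl (μ.colLen 0))) N).toFinset.preimage
    SkewSSYT.entry (SkewSSYT.entry_injective μ ⊥).injOn

theorem mem_boundedTabs {μ : YoungDiagram} {N : ℕ} (T : SkewSSYT μ ⊥) :
    T ∈ boundedTabs μ N ↔ IsTab μ.rowLen N T.entry := by
  simp [boundedTabs]

/-- The monomial of a tableau. -/
def tabWeight (μ : YoungDiagram) (x : ℕ → ℂ) (T : SkewSSYT μ ⊥) : ℂ :=
  ∏ c ∈ μ.cells \ (⊥ : YoungDiagram).cells, x (T.entry c.1 c.2)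

theorem sum_boundedTabs (μ : YoungDiagram) (x : ℕ → ℂ) (N : ℕ) {n : ℕ} (hn : μ.colLen 0 ≤ n) :
    ∑ T ∈ boundedTabs μ N, tabWeight μ x T = tabSum x N n μ.rowLen := by
  have hfin := finite_isTab (antitone_rowLen μ) (rowLen_eq_zero (le_refl (μ.colLen 0))) N
  rw [tabSum, finsum_mem_eq_finite_toFinset_sum _ hfin]
  refine Finset.sum_nbij SkewSSYT.entry ?_ ?_ ?_ ?_
  · intro T hT
    rw [Set.Finite.mem_toFinset]
    exact (mem_boundedTabs T).1 hT
  · exact (SkewSSYT.entry_injective μ ⊥).injOn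
  · intro f hf
    rw [Finset.mem_coe, Set.Finite.mem_toFinset] at hf
    obtain ⟨T, rfl⟩ := exists_entry_eq hf
    exact ⟨T, (mem_boundedTabs T).2 hf, rfl⟩
  · intro T _
    rw [tabWeight, YoungDiagram.cells_bot, Finset.sdiff_empty]
    exact Finset.prod_finset_product _ _ _ (fun c => by
      rw [YoungDiagram.mem_cells, Finset.mem_range, Finset.mem_range,
        ← YoungDiagram.mem_iff_lt_rowLen]
      refine ⟨fun h => ⟨?_, h⟩, fun h => h.2⟩
      have h1 := YoungDiagram.mem_iff_lt_colLen.1 (μ.up_left_mem le_rfl (Nat.zero_le c.2) h)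
      omega)

open Filter Topology in
theorem tendsto_boundedTabs (μ : YoungDiagram) : Tendsto (boundedTabs μ) atTop atTop := by
  refine tendsto_atTop_finset_of_monotone ?_ ?_
  · intro N M h T hT
    rw [mem_boundedTabs] at hT ⊢
    exact ⟨hT.row_weak, hT.col_strict, hT.zeros, fun i j hj => (hT.lt i j hj).trans_le h⟩
  · intro T
    refine ⟨μ.cells.sup (fun c => T.entry c.1 c.2) + 1, (mem_boundedTabs T).2 (T.isTab ?_)⟩
    intro i j hj
    rw [Nat.lt_succ_iff]
    exact Finset.le_sup (f := fun c : ℕ × ℕ => T.entry c.1 c.2)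
      ((YoungDiagram.mem_cells _).2 (YoungDiagram.mem_iff_lt_rowLen.2 hj))

/-- In the variables |x_i| the weights are nonnegative and the truncated sums converge by the finite
Jacobi-Trudi formula, hence are bounded. Any finite set of tableaux lies in some truncation, so the
same bound controls it. -/
theorem summable_tabWeight (μ : YoungDiagram) {x : ℕ → ℂ} (hx : Summable fun i => ‖x i‖) :
    Summable (tabWeight μ x) := by
  refine Summable.of_norm ?_
  have h1 := tendsto_tabSum (x := fun i => (‖x i‖ : ℂ)) (by simpa using hx) (antitone_rowLen μ)
    (rowLen_eq_zero (le_refl (μ.colLen 0)))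
  obtain ⟨C, hC⟩ := h1.norm.bddAbove_range
  refine summable_of_sum_le (c := C) (fun T => norm_nonneg _) fun s => ?_
  obtain ⟨N, hN⟩ := ((tendsto_boundedTabs μ).eventually (Filter.eventually_ge_atTop s)).exists
  refine (Finset.sum_le_sum_of_subset_of_nonneg hN fun _ _ _ => norm_nonneg _).trans ?_
  have h2 : ‖tabSum (fun i => (‖x i‖ : ℂ)) N (μ.colLen 0) μ.rowLen‖ ≤ C := hC ⟨N, rfl⟩
  rw [← sum_boundedTabs μ _ N le_rfl] at h2
  refine le_trans (le_of_eq ?_) h2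
  have h3 : ∀ T, tabWeight μ (fun i => (‖x i‖ : ℂ)) T = ((‖tabWeight μ x T‖ : ℝ) : ℂ) := by
    intro T
    simp [tabWeight, norm_prod]
  simp only [h3]
  rw [← Complex.ofReal_sum, Complex.norm_real, Real.norm_of_nonneg]
  exact Finset.sum_nonneg fun _ _ => norm_nonneg _

theorem schur_eq_tsum (μ : YoungDiagram) (x : ℕ → ℂ) : schur μ x = ∑' T, tabWeight μ x T := by
  rw [schur, skewSchur, if_pos bot_le]
  rfl

open Filter Topology in
-- The number of rows may vary with N, which permits square N × N determinants later.
theorem tendsto_tabSum_schur (μ : YoungDiagram) {x : ℕ → ℂ} (hx : Summable fun i => ‖x i‖)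
    {n : ℕ → ℕ} (hn : ∀ᶠ N in atTop, μ.colLen 0 ≤ n N) :
    Tendsto (fun N => tabSum x N (n N) μ.rowLen) atTop (𝓝 (schur μ x)) := by
  have h1 := (summable_tabWeight μ hx).hasSum.comp (tendsto_boundedTabs μ)
  rw [← schur_eq_tsum] at h1
  refine h1.congr' ?_
  filter_upwards [hn] with N hN
  exact sum_boundedTabs μ x N hN

/-- The Jacobi-Trudi formula. -/
theorem schur_eq_jacobiTrudi (μ : YoungDiagram) {x : ℕ → ℂ} (hx : Summable fun i => ‖x i‖)
    {n : ℕ} (hn : μ.colLen 0 ≤ n) :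
    schur μ x = jacobiTrudi (newtonSeq fun k => powerSum k x) n μ.rowLen :=
  tendsto_nhds_unique
    (tendsto_tabSum_schur μ hx (n := fun _ => n) (Filter.Eventually.of_forall fun _ => hn))
    (tendsto_tabSum hx (antitone_rowLen μ) (rowLen_eq_zero hn))

theorem schur_smul (μ : YoungDiagram) (c : ℂ) (x : ℕ → ℂ) :
    schur μ (fun i => c * x i) = c ^ μ.card * schur μ x := by
  rw [schur_eq_tsum, schur_eq_tsum, ← tsum_mul_left]
  congr 1
  ext T
  rw [tabWeight, tabWeight, Finset.prod_mul_distrib, Finset.prod_const, YoungDiagram.cells_bot,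
    Finset.sdiff_empty]

/-! ### Bialternants -/

theorem jacobiTrudi_zero {h : ℕ → ℂ} (h0 : h 0 = 1) (n : ℕ) :
    jacobiTrudi h n (fun _ => 0) = 1 := by
  rw [jacobiTrudi, Matrix.det_of_isUpperTriangular]
  · simp [extend, h0]
  · intro i j hij
    simp only [id_eq] at hij
    rw [Matrix.of_apply, extend_neg]
    have := Fin.lt_def.1 hij
    push_cast
    omega

/-- From 1/(1 - x_j X) = H(X) G_j(X) with G_j = ∏_{i≠j} (1 - x_i X), the matrix of powers factors as
the Jacobi-Trudi matrix times the coefficient matrix of the G_j. The case m = 0 has a unitriangular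
first factor and evaluates the second. Nothing is divided, so the x_j need not be distinct. -/
theorem det_pow_eq (x : ℕ → ℂ) (N : ℕ) (m : ℕ → ℕ) :
    Matrix.det (Matrix.of fun i j : Fin N => x j ^ (m i + (N - 1 - i))) =
      jacobiTrudi (hFin x N) N m *
        Matrix.det (Matrix.of fun i j : Fin N => x j ^ (N - 1 - (i : ℕ))) := by
  let G : Fin N → Polynomial ℂ := fun j =>
    ∏ i ∈ (Finset.range N).erase j, (1 - Polynomial.C (x i) * Polynomial.X)
  have hGdeg : ∀ j k, N ≤ k → (G j).coeff k = 0 := by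
    intro j k hk
    refine Polynomial.coeff_eq_zero_of_natDegree_lt (lt_of_lt_of_le ?_ hk)
    refine lt_of_le_of_lt (Polynomial.natDegree_prod_le _ _) ?_
    refine lt_of_le_of_lt (Finset.sum_le_card_nsmul _ _ 1 fun i _ => ?_) ?_
    · refine (Polynomial.natDegree_sub_le _ _).trans ?_
      rw [Polynomial.natDegree_one]
      simpa using (Polynomial.natDegree_C_mul_le (x i) Polynomial.X).trans Polynomial.natDegree_X_le
    · rw [Finset.card_erase_of_mem (Finset.mem_range.2 j.2), Finset.card_range]
      have := j.2
      simp only [smul_eq_mul, mul_one]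
      omega
  have hG : ∀ j : Fin N, (∏ i ∈ Finset.range N, PowerSeries.mk fun n => x i ^ n) *
      (G j : PowerSeries ℂ) = PowerSeries.mk fun n => x j ^ n := by
    intro j
    have h1 : (G j : PowerSeries ℂ) =
        ∏ i ∈ (Finset.range N).erase j, (1 - PowerSeries.C (x i) * PowerSeries.X) := by
      rw [← Polynomial.coeToPowerSeries.ringHom_apply, map_prod]
      simp
    rw [h1, ← Finset.mul_prod_erase _ _ (Finset.mem_range.2 j.2), mul_assoc,
      ← Finset.prod_mul_distrib, Finset.prod_eq_one, mul_one]
    intro i _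
    rw [mul_comm, one_sub_mul_mk_pow]
  have hpow : ∀ (j : Fin N) (s : ℕ), x j ^ s = ∑ k : Fin N,
      extend (hFin x N) ((s : ℤ) - ((N - 1 - k : ℕ) : ℤ)) * (G j).coeff (N - 1 - k) := by
    intro j s
    have h1 := congrArg (PowerSeries.coeff s) (hG j)
    rw [PowerSeries.coeff_mk, mul_comm, PowerSeries.coeff_mul,
      Finset.Nat.sum_antidiagonal_eq_sum_range_succ_mk] at h1
    simp only [Polynomial.coeff_coe] at h1
    have h2 : ∀ b, (G j).coeff b * PowerSeries.coeff (s - b)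
        (∏ i ∈ Finset.range N, PowerSeries.mk fun n => x i ^ n) = (G j).coeff b * hFin x N (s - b) :=
      fun b => rfl
    simp only [h2] at h1
    have h3 : ∀ b ∈ Finset.range (s + 1), (G j).coeff b * hFin x N (s - b) =
        extend (hFin x N) ((s : ℤ) - b) * (G j).coeff b := by
      intro b hb
      rw [Finset.mem_range] at hb
      rw [mul_comm, ← extend_natCast (hFin x N), Nat.cast_sub (by omega)]
    rw [← h1, Finset.sum_congr rfl h3]
    have h4 : ∑ k : Fin N, extend (hFin x N) ((s : ℤ) - ((N - 1 - k : ℕ) : ℤ)) *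
        (G j).coeff (N - 1 - k) =
        ∑ b ∈ Finset.range N, extend (hFin x N) ((s : ℤ) - b) * (G j).coeff b := by
      rw [← Finset.sum_range_reflect, Finset.sum_range]
    rw [h4]
    have h5 : ∀ A B : ℕ, (∀ b, A ≤ b → extend (hFin x N) ((s : ℤ) - b) * (G j).coeff b = 0) →
        A ≤ B → ∑ b ∈ Finset.range A, extend (hFin x N) ((s : ℤ) - b) * (G j).coeff b =
          ∑ b ∈ Finset.range B, extend (hFin x N) ((s : ℤ) - b) * (G j).coeff b := by
      intro A B hA hAB
      refine Finset.sum_subset (Finset.range_subset_range.2 hAB) fun b _ hb => hA b ?_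
      simpa using hb
    -- The convolution stops at s and the matrix product at N - 1; the extra terms vanish by
    -- negative index or by the degree of G_j.
    rw [h5 (s + 1) (max (s + 1) N) _ (le_max_left _ _), h5 N (max (s + 1) N) _ (le_max_right _ _)]
    · intro b hb
      rw [hGdeg j b hb, mul_zero]
    · intro b hb
      rw [extend_neg _ (by omega), zero_mul]
  have hfac : ∀ m : ℕ → ℕ, (Matrix.of fun i j : Fin N => x j ^ (m i + (N - 1 - i))) =
      (Matrix.of fun i j : Fin N => extend (hFin x N) ((m i : ℤ) - (i : ℕ) + (j : ℕ))) *
        Matrix.of fun k j : Fin N => (G j).coeff (N - 1 - k) := by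
    intro m
    ext i j
    rw [Matrix.mul_apply, Matrix.of_apply, hpow]
    refine Finset.sum_congr rfl fun k _ => ?_
    simp only [Matrix.of_apply]
    congr 2
    have := i.2
    have := k.2
    omega
  have h0 := congrArg Matrix.det (hfac fun _ => 0)
  rw [Matrix.det_mul] at h0
  simp only [zero_add] at h0
  rw [hfac m, Matrix.det_mul, h0]
  have h1 := jacobiTrudi_zero (hFin_zero_right x N) N
  rw [jacobiTrudi] at h1 ⊢
  rw [h1, one_mul]

/-- The determinant of `q^{(λ_i-i)(j-μ_j)}`. -/
def crossDet (q : ℂ) (N : ℕ) (lam mu : YoungDiagram) : ℂ :=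
  Matrix.det (Matrix.of fun i j : Fin N =>
    q ^ (((j : ℕ) - mu.rowLen j : ℤ) * (lam.rowLen i - (i : ℕ))))

theorem crossDet_comm (q : ℂ) (N : ℕ) (lam mu : YoungDiagram) :
    crossDet q N lam mu = crossDet q N mu lam := by
  rw [crossDet, ← Matrix.det_transpose, crossDet]
  congr 1
  ext i j
  simp only [Matrix.transpose_apply, Matrix.of_apply]
  congr 1
  ring

theorem rowLen_bot (i : ℕ) : (⊥ : YoungDiagram).rowLen i = 0 := by
  by_contra h
  exact YoungDiagram.notMem_bot _ (YoungDiagram.mem_iff_lt_rowLen.2 (Nat.pos_of_ne_zero h))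

theorem colLen_bot (i : ℕ) : (⊥ : YoungDiagram).colLen i = 0 := by
  by_contra h
  exact YoungDiagram.notMem_bot _ (YoungDiagram.mem_iff_lt_colLen.2 (Nat.pos_of_ne_zero h))

/-- The bialternant formula at x_j = q^{j-μ_j}, after cancelling the column factors q^{(j-μ_j)(N-1)}
common to both determinants. -/
theorem tabSum_mul_crossDet {q : ℂ} (hq : q ≠ 0) {N : ℕ} (lam mu : YoungDiagram)
    (hN : lam.colLen 0 ≤ N) :
    tabSum (qSeq q mu) N N lam.rowLen * crossDet q N ⊥ mu = crossDet q N lam mu := by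
  have key : ∀ m : ℕ → ℕ,
      Matrix.det (Matrix.of fun i j : Fin N => qSeq q mu j ^ (m i + (N - 1 - i))) =
      (∏ j : Fin N, q ^ (((j : ℕ) - mu.rowLen j : ℤ) * (N - 1))) *
        Matrix.det (Matrix.of fun i j : Fin N =>
          q ^ (((j : ℕ) - mu.rowLen j : ℤ) * (m i - (i : ℕ)))) := by
    intro m
    rw [← Matrix.det_mul_row]
    congr 1
    ext i j
    simp only [Matrix.of_apply]
    rw [← zpow_add₀ hq, qSeq, ← zpow_natCast, ← zpow_mul]
    congr 1
    have h1 : ((m i + (N - 1 - i) : ℕ) : ℤ) = m i + (N - 1 - (i : ℕ)) := by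
      have := i.2
      omega
    rw [h1]; ring
  have hpos : (∏ j : Fin N, q ^ (((j : ℕ) - mu.rowLen j : ℤ) * (N - 1))) ≠ 0 :=
    Finset.prod_ne_zero_iff.2 fun j _ => zpow_ne_zero _ hq
  have h1 := det_pow_eq (qSeq q mu) N lam.rowLen
  have h2 := key fun _ => 0
  simp only [zero_add] at h2
  rw [key, h2, ← tabSum_eq_jacobiTrudi _ _ (antitone_rowLen lam) (rowLen_eq_zero hN),
    mul_left_comm] at h1
  have h3 := mul_left_cancel₀ hpos h1
  rw [crossDet, crossDet, h3]
  simp only [rowLen_bot]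

theorem zpow_ne_one {q : ℂ} (hq1 : ‖q‖ < 1) {k : ℤ} (hk : k ≠ 0) : q ^ k ≠ 1 := by
  intro h
  have h1 : ‖q‖ ^ k = 1 := by rw [← norm_zpow, h, norm_one]
  exact hk ((zpow_eq_one_iff_right₀ (norm_nonneg q) hq1.ne).1 h1)

theorem crossDet_bot_bot_ne_zero {q : ℂ} (hq0 : q ≠ 0) (hq1 : ‖q‖ < 1) (N : ℕ) :
    crossDet q N ⊥ ⊥ ≠ 0 := by
  have h1 : (Matrix.of fun i j : Fin N => q ^ (((j : ℕ) - (⊥ : YoungDiagram).rowLen j : ℤ) *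
      ((⊥ : YoungDiagram).rowLen i - (i : ℕ)))) =
      Matrix.vandermonde fun i : Fin N => q ^ (-((i : ℕ) : ℤ)) := by
    ext i j
    rw [Matrix.vandermonde_apply, Matrix.of_apply, ← zpow_natCast, ← zpow_mul, rowLen_bot,
      rowLen_bot]
    congr 1
    push_cast; ring
  rw [crossDet, h1, Matrix.det_vandermonde_ne_zero_iff]
  intro i j hij
  by_contra hne
  refine zpow_ne_one hq1 (k := -((i : ℕ) : ℤ) + (j : ℕ)) ?_ ?_
  · intro h
    exact hne (Fin.ext (by omega))
  · simp only at hij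
    rw [zpow_add₀ hq0, hij, ← zpow_add₀ hq0, neg_add_cancel, zpow_zero]

/-- Multiplied by the nonzero determinant of (∅, ∅), the left side telescopes to the determinant of
(λ, μ), which is symmetric. -/
theorem tabSum_symm {q : ℂ} (hq0 : q ≠ 0) (hq1 : ‖q‖ < 1) {N : ℕ} (lam mu : YoungDiagram)
    (hl : lam.colLen 0 ≤ N) (hm : mu.colLen 0 ≤ N) :
    tabSum (qSeq q mu) N N lam.rowLen * tabSum (qSeq q ⊥) N N mu.rowLen =
      tabSum (qSeq q lam) N N mu.rowLen * tabSum (qSeq q ⊥) N N lam.rowLen := by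
  have key : ∀ lam mu : YoungDiagram, lam.colLen 0 ≤ N → mu.colLen 0 ≤ N →
      tabSum (qSeq q mu) N N lam.rowLen * tabSum (qSeq q ⊥) N N mu.rowLen * crossDet q N ⊥ ⊥ =
        crossDet q N lam mu := by
    intro lam mu hl hm
    rw [mul_assoc, tabSum_mul_crossDet hq0 mu ⊥ hm, crossDet_comm, tabSum_mul_crossDet hq0 lam mu hl]
  refine mul_right_cancel₀ (crossDet_bot_bot_ne_zero hq0 hq1 N) ?_
  rw [key _ _ hl hm, key _ _ hm hl, crossDet_comm]

theorem summable_norm_qSeq {q : ℂ} (hq1 : ‖q‖ < 1) (mu : YoungDiagram) :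
    Summable fun i => ‖qSeq q mu i‖ := by
  rw [← summable_nat_add_iff (mu.colLen 0)]
  have h1 : ∀ i, ‖qSeq q mu (i + mu.colLen 0)‖ = ‖q‖ ^ (mu.colLen 0) * ‖q‖ ^ i := by
    intro i
    rw [qSeq, rowLen_eq_zero (by omega), Nat.cast_zero, sub_zero, zpow_natCast, norm_pow, pow_add,
      mul_comm]
  simp only [h1]
  exact (summable_geometric_of_lt_one (norm_nonneg q) hq1).mul_left _

theorem schur_symm {q : ℂ} (hq0 : q ≠ 0) (hq1 : ‖q‖ < 1) (lam mu : YoungDiagram) :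
    schur lam (qSeq q mu) * schur mu (qSeq q ⊥) = schur mu (qSeq q lam) * schur lam (qSeq q ⊥) := by
  have h : ∀ lam mu : YoungDiagram, Filter.Tendsto (fun N => tabSum (qSeq q mu) N N lam.rowLen)
      Filter.atTop (nhds (schur lam (qSeq q mu))) := fun lam mu =>
    tendsto_tabSum_schur lam (summable_norm_qSeq hq1 mu) (n := fun N => N)
      (Filter.eventually_ge_atTop _)
  refine tendsto_nhds_unique ((h lam mu).mul (h mu ⊥)) (((h mu lam).mul (h lam ⊥)).congr' ?_)
  filter_upwards [Filter.eventually_ge_atTop (lam.colLen 0),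
    Filter.eventually_ge_atTop (mu.colLen 0)] with N h1 h2
  exact (tabSum_symm hq0 hq1 lam mu h1 h2).symm

/-! ### Maya diagrams and hook lengths -/

/-- The set `{λ_i - i - 1} ∪ {j - λ'_j}` exhausts the integers. -/
theorem prod_maya (lam : YoungDiagram) {N : ℕ} (h1 : lam.colLen 0 ≤ N) (h2 : lam.rowLen 0 ≤ N)
    (f : ℤ → ℂ) :
    ∏ z ∈ Finset.Ico (-(N : ℤ)) N, f z =
      (∏ i ∈ Finset.range N, f (lam.rowLen i - i - 1)) *
        ∏ j ∈ Finset.range N, f (j - lam.colLen j) := by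
  have ha : Function.Injective fun i : ℕ => (lam.rowLen i - i - 1 : ℤ) :=
    StrictAnti.injective fun i j h => by
      have := lam.rowLen_anti _ _ h.le
      omega
  have hb : Function.Injective fun j : ℕ => (j - lam.colLen j : ℤ) :=
    StrictMono.injective fun i j h => by
      have := lam.colLen_anti _ _ h.le
      omega
  have hdisj : Disjoint ((Finset.range N).image fun i : ℕ => (lam.rowLen i - i - 1 : ℤ))
      ((Finset.range N).image fun j : ℕ => (j - lam.colLen j : ℤ)) := by
    rw [Finset.disjoint_left]
    intro z hz hz'
    obtain ⟨i, _, rfl⟩ := Finset.mem_image.1 hz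
    obtain ⟨j, _, hj⟩ := Finset.mem_image.1 hz'
    have := lt_rowLen_iff_lt_colLen lam i j
    omega
  have hU : ((Finset.range N).image fun i : ℕ => (lam.rowLen i - i - 1 : ℤ)) ∪
      ((Finset.range N).image fun j : ℕ => (j - lam.colLen j : ℤ)) = Finset.Ico (-(N : ℤ)) N := by
    -- Two disjoint sets of N integers inside an interval of 2N integers must fill it.
    refine Finset.eq_of_subset_of_card_le ?_ ?_
    · intro z hz
      rw [Finset.mem_Ico]
      rcases Finset.mem_union.1 hz with hz | hz
      · obtain ⟨i, hi, rfl⟩ := Finset.mem_image.1 hz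
        rw [Finset.mem_range] at hi
        have := lam.rowLen_anti _ _ (Nat.zero_le i)
        omega
      · obtain ⟨i, hi, rfl⟩ := Finset.mem_image.1 hz
        rw [Finset.mem_range] at hi
        have := lam.colLen_anti _ _ (Nat.zero_le i)
        omega
    · rw [Finset.card_union_of_disjoint hdisj, Finset.card_image_of_injective _ ha,
        Finset.card_image_of_injective _ hb, Int.card_Ico, Finset.card_range]
      omega
  rw [← hU, Finset.prod_union hdisj, Finset.prod_image ha.injOn, Finset.prod_image hb.injOn]

/-- The `q`-Pochhammer symbol `(q; q)_k`. -/
def qPoch (q : ℂ) (k : ℕ) : ℂ := ∏ m ∈ Finset.range k, (1 - q ^ (m + 1))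

theorem prod_upper (q : ℂ) {N : ℕ} {a : ℤ} (h : -(N : ℤ) ≤ a) (h2 : a < N) :
    ∏ z ∈ Finset.Ico (-(N : ℤ)) N, (if a < z then 1 - q ^ (z - a) else 1) =
      qPoch q (N - 1 - a).toNat := by
  rw [← Finset.prod_filter, qPoch]
  refine Finset.prod_nbij' (fun z => (z - a - 1).toNat) (fun m => a + 1 + m) ?_ ?_ ?_ ?_ ?_
  · intro z hz
    rw [Finset.mem_filter, Finset.mem_Ico] at hz
    rw [Finset.mem_range]; omega
  · intro m hm
    rw [Finset.mem_range] at hm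
    rw [Finset.mem_filter, Finset.mem_Ico]; omega
  · intro z hz
    rw [Finset.mem_filter, Finset.mem_Ico] at hz
    omega
  · intro m hm
    omega
  · intro z hz
    rw [Finset.mem_filter, Finset.mem_Ico] at hz
    rw [← zpow_natCast]
    congr 2
    push_cast
    omega

theorem prod_lower (q : ℂ) {N : ℕ} {a : ℤ} (h : -(N : ℤ) ≤ a) (h2 : a < N) :
    ∏ z ∈ Finset.Ico (-(N : ℤ)) N, (if z < a then 1 - q ^ (a - z) else 1) =
      qPoch q (N + a).toNat := by
  rw [← Finset.prod_filter, qPoch]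
  refine Finset.prod_nbij' (fun z => (a - z - 1).toNat) (fun m => a - 1 - m) ?_ ?_ ?_ ?_ ?_
  · intro z hz
    rw [Finset.mem_filter, Finset.mem_Ico] at hz
    rw [Finset.mem_range]; omega
  · intro m hm
    rw [Finset.mem_range] at hm
    rw [Finset.mem_filter, Finset.mem_Ico]; omega
  · intro z hz
    rw [Finset.mem_filter, Finset.mem_Ico] at hz
    omega
  · intro m hm
    omega
  · intro z hz
    rw [Finset.mem_filter, Finset.mem_Ico] at hz
    rw [← zpow_natCast]
    congr 2
    push_cast
    omega

/-- The hook length of a cell. -/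
def hookLen (lam : YoungDiagram) (c : ℕ × ℕ) : ℕ :=
  lam.rowLen c.1 + lam.colLen c.2 - c.1 - c.2 - 1

/-- The product of `1 - q^h` over the hook lengths `h`. -/
def hookProd (lam : YoungDiagram) (q : ℂ) : ℂ := ∏ c ∈ lam.cells, (1 - q ^ hookLen lam c)

/-- The Vandermonde-type product `∏_{i<k<N} (1 - q^{λ_i-λ_k+k-i})`. -/
def vdmProd (lam : YoungDiagram) (q : ℂ) (N : ℕ) : ℂ :=
  ∏ i ∈ Finset.range N, ∏ k ∈ Finset.range N,
    if i < k then 1 - q ^ ((lam.rowLen i - i : ℤ) - (lam.rowLen k - k)) else 1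

/-- The product of the inverse hook factors outside the diagram, in an `N × N` square. -/
def outProd (lam : YoungDiagram) (q : ℂ) (N : ℕ) : ℂ :=
  ∏ i ∈ Finset.range N, ∏ j ∈ Finset.range N,
    if lam.rowLen i ≤ j then (hookFactor lam q (i, j))⁻¹ else 1

/-- Fix a = λ_i - i - 1 and take 1 - q^{a-z} over all z < a in the window: a q-Pochhammer symbol. In
the Maya splitting, the z = λ_k - k - 1 give the Vandermonde factors with k > i, and the z = j -
λ'_j give the hook lengths of row i. -/
theorem hookProd_mul_vdmProd (lam : YoungDiagram) (q : ℂ) {N : ℕ} (h1 : lam.colLen 0 ≤ N)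
    (h2 : lam.rowLen 0 ≤ N) :
    hookProd lam q * vdmProd lam q N =
      ∏ i ∈ Finset.range N, qPoch q (N - 1 - i + lam.rowLen i) := by
  have hh : hookProd lam q = ∏ i ∈ Finset.range N, ∏ j ∈ Finset.range (lam.rowLen i),
      (1 - q ^ hookLen lam (i, j)) := by
    refine Finset.prod_finset_product _ _ _ fun c => ?_
    rw [YoungDiagram.mem_cells, Finset.mem_range, Finset.mem_range, ← YoungDiagram.mem_iff_lt_rowLen]
    refine ⟨fun h => ⟨?_, h⟩, fun h => h.2⟩
    have h1 := YoungDiagram.mem_iff_lt_colLen.1 (lam.up_left_mem le_rfl (Nat.zero_le c.2) h)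
    omega
  rw [hh, vdmProd, ← Finset.prod_mul_distrib]
  refine Finset.prod_congr rfl fun i hi => ?_
  rw [Finset.mem_range] at hi
  have h3 := lam.rowLen_anti _ _ (Nat.zero_le i)
  have h4 := prod_lower q (N := N) (a := lam.rowLen i - i - 1) (by omega) (by omega)
  rw [prod_maya lam h1 h2, mul_comm] at h4
  have e : ((N : ℤ) + (lam.rowLen i - i - 1)).toNat = N - 1 - i + lam.rowLen i := by omega
  rw [e] at h4
  rw [← h4]
  congr 1
  · rw [← Finset.prod_filter]
    have h5 : (Finset.range N).filter (fun j : ℕ => (j - lam.colLen j : ℤ) < lam.rowLen i - i - 1) =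
        Finset.range (lam.rowLen i) := by
      ext j
      rw [Finset.mem_filter, Finset.mem_range, Finset.mem_range]
      have := lt_rowLen_iff_lt_colLen lam i j
      omega
    rw [h5]
    refine Finset.prod_congr rfl fun j hj => ?_
    rw [Finset.mem_range] at hj
    have := (lt_rowLen_iff_lt_colLen lam i j).1 hj
    rw [← zpow_natCast, hookLen]
    congr 2
    simp only
    omega
  · refine Finset.prod_congr rfl fun k hk => ?_
    have h6 : i < k ↔ (lam.rowLen k - k - 1 : ℤ) < lam.rowLen i - i - 1 := by
      rcases lt_trichotomy i k with h | h | h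
      · have := lam.rowLen_anti _ _ h.le; omega
      · subst h; omega
      · have := lam.rowLen_anti _ _ h.le; omega
    simp only [h6]
    congr 3
    ring

/-- The same count with z > a: now k < i, and j runs over the columns outside row i. -/
theorem outProd_mul_vdmProd (lam : YoungDiagram) (q : ℂ) {N : ℕ} (h1 : lam.colLen 0 ≤ N)
    (h2 : lam.rowLen 0 ≤ N) :
    outProd lam q N * vdmProd lam q N =
      ∏ i ∈ Finset.range N, qPoch q (N + i - lam.rowLen i) := by
  rw [outProd, vdmProd, Finset.prod_comm (s := Finset.range N) (t := Finset.range N)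
    (f := fun i k => if i < k then 1 - q ^ ((lam.rowLen i - i : ℤ) - (lam.rowLen k - k)) else 1),
    ← Finset.prod_mul_distrib]
  refine Finset.prod_congr rfl fun i hi => ?_
  rw [Finset.mem_range] at hi
  have h3 := lam.rowLen_anti _ _ (Nat.zero_le i)
  have h4 := prod_upper q (N := N) (a := lam.rowLen i - i - 1) (by omega) (by omega)
  rw [prod_maya lam h1 h2, mul_comm] at h4
  have e : ((N : ℤ) - 1 - (lam.rowLen i - i - 1)).toNat = N + i - lam.rowLen i := by omega
  rw [e] at h4
  rw [← h4]
  congr 1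
  · refine Finset.prod_congr rfl fun j _ => ?_
    have h5 : lam.rowLen i ≤ j ↔ (lam.rowLen i - i - 1 : ℤ) < j - lam.colLen j := by
      have := lt_rowLen_iff_lt_colLen lam i j
      omega
    simp only [h5, hookFactor, inv_inv]
    congr 3
    ring
  · refine Finset.prod_congr rfl fun k hk => ?_
    have h6 : k < i ↔ (lam.rowLen i - i - 1 : ℤ) < lam.rowLen k - k - 1 := by
      rcases lt_trichotomy i k with h | h | h
      · have := lam.rowLen_anti _ _ h.le; omega
      · subst h; omega
      · have := lam.rowLen_anti _ _ h.le; omega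
    simp only [h6]
    congr 3
    ring

open Filter Topology

/-! ### Evaluation of Schur functions at the principal specialization -/

theorem one_sub_pow_ne_zero {q : ℂ} (hq1 : ‖q‖ < 1) {k : ℕ} (hk : 0 < k) : 1 - q ^ k ≠ 0 := by
  intro h
  refine zpow_ne_one hq1 (k := (k : ℤ)) (by omega) ?_
  rw [zpow_natCast]
  exact (sub_eq_zero.1 h).symm

theorem qPoch_ne_zero {q : ℂ} (hq1 : ‖q‖ < 1) (k : ℕ) : qPoch q k ≠ 0 :=
  Finset.prod_ne_zero_iff.2 fun _ _ => one_sub_pow_ne_zero hq1 (Nat.succ_pos _)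

theorem vdmProd_ne_zero {q : ℂ} (hq1 : ‖q‖ < 1) (lam : YoungDiagram) (N : ℕ) :
    vdmProd lam q N ≠ 0 := by
  refine Finset.prod_ne_zero_iff.2 fun i _ => Finset.prod_ne_zero_iff.2 fun k _ => ?_
  split_ifs with h
  · have := lam.rowLen_anti _ _ h.le
    exact sub_ne_zero.2 (zpow_ne_one hq1 (by omega)).symm
  · exact one_ne_zero

theorem hookLen_pos {lam : YoungDiagram} {c : ℕ × ℕ} (hc : c ∈ lam.cells) : 0 < hookLen lam c := by
  rw [YoungDiagram.mem_cells] at hc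
  have h1 := YoungDiagram.mem_iff_lt_rowLen.1 (show (c.1, c.2) ∈ lam from hc)
  have h2 := YoungDiagram.mem_iff_lt_colLen.1 (show (c.1, c.2) ∈ lam from hc)
  rw [hookLen]; omega

theorem hookProd_ne_zero {q : ℂ} (hq1 : ‖q‖ < 1) (lam : YoungDiagram) : hookProd lam q ≠ 0 :=
  Finset.prod_ne_zero_iff.2 fun _ hc => one_sub_pow_ne_zero hq1 (hookLen_pos hc)

theorem tendsto_qPoch_ratio {q : ℂ} (hq1 : ‖q‖ < 1) {f : ℕ → ℕ} (hf : Tendsto f atTop atTop)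
    (s : ℕ) : Tendsto (fun N => qPoch q (f N + s) / qPoch q (f N)) atTop (𝓝 1) := by
  have h1 : ∀ N, qPoch q (f N + s) / qPoch q (f N) =
      ∏ m ∈ Finset.range s, (1 - q ^ (f N) * q ^ (m + 1)) := by
    intro N
    rw [div_eq_iff (qPoch_ne_zero hq1 _), qPoch, Finset.prod_range_add, mul_comm, qPoch]
    congr 1
    exact Finset.prod_congr rfl fun m _ => by rw [add_assoc, pow_add]
  simp only [h1]
  have h2 : Tendsto (fun N => q ^ f N) atTop (𝓝 0) :=
    (tendsto_pow_atTop_nhds_zero_of_norm_lt_one hq1).comp hf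
  have h3 : Tendsto (fun N => ∏ m ∈ Finset.range s, (1 - q ^ (f N) * q ^ (m + 1))) atTop
      (𝓝 (∏ m ∈ Finset.range s, (1 - 0 * q ^ (m + 1)))) :=
    tendsto_finsetProd _ fun m _ => tendsto_const_nhds.sub (h2.mul_const _)
  simpa using h3

/-- `∑ (i - 1) λ_i`. -/
def rowWeight (lam : YoungDiagram) : ℕ := ∑ c ∈ lam.cells, c.1

theorem rowWeight_eq (lam : YoungDiagram) {n : ℕ} (hn : lam.colLen 0 ≤ n) :
    rowWeight lam = ∑ i ∈ Finset.range n, i * lam.rowLen i := by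
  rw [rowWeight, sum_cells lam hn]
  simp [mul_comm]

/-- A Vandermonde determinant in the q^{λ_i-i}. Pulling q^{λ_k-k} out of each difference with i < k
leaves `vdmProd`; the middle factor does not depend on λ and cancels in ratios. -/
theorem crossDet_bot_right {q : ℂ} (hq : q ≠ 0) (lam : YoungDiagram) {N : ℕ}
    (hN : lam.colLen 0 ≤ N) :
    crossDet q N lam ⊥ = q ^ rowWeight lam *
      (∏ i ∈ Finset.range N, ∏ k ∈ Finset.range N, if i < k then q ^ (-(k : ℤ)) else 1) *
        vdmProd lam q N := by
  have h1 : (Matrix.of fun i j : Fin N => q ^ (((j : ℕ) - (⊥ : YoungDiagram).rowLen j : ℤ) *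
      (lam.rowLen i - (i : ℕ)))) =
      Matrix.vandermonde fun i : Fin N => q ^ (lam.rowLen i - (i : ℕ) : ℤ) := by
    ext i j
    rw [Matrix.vandermonde_apply, Matrix.of_apply, ← zpow_natCast, ← zpow_mul, rowLen_bot]
    congr 1
    push_cast; ring
  have h2 : q ^ rowWeight lam = ∏ i ∈ Finset.range N, ∏ k ∈ Finset.range N,
      if i < k then q ^ lam.rowLen k else 1 := by
    rw [Finset.prod_comm, rowWeight_eq lam hN, ← Finset.prod_pow_eq_pow_sum]
    refine Finset.prod_congr rfl fun k hk => ?_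
    rw [← Finset.prod_filter, Finset.prod_const, mul_comm, pow_mul]
    congr 1
    have : (Finset.range N).filter (fun i => i < k) = Finset.range k := by
      ext i
      rw [Finset.mem_range] at hk
      rw [Finset.mem_filter, Finset.mem_range, Finset.mem_range]; omega
    rw [this, Finset.card_range]
  rw [crossDet, h1, Matrix.det_vandermonde, h2, vdmProd, ← Finset.prod_mul_distrib,
    ← Finset.prod_mul_distrib, Finset.prod_range]
  refine Finset.prod_congr rfl fun i _ => ?_
  rw [← Finset.prod_mul_distrib, ← Finset.prod_mul_distrib, Finset.prod_range,
    ← Finset.prod_filter_mul_prod_filter_not Finset.univ (fun k : Fin N => (i : ℕ) < k)]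
  rw [Finset.prod_eq_one (s := Finset.univ.filter fun k : Fin N => ¬ (i : ℕ) < k), mul_one]
  · refine Finset.prod_congr ?_ fun k hk => ?_
    · ext k; simp
    · replace hk := (Finset.mem_filter.1 hk).2
      rw [if_pos hk, if_pos hk, if_pos hk, ← zpow_natCast, ← zpow_add₀ hq, mul_sub, mul_one,
        ← zpow_add₀ hq]
      congr 2
      ring
  · intro k hk
    have := (Finset.mem_filter.1 hk).2
    rw [if_neg this, if_neg this, if_neg this]; simp

/-- In N variables the value is q^{n(λ)}/H_λ times a ratio of q-Pochhammer symbols for each nonempty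
row; these finitely many ratios tend to 1. -/
theorem schur_principal {q : ℂ} (hq0 : q ≠ 0) (hq1 : ‖q‖ < 1) (lam : YoungDiagram) :
    schur lam (qSeq q ⊥) = q ^ rowWeight lam / hookProd lam q := by
  have h1 := tendsto_tabSum_schur lam (summable_norm_qSeq hq1 ⊥) (n := fun N => N)
    (eventually_ge_atTop _)
  have h2 : Tendsto (fun N => q ^ rowWeight lam / hookProd lam q *
      ∏ i ∈ Finset.range (lam.colLen 0), (qPoch q (N - 1 - i + lam.rowLen i) / qPoch q (N - 1 - i)))
      atTop (𝓝 (q ^ rowWeight lam / hookProd lam q * ∏ i ∈ Finset.range (lam.colLen 0), 1)) :=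
    tendsto_const_nhds.mul (tendsto_finsetProd _ fun i _ => tendsto_qPoch_ratio hq1
      (tendsto_atTop_mono (fun N => by omega) (tendsto_sub_atTop_nat (1 + i))) _)
  rw [Finset.prod_const_one, mul_one] at h2
  refine tendsto_nhds_unique h1 (h2.congr' ?_)
  filter_upwards [eventually_ge_atTop (lam.colLen 0), eventually_ge_atTop (lam.rowLen 0)]
    with N hN hN'
  have hV := hookProd_mul_vdmProd lam q hN hN'
  have hV0 := hookProd_mul_vdmProd ⊥ q (N := N) (by rw [colLen_bot]; omega)
    (by rw [rowLen_bot]; omega)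
  have hh0 : hookProd ⊥ q = 1 := by simp [hookProd]
  have hr0 : rowWeight ⊥ = 0 := by simp [rowWeight]
  have hD := tabSum_mul_crossDet hq0 lam ⊥ hN
  rw [crossDet_bot_right hq0 lam hN, crossDet_bot_right hq0 ⊥ (by rw [colLen_bot]; omega), hr0,
    pow_zero, one_mul] at hD
  rw [hh0, one_mul] at hV0
  simp only [rowLen_bot, add_zero] at hV0
  have hC : (∏ i ∈ Finset.range N, ∏ k ∈ Finset.range N,
      if i < k then q ^ (-(k : ℤ)) else 1) ≠ 0 := by
    refine Finset.prod_ne_zero_iff.2 fun i _ => Finset.prod_ne_zero_iff.2 fun k _ => ?_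
    split_ifs
    · exact zpow_ne_zero _ hq0
    · exact one_ne_zero
  have hD' : tabSum (qSeq q ⊥) N N lam.rowLen * vdmProd ⊥ q N =
      q ^ rowWeight lam * vdmProd lam q N := by
    refine mul_left_cancel₀ hC ?_
    linear_combination hD
  have hprod : ∏ i ∈ Finset.range (lam.colLen 0),
      (qPoch q (N - 1 - i + lam.rowLen i) / qPoch q (N - 1 - i)) =
      hookProd lam q * vdmProd lam q N / vdmProd ⊥ q N := by
    rw [hV, hV0, ← Finset.prod_div_distrib]
    refine Finset.prod_subset (Finset.range_subset_range.2 hN) fun i _ hi => ?_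
    rw [rowLen_eq_zero (by simpa using hi), add_zero, div_self (qPoch_ne_zero hq1 _)]
  rw [hprod, eq_comm, div_mul_div_comm, mul_left_comm, mul_div_mul_left _ _ (hookProd_ne_zero hq1 lam),
    eq_div_iff (vdmProd_ne_zero hq1 _ _), hD']

/-! ### The infinite product -/

theorem hookFactor_exponent_ne_zero (lam : YoungDiagram) (p : ℕ × ℕ) :
    (-(lam.rowLen p.1 : ℤ) - (lam.colLen p.2 : ℤ) + (p.1 : ℤ) + (p.2 : ℤ) + 1) ≠ 0 := by
  have := lt_rowLen_iff_lt_colLen lam p.1 p.2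
  omega

theorem hookFactor_ne_zero {q : ℂ} (hq1 : ‖q‖ < 1) (lam : YoungDiagram) (p : ℕ × ℕ) :
    hookFactor lam q p ≠ 0 :=
  inv_ne_zero (sub_ne_zero.2 (zpow_ne_one hq1 (hookFactor_exponent_ne_zero lam p)).symm)

/-- The inverse factor is 1 minus q times a product of two absolutely summable sequences, one in i
and one in j. No factor is zero, so the product is nonzero and may be inverted. -/
theorem multipliable_hookFactor {q : ℂ} (hq0 : q ≠ 0) (hq1 : ‖q‖ < 1) (lam : YoungDiagram) :
    Multipliable (hookFactor lam q) := by
  have h1 : Summable fun p : ℕ × ℕ => ‖-(q * (qSeq q lam p.1 * qSeq q lam.transpose p.2))‖ := by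
    have h2 := ((summable_norm_qSeq hq1 lam).mul_norm
      (summable_norm_qSeq hq1 lam.transpose)).mul_left ‖q‖
    simpa [norm_mul] using h2
  have h3 : ∀ p : ℕ × ℕ, 1 + -(q * (qSeq q lam p.1 * qSeq q lam.transpose p.2)) =
      (hookFactor lam q p)⁻¹ := by
    intro p
    rw [hookFactor, inv_inv, qSeq, qSeq, YoungDiagram.rowLen_transpose, ← zpow_add₀ hq0,
      ← zpow_one_add₀ hq0, ← sub_eq_add_neg]
    congr 2
    ring
  have h4 := multipliable_one_add_of_summable h1
  have h5 := tprod_one_add_ne_zero_of_summable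
    (fun p => by rw [h3]; exact inv_ne_zero (hookFactor_ne_zero hq1 lam p)) h1
  simp only [h3] at h4 h5
  simpa using h4.inv₀ h5

theorem outProd_ne_zero {q : ℂ} (hq1 : ‖q‖ < 1) (lam : YoungDiagram) (N : ℕ) :
    outProd lam q N ≠ 0 := by
  refine Finset.prod_ne_zero_iff.2 fun i _ => Finset.prod_ne_zero_iff.2 fun k _ => ?_
  split_ifs
  · exact inv_ne_zero (hookFactor_ne_zero hq1 lam _)
  · exact one_ne_zero

/-- Both finite hook identities, for λ and for ∅, are divided by one another: the Vandermonde
products cancel and the q-Pochhammer ratios tend to 1. -/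
theorem tendsto_outProd_ratio {q : ℂ} (hq1 : ‖q‖ < 1) (lam : YoungDiagram) :
    Tendsto (fun N => outProd ⊥ q N / outProd lam q N) atTop (𝓝 (hookProd lam q)⁻¹) := by
  have h1 : Tendsto (fun N => (hookProd lam q)⁻¹ *
      (∏ i ∈ Finset.range (lam.colLen 0),
        (qPoch q (N - 1 - i + lam.rowLen i) / qPoch q (N - 1 - i))) *
      ∏ i ∈ Finset.range (lam.colLen 0),
        (qPoch q (N + i - lam.rowLen i + lam.rowLen i) / qPoch q (N + i - lam.rowLen i)))
      atTop (𝓝 ((hookProd lam q)⁻¹ * (∏ i ∈ Finset.range (lam.colLen 0), 1) *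
        ∏ i ∈ Finset.range (lam.colLen 0), 1)) :=
    (tendsto_const_nhds.mul (tendsto_finsetProd _ fun i _ => tendsto_qPoch_ratio hq1
      (tendsto_atTop_mono (fun N => by omega) (tendsto_sub_atTop_nat (1 + i))) _)).mul
      (tendsto_finsetProd _ fun i _ => tendsto_qPoch_ratio hq1
        (tendsto_atTop_mono (fun N => by omega) (tendsto_sub_atTop_nat (lam.rowLen i))) _)
  rw [Finset.prod_const_one, mul_one, mul_one] at h1
  refine h1.congr' ?_
  filter_upwards [eventually_ge_atTop (lam.colLen 0), eventually_ge_atTop (lam.rowLen 0)]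
    with N hN hN'
  have hb : (⊥ : YoungDiagram).colLen 0 ≤ N := by rw [colLen_bot]; omega
  have hb' : (⊥ : YoungDiagram).rowLen 0 ≤ N := by rw [rowLen_bot]; omega
  have hV := hookProd_mul_vdmProd lam q hN hN'
  have hV0 := hookProd_mul_vdmProd ⊥ q hb hb'
  have hO := outProd_mul_vdmProd lam q hN hN'
  have hO0 := outProd_mul_vdmProd ⊥ q hb hb'
  have hh0 : hookProd ⊥ q = 1 := by simp [hookProd]
  rw [hh0, one_mul] at hV0
  simp only [rowLen_bot, add_zero, Nat.sub_zero] at hV0 hO0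
  have e1 : ∏ i ∈ Finset.range (lam.colLen 0),
      (qPoch q (N - 1 - i + lam.rowLen i) / qPoch q (N - 1 - i)) =
      hookProd lam q * vdmProd lam q N / vdmProd ⊥ q N := by
    rw [hV, hV0, ← Finset.prod_div_distrib]
    refine Finset.prod_subset (Finset.range_subset_range.2 hN) fun i _ hi => ?_
    rw [rowLen_eq_zero (by simpa using hi), add_zero, div_self (qPoch_ne_zero hq1 _)]
  have e2 : ∏ i ∈ Finset.range (lam.colLen 0),
      (qPoch q (N + i - lam.rowLen i + lam.rowLen i) / qPoch q (N + i - lam.rowLen i)) =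
      outProd ⊥ q N * vdmProd ⊥ q N / (outProd lam q N * vdmProd lam q N) := by
    rw [hO, hO0, ← Finset.prod_div_distrib]
    rw [← Finset.prod_subset (Finset.range_subset_range.2 hN) (f := fun i =>
      qPoch q (N + i) / qPoch q (N + i - lam.rowLen i))]
    · refine Finset.prod_congr rfl fun i _ => ?_
      have := lam.rowLen_anti _ _ (Nat.zero_le i)
      rw [Nat.sub_add_cancel (by omega)]
    · intro i _ hi
      rw [rowLen_eq_zero (by simpa using hi), Nat.sub_zero, div_self (qPoch_ne_zero hq1 _)]
  rw [e1, e2]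
  have n1 := vdmProd_ne_zero hq1 lam N
  have n2 := vdmProd_ne_zero hq1 ⊥ N
  have n3 := outProd_ne_zero hq1 lam N
  have n4 := hookProd_ne_zero hq1 lam
  field_simp

theorem prod_square (lam : YoungDiagram) (q : ℂ) {N : ℕ} (hN : lam.colLen 0 ≤ N)
    (hN' : lam.rowLen 0 ≤ N) :
    ∏ p ∈ Finset.range N ×ˢ Finset.range N, hookFactor lam q p =
      (∏ c ∈ lam.cells, hookFactor lam q c) * (outProd lam q N)⁻¹ := by
  have hh : ∏ c ∈ lam.cells, hookFactor lam q c = ∏ i ∈ Finset.range N,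
      ∏ j ∈ Finset.range (lam.rowLen i), hookFactor lam q (i, j) := by
    refine Finset.prod_finset_product _ _ _ fun c => ?_
    rw [YoungDiagram.mem_cells, Finset.mem_range, Finset.mem_range, ← YoungDiagram.mem_iff_lt_rowLen]
    refine ⟨fun h => ⟨?_, h⟩, fun h => h.2⟩
    have h1 := YoungDiagram.mem_iff_lt_colLen.1 (lam.up_left_mem le_rfl (Nat.zero_le c.2) h)
    omega
  rw [Finset.prod_product, hh, outProd, ← Finset.prod_inv_distrib, ← Finset.prod_mul_distrib]
  refine Finset.prod_congr rfl fun i _ => ?_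
  have h1 := lam.rowLen_anti _ _ (Nat.zero_le i)
  rw [← Finset.prod_filter, ← Finset.prod_inv_distrib,
    ← Finset.prod_filter_mul_prod_filter_not (Finset.range N) (fun j => j < lam.rowLen i)]
  congr 1
  · refine Finset.prod_congr ?_ fun _ _ => rfl
    ext j
    rw [Finset.mem_filter, Finset.mem_range, Finset.mem_range]; omega
  · simp only [not_lt, inv_inv]

/-- The infinite product for the empty partition. -/
def macMahon (q : ℂ) : ℂ := ∏' p : ℕ × ℕ, hookFactor ⊥ q p

theorem tendsto_square : Tendsto (fun N : ℕ => Finset.range N ×ˢ Finset.range N) atTop atTop := by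
  refine tendsto_atTop_finset_of_monotone ?_ ?_
  · intro N M h
    exact Finset.product_subset_product (Finset.range_subset_range.2 h) (Finset.range_subset_range.2 h)
  · intro p
    refine ⟨p.1 + p.2 + 1, ?_⟩
    rw [Finset.mem_product, Finset.mem_range, Finset.mem_range]; omega

theorem tprod_hookFactor_aux {q : ℂ} (hq0 : q ≠ 0) (hq1 : ‖q‖ < 1) (lam : YoungDiagram) :
    ∏' p : ℕ × ℕ, hookFactor lam q p =
      macMahon q * (hookProd lam q)⁻¹ * ∏ c ∈ lam.cells, hookFactor lam q c := by
  have h := fun lam => (multipliable_hookFactor hq0 hq1 lam).hasProd.comp tendsto_square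
  refine tendsto_nhds_unique (h lam)
    ((((h ⊥).mul (tendsto_outProd_ratio hq1 lam)).mul_const _).congr' ?_)
  filter_upwards [eventually_ge_atTop (lam.colLen 0), eventually_ge_atTop (lam.rowLen 0)]
    with N hN hN'
  simp only [Function.comp_apply]
  rw [prod_square lam q hN hN', prod_square ⊥ q (by rw [colLen_bot]; omega)
    (by rw [rowLen_bot]; omega), YoungDiagram.cells_bot, Finset.prod_empty, one_mul]
  have n1 := outProd_ne_zero hq1 lam N
  have n2 := outProd_ne_zero hq1 ⊥ N
  field_simp

/-- Inside the diagram the exponent is minus the hook length, and 1/(1 - q^{-h}) = -q^h/(1 - q^h).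
-/
theorem prod_cells_hookFactor {q : ℂ} (hq0 : q ≠ 0) (hq1 : ‖q‖ < 1) (lam : YoungDiagram) :
    ∏ c ∈ lam.cells, hookFactor lam q c =
      (-1) ^ lam.card * q ^ (∑ c ∈ lam.cells, hookLen lam c) * (hookProd lam q)⁻¹ := by
  rw [← Finset.prod_pow_eq_pow_sum, hookProd, ← Finset.prod_inv_distrib, YoungDiagram.card,
    ← Finset.prod_const, ← Finset.prod_mul_distrib, ← Finset.prod_mul_distrib]
  refine Finset.prod_congr rfl fun c hc => ?_
  have h0 := hookLen_pos hc
  have h1 : (-(lam.rowLen c.1 : ℤ) - (lam.colLen c.2 : ℤ) + (c.1 : ℤ) + (c.2 : ℤ) + 1) =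
      -(hookLen lam c : ℤ) := by
    rw [hookLen] at h0 ⊢; omega
  have n1 := one_sub_pow_ne_zero hq1 h0
  have n2 : q ^ hookLen lam c ≠ 0 := pow_ne_zero _ hq0
  rw [hookFactor, h1, zpow_neg, zpow_natCast]
  have h2 : 1 - (q ^ hookLen lam c)⁻¹ = -((q ^ hookLen lam c)⁻¹ * (1 - q ^ hookLen lam c)) := by
    field_simp
    ring
  rw [h2, inv_neg, mul_inv, inv_inv]
  ring

/-! ### The statistics n(λ), κ_λ and the sum of hook lengths; closed form of the normalizations -/

theorem sum_cells_transpose {M : Type*} [AddCommMonoid M] (lam : YoungDiagram) (f : ℕ × ℕ → M) :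
    ∑ c ∈ lam.transpose.cells, f c = ∑ c ∈ lam.cells, f c.swap := by
  refine Finset.sum_nbij' Prod.swap Prod.swap ?_ ?_ ?_ ?_ ?_ <;>
    simp [YoungDiagram.mem_transpose]

theorem rowWeight_transpose (lam : YoungDiagram) :
    rowWeight lam.transpose = ∑ c ∈ lam.cells, c.2 := by
  rw [rowWeight, sum_cells_transpose]
  rfl

theorem hookProd_transpose (lam : YoungDiagram) (q : ℂ) :
    hookProd lam.transpose q = hookProd lam q := by
  rw [hookProd, hookProd]
  refine Finset.prod_nbij' Prod.swap Prod.swap ?_ ?_ ?_ ?_ ?_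
  · intro c hc; simpa [YoungDiagram.mem_transpose] using hc
  · intro c hc; simpa [YoungDiagram.mem_transpose] using hc
  · intro c _; simp
  · intro c _; simp
  · intro c _
    simp only [hookLen, YoungDiagram.rowLen_transpose, YoungDiagram.colLen_transpose,
      Prod.fst_swap, Prod.snd_swap]
    congr 2
    omega

theorem kappa_eq (lam : YoungDiagram) :
    kappa lam = 2 * ((rowWeight lam.transpose : ℤ) - rowWeight lam) := by
  rw [rowWeight_transpose, rowWeight_eq lam le_rfl, sum_cells lam le_rfl, kappa, Nat.cast_sum,
    Nat.cast_sum, ← Finset.sum_sub_distrib, Finset.mul_sum]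
  refine Finset.sum_congr rfl fun i _ => ?_
  have h := Finset.sum_range_id_mul_two (lam.rowLen i)
  simp only
  have h2 : ((∑ j ∈ Finset.range (lam.rowLen i), j : ℕ) : ℤ) * 2 =
      lam.rowLen i * ((lam.rowLen i : ℤ) - 1) := by
    have h3 := congrArg (Nat.cast (R := ℤ)) h
    rcases Nat.eq_zero_or_pos (lam.rowLen i) with h0 | h0
    · simp [h0]
    · push_cast [Nat.cast_sub h0] at h3 ⊢
      exact h3
  push_cast at h2 ⊢
  linear_combination -h2

theorem kappa_div_two (lam : YoungDiagram) :
    kappa lam / 2 = (rowWeight lam.transpose : ℤ) - rowWeight lam := by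
  rw [kappa_eq]; omega

/-- A hook is arm plus leg plus one; reversing each row shows that the arms sum to n(λ'), and by
transposition the legs sum to n(λ). -/
theorem sum_hookLen (lam : YoungDiagram) :
    ∑ c ∈ lam.cells, hookLen lam c = rowWeight lam + rowWeight lam.transpose + lam.card := by
  have key : ∀ lam : YoungDiagram, ∑ c ∈ lam.cells, (lam.rowLen c.1 - 1 - c.2) =
      rowWeight lam.transpose := by
    intro lam
    rw [rowWeight_transpose, sum_cells lam le_rfl, sum_cells lam le_rfl]
    exact Finset.sum_congr rfl fun i _ => Finset.sum_range_reflect (fun j => j) _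
  have key2 := key lam.transpose
  rw [sum_cells_transpose, YoungDiagram.transpose_transpose] at key2
  rw [← key2, ← key lam, YoungDiagram.card, Finset.card_eq_sum_ones, ← Finset.sum_add_distrib,
    ← Finset.sum_add_distrib]
  refine Finset.sum_congr rfl fun c hc => ?_
  rw [YoungDiagram.mem_cells] at hc
  have h1 := YoungDiagram.mem_iff_lt_rowLen.1 (show (c.1, c.2) ∈ lam from hc)
  have h2 := YoungDiagram.mem_iff_lt_colLen.1 (show (c.1, c.2) ∈ lam from hc)
  rw [hookLen, YoungDiagram.rowLen_transpose, Prod.fst_swap, Prod.snd_swap]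
  omega

theorem tprod_hookFactor {q : ℂ} (hq0 : q ≠ 0) (hq1 : ‖q‖ < 1) (lam : YoungDiagram) :
    ∏' p : ℕ × ℕ, hookFactor lam q p = macMahon q * ((-1) ^ lam.card *
      q ^ (rowWeight lam + rowWeight lam.transpose + lam.card)) * ((hookProd lam q)⁻¹) ^ 2 := by
  rw [tprod_hookFactor_aux hq0 hq1, prod_cells_hookFactor hq0 hq1, sum_hookLen]
  ring

/-- The signs cancel and the exponents of q add up to 2n(λ'), so apart from the MacMahon function
the quantity is a perfect square, whose root is explicit. -/
theorem normSq_eq {q : ℂ} (hq0 : q ≠ 0) (hq1 : ‖q‖ < 1) (lam : YoungDiagram) :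
    normSq lam q = macMahon q * (q ^ rowWeight lam.transpose / hookProd lam q) ^ 2 := by
  rw [normSq, tprod_hookFactor hq0 hq1, kappa_div_two, div_pow, div_eq_mul_inv, ← inv_pow]
  have h1 : q ^ ((rowWeight lam.transpose : ℤ) - rowWeight lam - lam.card) *
      q ^ (rowWeight lam + rowWeight lam.transpose + lam.card) =
      (q ^ rowWeight lam.transpose) ^ 2 := by
    rw [← zpow_natCast, ← zpow_add₀ hq0, ← pow_mul, ← zpow_natCast]
    congr 1
    push_cast; ring
  have h2 : ((-1 : ℂ) ^ lam.card) * (-1) ^ lam.card = 1 := by rw [← mul_pow]; simp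
  rw [← h1]
  linear_combination (q ^ ((rowWeight lam.transpose : ℤ) - rowWeight lam - lam.card) *
      q ^ (rowWeight lam + rowWeight lam.transpose + lam.card) * macMahon q *
        (hookProd lam q)⁻¹ ^ 2) * h2

theorem normSq'_eq {q : ℂ} (hq0 : q ≠ 0) (hq1 : ‖q‖ < 1) (lam : YoungDiagram) :
    normSq' lam q = macMahon q * (q ^ (lam.card + rowWeight lam) / hookProd lam q) ^ 2 := by
  rw [normSq', tprod_hookFactor hq0 hq1, kappa_div_two, div_pow, div_eq_mul_inv, ← inv_pow]
  have h1 : q ^ (-((rowWeight lam.transpose : ℤ) - rowWeight lam) + lam.card) *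
      q ^ (rowWeight lam + rowWeight lam.transpose + lam.card) =
      (q ^ (lam.card + rowWeight lam)) ^ 2 := by
    rw [← zpow_natCast, ← zpow_add₀ hq0, ← pow_mul, ← zpow_natCast]
    congr 1
    push_cast; ring
  have h2 : ((-1 : ℂ) ^ lam.card) * (-1) ^ lam.card = 1 := by rw [← mul_pow]; simp
  rw [← h1]
  linear_combination (q ^ (-((rowWeight lam.transpose : ℤ) - rowWeight lam) + lam.card) *
      q ^ (rowWeight lam + rowWeight lam.transpose + lam.card) * macMahon q *
        (hookProd lam q)⁻¹ ^ 2) * h2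

/-! ### The square root of the MacMahon function -/

/-- The logarithm of the factor `(1 - q^{n+1})^{-(n+1)/2}`. -/
def logFactor (n : ℕ) (q : ℂ) : ℂ := Complex.log (1 - q ^ (n + 1)) * (-((n : ℂ) + 1) / 2)

/-- The square root of the MacMahon function. -/
def sqrtMacMahon (q : ℂ) : ℂ := Complex.exp (∑' n, logFactor n q)

/-- A summable bound for `logFactor` on the disc of radius `r`. -/
def logBound (r : ℝ) (n : ℕ) : ℝ := ((1 - r)⁻¹ / 2 + 1) / 2 * (((n : ℝ) + 1) * r ^ (n + 1))

theorem norm_pow_succ_le {q : ℂ} {r : ℝ} (hr : r < 1) (hq : ‖q‖ ≤ r) (n : ℕ) :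
    ‖-(q ^ (n + 1))‖ ≤ r := by
  rw [norm_neg, norm_pow]
  exact (pow_le_of_le_one (norm_nonneg q) (hq.trans hr.le) (Nat.succ_ne_zero n)).trans hq

theorem norm_logFactor_le {q : ℂ} {r : ℝ} (hr : r < 1) (hq : ‖q‖ ≤ r) (n : ℕ) :
    ‖logFactor n q‖ ≤ logBound r n := by
  have h1 := norm_pow_succ_le hr hq n
  have h2 := Complex.norm_log_one_add_le (h1.trans_lt hr)
  have h3 : ‖-(q ^ (n + 1))‖ ≤ r ^ (n + 1) := by
    rw [norm_neg, norm_pow]; gcongr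
  set z := ‖-(q ^ (n + 1))‖ with hz
  have hz0 : 0 ≤ z := norm_nonneg _
  -- The constant in `logBound`: z² ≤ z and 1/(1-z) ≤ 1/(1-r), both from 0 ≤ z ≤ r < 1.
  have h4 : z ^ 2 * (1 - z)⁻¹ / 2 + z ≤ ((1 - r)⁻¹ / 2 + 1) * z := by
    have h5 : (1 - z)⁻¹ ≤ (1 - r)⁻¹ := inv_anti₀ (by linarith) (by linarith)
    have h6 : z ^ 2 ≤ z := by nlinarith
    have h7 : 0 ≤ (1 - z)⁻¹ := inv_nonneg.2 (by linarith)
    have h8 := mul_le_mul h6 h5 h7 hz0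
    linarith
  have hr1 : 0 ≤ (1 - r)⁻¹ := inv_nonneg.2 (by linarith)
  have hn : ‖-((n : ℂ) + 1) / 2‖ = ((n : ℝ) + 1) / 2 := by
    rw [norm_div, norm_neg]
    congr 1
    · exact_mod_cast Complex.norm_natCast (n + 1)
    · simp
  rw [logFactor, sub_eq_add_neg, norm_mul, hn, logBound]
  have h9 : ‖Complex.log (1 + -q ^ (n + 1))‖ ≤ ((1 - r)⁻¹ / 2 + 1) * r ^ (n + 1) :=
    (h2.trans h4).trans (mul_le_mul_of_nonneg_left h3 (by linarith))
  calc _ ≤ ((1 - r)⁻¹ / 2 + 1) * r ^ (n + 1) * (((n : ℝ) + 1) / 2) :=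
        mul_le_mul_of_nonneg_right h9 (by positivity)
    _ = _ := by ring

theorem summable_logBound {r : ℝ} (hr0 : 0 ≤ r) (hr : r < 1) : Summable (logBound r) := by
  have h1 := summable_pow_mul_geometric_of_norm_lt_one 1
    (show ‖r‖ < 1 by rwa [Real.norm_of_nonneg hr0])
  have h2 := (summable_nat_add_iff 1).2 h1
  simp only [pow_one] at h2
  refine Summable.mul_left _ ?_
  simpa using h2

theorem summable_logFactor {q : ℂ} (hq1 : ‖q‖ < 1) : Summable fun n => logFactor n q :=
  Summable.of_norm_bounded (summable_logBound (norm_nonneg q) hq1)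
    (norm_logFactor_le hq1 le_rfl)

theorem hasProd_sqrtMacMahon {q : ℂ} (hq1 : ‖q‖ < 1) :
    HasProd (fun n : ℕ => (1 - q ^ (n + 1)) ^ (-((n : ℂ) + 1) / 2)) (sqrtMacMahon q) := by
  have h := (summable_logFactor hq1).hasSum.cexp
  refine h.congr_fun fun n => ?_
  rw [Function.comp_apply, Complex.cpow_def_of_ne_zero (one_sub_pow_ne_zero hq1 (Nat.succ_pos n))]
  rfl

theorem sqrtMacMahon_ne_zero (q : ℂ) : sqrtMacMahon q ≠ 0 := Complex.exp_ne_zero _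

/-- On each smaller disc the logarithms converge uniformly, and 1 - q^{n+1} avoids the cut of the
principal logarithm. -/
theorem continuousOn_sqrtMacMahon : ContinuousOn sqrtMacMahon {q : ℂ | ‖q‖ < 1} := by
  have hball : ∀ r : ℝ, 0 ≤ r → r < 1 → ContinuousOn sqrtMacMahon {q : ℂ | ‖q‖ < r} := by
    intro r hr0 hr
    refine Complex.continuous_exp.comp_continuousOn ?_
    refine continuousOn_tsum (fun n => ?_) (summable_logBound hr0 hr)
      fun n q hq => norm_logFactor_le hr (le_of_lt hq) n
    refine ContinuousOn.mul ?_ continuousOn_const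
    refine ContinuousOn.clog (by fun_prop) fun q hq => ?_
    rw [sub_eq_add_neg]
    exact Complex.mem_slitPlane_of_norm_lt_one
      ((norm_pow_succ_le hr (le_of_lt hq) n).trans_lt hr)
  intro q hq
  obtain ⟨r, h1, h2⟩ := exists_between (show ‖q‖ < 1 from hq)
  have h3 : {q : ℂ | ‖q‖ < r} ∈ 𝓝 q := (isOpen_lt continuous_norm continuous_const).mem_nhds h1
  exact ((hball r ((norm_nonneg q).trans h1.le) h2).continuousAt h3).continuousWithinAt

theorem sqrtMacMahon_pos {x : ℝ} (hx0 : 0 < x) (hx1 : x < 1) :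
    ∃ y : ℝ, 0 < y ∧ sqrtMacMahon (x : ℂ) = (y : ℂ) := by
  refine ⟨Real.exp (∑' n : ℕ, Real.log (1 - x ^ (n + 1)) * (-((n : ℝ) + 1) / 2)), Real.exp_pos _, ?_⟩
  rw [sqrtMacMahon, Complex.ofReal_exp, Complex.ofReal_tsum]
  congr 2
  ext n
  have h1 : 0 ≤ 1 - x ^ (n + 1) := sub_nonneg.2 (pow_le_one₀ hx0.le hx1.le)
  rw [logFactor, Complex.ofReal_mul, Complex.ofReal_log h1]
  push_cast
  rfl

theorem hasProd_sqrtMacMahon_sq {q : ℂ} (hq1 : ‖q‖ < 1) :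
    HasProd (fun n : ℕ => ((1 - q ^ (n + 1)) ^ (n + 1))⁻¹) (sqrtMacMahon q ^ 2) := by
  have h := (hasProd_sqrtMacMahon hq1).mul (hasProd_sqrtMacMahon hq1)
  rw [← sq] at h
  refine h.congr_fun fun n => ?_
  rw [← Complex.cpow_add _ _ (one_sub_pow_ne_zero hq1 (Nat.succ_pos n))]
  have : (-((n : ℂ) + 1) / 2 + -((n : ℂ) + 1) / 2) = -((n + 1 : ℕ) : ℂ) := by push_cast; ring
  rw [this, Complex.cpow_neg, Complex.cpow_natCast]

theorem hookFactor_bot (q : ℂ) (p : ℕ × ℕ) : hookFactor ⊥ q p = (1 - q ^ (p.1 + p.2 + 1))⁻¹ := by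
  rw [hookFactor, rowLen_bot, colLen_bot, ← zpow_natCast]
  congr 3
  push_cast; ring

/-- The n + 1 pairs with i + j = n contribute equal factors, so grouping by antidiagonals turns the
double product into the single one. -/
theorem sqrtMacMahon_sq {q : ℂ} (hq0 : q ≠ 0) (hq1 : ‖q‖ < 1) : sqrtMacMahon q ^ 2 = macMahon q := by
  have h1 := (multipliable_hookFactor hq0 hq1 ⊥).hasProd
  rw [← (Finset.HasAntidiagonal.sigmaAntidiagonalEquivProd (A := ℕ)).hasProd_iff] at h1
  have h2 := h1.sigma (g := fun n => ((1 - q ^ (n + 1)) ^ (n + 1))⁻¹) fun n => by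
    have h3 := hasProd_fintype (fun c : Finset.HasAntidiagonal.antidiagonal n =>
      hookFactor ⊥ q (c : ℕ × ℕ))
    have h4 : ∏ c : Finset.HasAntidiagonal.antidiagonal n, hookFactor ⊥ q (c : ℕ × ℕ) =
        ((1 - q ^ (n + 1)) ^ (n + 1))⁻¹ := by
      rw [Finset.prod_coe_sort (Finset.HasAntidiagonal.antidiagonal n) (fun c => hookFactor ⊥ q c),
        Finset.prod_congr rfl (g := fun _ => (1 - q ^ (n + 1))⁻¹), Finset.prod_const,
        Finset.Nat.card_antidiagonal, inv_pow]
      intro c hc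
      rw [hookFactor_bot, Finset.HasAntidiagonal.mem_antidiagonal.1 hc]
    rw [h4] at h3
    exact h3
  exact (hasProd_sqrtMacMahon_sq hq1).unique h2

/-! ### Branches of square roots -/

theorem isPreconnected_puncturedDisc : IsPreconnected {q : ℂ | q ≠ 0 ∧ ‖q‖ < 1} := by
  have h1 : {q : ℂ | q ≠ 0 ∧ ‖q‖ < 1} =
      (fun p : ℝ × ℝ => (p.1 : ℂ) * Complex.exp (p.2 * Complex.I)) ''
        (Set.Ioo (0 : ℝ) 1 ×ˢ Set.univ) := by
    ext q
    constructor
    · rintro ⟨h0, h1⟩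
      exact ⟨(‖q‖, Complex.arg q), ⟨⟨norm_pos_iff.2 h0, h1⟩, trivial⟩,
        Complex.norm_mul_exp_arg_mul_I q⟩
    · rintro ⟨⟨r, θ⟩, ⟨⟨h0, h1⟩, -⟩, rfl⟩
      simp only at h0 h1
      refine ⟨mul_ne_zero (Complex.ofReal_ne_zero.2 h0.ne') (Complex.exp_ne_zero _), ?_⟩
      rw [norm_mul, Complex.norm_exp_ofReal_mul_I, mul_one, Complex.norm_real,
        Real.norm_of_nonneg h0.le]
      exact h1
  rw [h1]
  refine (isPreconnected_Ioo.prod isPreconnected_univ).image _ ?_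
  fun_prop

/-- Two continuous roots of a nonvanishing function on a connected set agree up to one global sign,
and positivity at 1/2 fixes it. -/
theorem IsSqrtBranch.eqOn {f g g' : ℂ → ℂ} (hg : IsSqrtBranch f g) (hg' : IsSqrtBranch f g')
    (hf : ∀ q : ℂ, q ≠ 0 → ‖q‖ < 1 → f q ≠ 0) {q : ℂ} (hq0 : q ≠ 0) (hq1 : ‖q‖ < 1) :
    g q = g' q := by
  have hmem : ((1 / 2 : ℝ) : ℂ) ∈ {q : ℂ | q ≠ 0 ∧ ‖q‖ < 1} :=
    ⟨by norm_num, by rw [Complex.norm_real]; norm_num⟩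
  have hsq : Set.EqOn (g ^ 2) (g' ^ 2) {q : ℂ | q ≠ 0 ∧ ‖q‖ < 1} := fun z hz => by
    rw [Pi.pow_apply, Pi.pow_apply, hg.sq_eq z hz.1 hz.2, hg'.sq_eq z hz.1 hz.2]
  refine isPreconnected_puncturedDisc.eq_of_sq_eq hg.continuousOn hg'.continuousOn hsq
    (fun {z} hz h0 => ?_) hmem ?_ ⟨hq0, hq1⟩
  · refine hf z hz.1 hz.2 ?_
    rw [← hg'.sq_eq z hz.1 hz.2, h0]; simp
  · obtain ⟨y, hy, hgy⟩ := hg.pos (1 / 2) (by norm_num) (by norm_num)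
    obtain ⟨y', hy', hgy'⟩ := hg'.pos (1 / 2) (by norm_num) (by norm_num)
    have h1 := hsq hmem
    rw [Pi.pow_apply, Pi.pow_apply, hgy, hgy'] at h1
    rw [hgy, hgy', (pow_left_inj₀ hy.le hy'.le two_ne_zero).1 (by exact_mod_cast h1)]

theorem isSqrtBranch_sqrtBranch {f g : ℂ → ℂ} (hg : IsSqrtBranch f g) :
    IsSqrtBranch f (sqrtBranch f) := Classical.epsilon_spec ⟨g, hg⟩

theorem isSqrtBranch_aux {f : ℂ → ℂ} (lam : YoungDiagram) (k : ℕ)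
    (hf : ∀ q : ℂ, q ≠ 0 → ‖q‖ < 1 → f q = macMahon q * (q ^ k / hookProd lam q) ^ 2) :
    IsSqrtBranch f fun q => sqrtMacMahon q * (q ^ k / hookProd lam q) where
  continuousOn := by
    refine (continuousOn_sqrtMacMahon.mono fun q hq => hq.2).mul ?_
    refine ContinuousOn.div (by fun_prop) ?_ fun q hq => hookProd_ne_zero hq.2 lam
    unfold hookProd
    fun_prop
  sq_eq q hq0 hq1 := by rw [hf q hq0 hq1, mul_pow, sqrtMacMahon_sq hq0 hq1]
  pos x hx0 hx1 := by
    obtain ⟨y, hy, hxy⟩ := sqrtMacMahon_pos hx0 hx1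
    refine ⟨y * (x ^ k / ∏ c ∈ lam.cells, (1 - x ^ hookLen lam c)), ?_, ?_⟩
    · refine mul_pos hy (div_pos (pow_pos hx0 k) (Finset.prod_pos fun c hc => ?_))
      exact sub_pos.2 (pow_lt_one₀ hx0.le hx1 (hookLen_pos hc).ne')
    · rw [hxy, hookProd]
      push_cast
      rfl

theorem macMahon_mul_ne_zero {q : ℂ} (hq0 : q ≠ 0) (hq1 : ‖q‖ < 1) (lam : YoungDiagram) (k : ℕ) :
    macMahon q * (q ^ k / hookProd lam q) ^ 2 ≠ 0 := by
  rw [← sqrtMacMahon_sq hq0 hq1]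
  exact mul_ne_zero (pow_ne_zero _ (sqrtMacMahon_ne_zero q))
    (pow_ne_zero _ (div_ne_zero (pow_ne_zero _ hq0) (hookProd_ne_zero hq1 lam)))

theorem isSqrtBranch_normSq (lam : YoungDiagram) : IsSqrtBranch (normSq lam)
    fun q => sqrtMacMahon q * (q ^ rowWeight lam.transpose / hookProd lam q) :=
  isSqrtBranch_aux lam _ fun _ hq0 hq1 => normSq_eq hq0 hq1 lam

theorem isSqrtBranch_normSq' (lam : YoungDiagram) : IsSqrtBranch (normSq' lam)
    fun q => sqrtMacMahon q * (q ^ (lam.card + rowWeight lam) / hookProd lam q) :=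
  isSqrtBranch_aux lam _ fun _ hq0 hq1 => normSq'_eq hq0 hq1 lam

theorem norm_eq {q : ℂ} (hq0 : q ≠ 0) (hq1 : ‖q‖ < 1) (lam : YoungDiagram) :
    norm lam q = sqrtMacMahon q * (q ^ rowWeight lam.transpose / hookProd lam q) :=
  (isSqrtBranch_sqrtBranch (isSqrtBranch_normSq lam)).eqOn (isSqrtBranch_normSq lam)
    (fun _ hq0 hq1 => by rw [normSq_eq hq0 hq1]; exact macMahon_mul_ne_zero hq0 hq1 _ _) hq0 hq1

theorem norm'_eq {q : ℂ} (hq0 : q ≠ 0) (hq1 : ‖q‖ < 1) (lam : YoungDiagram) :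
    norm' lam q = (-1) ^ lam.card *
      (sqrtMacMahon q * (q ^ (lam.card + rowWeight lam) / hookProd lam q)) := by
  rw [norm', (isSqrtBranch_sqrtBranch (isSqrtBranch_normSq' lam)).eqOn (isSqrtBranch_normSq' lam)
    (fun _ hq0 hq1 => by rw [normSq'_eq hq0 hq1]; exact macMahon_mul_ne_zero hq0 hq1 _ _) hq0 hq1]

theorem norm_bot {q : ℂ} (hq0 : q ≠ 0) (hq1 : ‖q‖ < 1) : norm ⊥ q = sqrtMacMahon q := by
  rw [norm_eq hq0 hq1, rowWeight_transpose, hookProd]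
  simp

theorem neg_one_pow_mul_norm' (lam : YoungDiagram) :
    (fun z => (-1) ^ lam.card * norm' lam z) = sqrtBranch (normSq' lam) := by
  ext z
  rw [norm', ← mul_assoc, ← mul_pow]
  simp

/-! ### The Hopf-link invariant -/

theorem transpose_bot : (⊥ : YoungDiagram).transpose = ⊥ := by
  ext c
  simp [YoungDiagram.mem_transpose]

theorem schur_bot (x : ℕ → ℂ) : schur ⊥ x = 1 := by
  have h0 : ∀ (T : SkewSSYT ⊥ ⊥) (i j : ℕ), T.entry i j = 0 := fun T i j => T.zeros i j (by simp)
  obtain ⟨T0, -⟩ := exists_entry_eq (μ := ⊥) (N := 0) (f := fun _ _ => 0)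
    ⟨fun _ _ _ _ _ => le_rfl, fun _ _ _ _ h => by rw [rowLen_bot] at h; omega, fun _ _ _ => rfl,
      fun _ _ h => by rw [rowLen_bot] at h; omega⟩
  rw [schur_eq_tsum, tsum_eq_single T0]
  · simp [tabWeight]
  · intro T hT
    refine absurd (SkewSSYT.entry_injective _ _ ?_) hT
    ext i j
    rw [h0, h0]

theorem vertex_bot (q t : ℂ) (mu nu : YoungDiagram) :
    vertex q t ⊥ mu nu = q ^ (kappa mu / 2) * schur nu.transpose (fun i => t * qSeq q ⊥ i) *
      schur mu (fun i => t * qSeq q nu.transpose i) := by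
  rw [vertex, finsum_eq_single _ ⊥]
  · rw [transpose_bot, ← schur, ← schur, schur_bot, one_mul]
  · intro eta heta
    rw [transpose_bot, skewSchur, if_neg (fun h => heta (le_bot_iff.1 h)), zero_mul]

theorem vertex_bot_eq {q t : ℂ} (mu lam : YoungDiagram) :
    vertex q t ⊥ mu lam.transpose = q ^ (kappa mu / 2) * t ^ (lam.card + mu.card) *
      (schur mu (qSeq q lam) * schur lam (qSeq q ⊥)) := by
  rw [vertex_bot, YoungDiagram.transpose_transpose, schur_smul, schur_smul, pow_add]
  ring

/-- The definition gives the Schur factors with λ and μ exchanged; `schur_symm` brings them to the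
common form. -/
theorem hopfLink_eq {q t : ℂ} (hq0 : q ≠ 0) (hq1 : ‖q‖ < 1) (lam mu : YoungDiagram) :
    hopfLink q t lam mu = q ^ (kappa lam / 2 + kappa mu / 2) * t ^ (lam.card + mu.card) *
      (schur mu (qSeq q lam) * schur lam (qSeq q ⊥)) := by
  rw [hopfLink, vertex_bot_eq, schur_symm hq0 hq1, zpow_add₀ hq0, add_comm mu.card]
  ring

theorem dualBraKet_eq {q : ℂ} (hq1 : ‖q‖ < 1) (lam mu : YoungDiagram) :
    dualBraKet q lam mu =
      norm' lam q * ((-1) ^ mu.card * (q ^ mu.card * schur mu (qSeq q lam))) := by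
  have hx : Summable fun i => ‖q * qSeq q lam i‖ := by
    simpa [norm_mul] using (summable_norm_qSeq hq1 lam).mul_left ‖q‖
  have h1 : ∀ d, dualBra q lam d (ket mu) = if mu.card = d then
      norm' lam q * ((-1) ^ mu.card * (q ^ mu.card * schur mu (qSeq q lam))) else 0 := by
    intro d
    rw [← schur_smul, schur_eq_jacobiTrudi mu hx le_rfl, ← mul_ite_zero,
      ← vacBra_expPart_ket (isNewton_newtonSeq _) mu le_rfl d]
    rfl
  rw [dualBraKet, finsum_eq_single _ mu.card, h1, if_pos rfl]
  intro d hd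
  rw [h1, if_neg hd.symm]

theorem braDualKet_eq {q : ℂ} (hq1 : ‖q‖ < 1) (lam mu : YoungDiagram) :
    braDualKet q mu.transpose lam.transpose =
      norm lam.transpose q * schur mu (qSeq q lam) := by
  have h1 : ∀ d, bra mu.transpose (dualKet q lam.transpose d) = if mu.card = d then
      norm lam.transpose q * schur mu (qSeq q lam) else 0 := by
    intro d
    rw [schur_eq_jacobiTrudi mu (summable_norm_qSeq hq1 lam) le_rfl, ← mul_ite_zero,
      ← bra_expPart_one (isNewton_newtonSeq _) mu le_rfl d, dualKet, map_smul, smul_eq_mul,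
      YoungDiagram.transpose_transpose]
  rw [braDualKet, finsum_eq_single _ mu.card, h1, if_pos rfl]
  intro d hd
  rw [h1, if_neg hd.symm]

theorem hopfLink_eq_dualBraKet {q t : ℂ} (hq0 : q ≠ 0) (hq1 : ‖q‖ < 1) (ht : t ^ 2 = q)
    (lam mu : YoungDiagram) :
    hopfLink q t lam mu =
      q ^ (kappa lam / 2 + kappa mu / 2) * (-t⁻¹) ^ (lam.card + mu.card) *
        (norm ⊥ q)⁻¹ * dualBraKet q lam mu := by
  have ht0 : t ≠ 0 := by rintro rfl; exact hq0 (by rw [← ht]; simp)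
  -- For each box (-t⁻¹)(-1)q = t. The λ factors come from N'_λ, and the μ factors from the sign of
  -- the ket and from the variables being q times `qSeq q lam`.
  have h1 : (-t⁻¹) ^ (lam.card + mu.card) * (-1) ^ lam.card * (-1) ^ mu.card *
      q ^ lam.card * q ^ mu.card = t ^ (lam.card + mu.card) := by
    rw [mul_assoc _ _ ((-1) ^ mu.card), ← pow_add, ← mul_pow, mul_assoc, ← pow_add, ← mul_pow, ← ht]
    congr 1
    field_simp
  have h2 := mul_inv_cancel₀ (sqrtMacMahon_ne_zero q)
  rw [hopfLink_eq hq0 hq1, dualBraKet_eq hq1, norm_bot hq0 hq1, norm'_eq hq0 hq1,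
    schur_principal hq0 hq1, ← h1, pow_add q lam.card, mul_div_assoc]
  linear_combination (-(q ^ (kappa lam / 2 + kappa mu / 2) * ((-t⁻¹) ^ (lam.card + mu.card) *
    (-1) ^ lam.card * (-1) ^ mu.card * q ^ lam.card * q ^ mu.card) *
      (schur mu (qSeq q lam) * (q ^ rowWeight lam / hookProd lam q)))) * h2

theorem hopfLink_eq_braDualKet {q t : ℂ} (hq0 : q ≠ 0) (hq1 : ‖q‖ < 1) (lam mu : YoungDiagram) :
    hopfLink q t lam mu =
      q ^ (kappa lam / 2 + kappa mu / 2) * t ^ (lam.card + mu.card) *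
        (norm ⊥ q)⁻¹ * braDualKet q mu.transpose lam.transpose := by
  have h2 := mul_inv_cancel₀ (sqrtMacMahon_ne_zero q)
  rw [hopfLink_eq hq0 hq1, braDualKet_eq hq1, norm_bot hq0 hq1, norm_eq hq0 hq1,
    schur_principal hq0 hq1, YoungDiagram.transpose_transpose, hookProd_transpose]
  linear_combination (-(q ^ (kappa lam / 2 + kappa mu / 2) * t ^ (lam.card + mu.card) *
      (schur mu (qSeq q lam) * (q ^ rowWeight lam / hookProd lam q)))) * h2

theorem hopfLink_eq_vertex {q t : ℂ} (hq0 : q ≠ 0) (hq1 : ‖q‖ < 1) (lam mu : YoungDiagram) :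
    hopfLink q t lam mu = q ^ (kappa lam / 2) * vertex q t ⊥ mu lam.transpose := by
  rw [hopfLink_eq hq0 hq1, vertex_bot_eq, zpow_add₀ hq0]
  ring

end SDual

end

/-! ### The proposition -/

theorem mainTheorem1 (q t : ℂ) (hq0 : q ≠ 0) (hq1 : ‖q‖ < 1) (ht : t ^ 2 = q) :
    (∀ ν : YoungDiagram,
      Multipliable (SDual.hookFactor ν q) ∧
      SDual.IsSqrtBranch (SDual.normSq ν) (SDual.norm ν) ∧
      SDual.IsSqrtBranch (SDual.normSq' ν) (fun z => (-1) ^ ν.card * SDual.norm' ν z)) ∧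
    (∀ lam mu : YoungDiagram,
      SDual.hopfLink q t lam mu =
        q ^ (SDual.kappa lam / 2 + SDual.kappa mu / 2) * (-t⁻¹) ^ (lam.card + mu.card) *
          (SDual.norm ⊥ q)⁻¹ * SDual.dualBraKet q lam mu ∧
      SDual.hopfLink q t lam mu =
        q ^ (SDual.kappa lam / 2 + SDual.kappa mu / 2) * t ^ (lam.card + mu.card) *
          (SDual.norm ⊥ q)⁻¹ * SDual.braDualKet q mu.transpose lam.transpose ∧
      SDual.hopfLink q t lam mu =
        q ^ (SDual.kappa lam / 2) * SDual.vertex q t ⊥ mu lam.transpose) ∧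
    HasProd (fun n : ℕ => (1 - q ^ (n + 1)) ^ (-((n : ℂ) + 1) / 2)) (SDual.norm ⊥ q) ∧
    HasProd (fun n : ℕ => ((1 - q ^ (n + 1)) ^ (n + 1))⁻¹) (SDual.norm ⊥ q ^ 2) := by
  refine ⟨fun ν => ⟨SDual.multipliable_hookFactor hq0 hq1 ν,
    SDual.isSqrtBranch_sqrtBranch (SDual.isSqrtBranch_normSq ν), ?_⟩, fun lam mu => ?_, ?_, ?_⟩
  · rw [SDual.neg_one_pow_mul_norm']
    exact SDual.isSqrtBranch_sqrtBranch (SDual.isSqrtBranch_normSq' ν)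
  · exact ⟨SDual.hopfLink_eq_dualBraKet hq0 hq1 ht lam mu,
      SDual.hopfLink_eq_braDualKet hq0 hq1 lam mu, SDual.hopfLink_eq_vertex hq0 hq1 lam mu⟩
  · rw [SDual.norm_bot hq0 hq1]
    exact SDual.hasProd_sqrtMacMahon hq1
  · rw [SDual.norm_bot hq0 hq1]
    exact SDual.hasProd_sqrtMacMahon_sq hq1
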